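/- **Formulae and proofs.** Formulae of multiplicative linear logic with units (MLL) are $A ::= X \mid \mathbf 1 \mid \bot \mid A\otimes A \mid A ⅋ A$, where $X$ ranges over countably many atoms carrying a fixed-point-free involution $X\mapsto X^\perp$, extended by $\mathbf 1^\perp=\bot$, $\bot^\perp=\mathbf 1$, $(A\otimes B)^\perp=A^\perp⅋ B^\perp$, $(A⅋ B)^\perp=A^\perp\otimes B^\perp$. The fragment $(\neg\bot\otimes)LL$ consists of the formulae of kind $A$ or $E$ of the grammar $$A ::= X \mid \mathbf 1 \mid A\otimes A \mid A⅋ A \mid A⅋ E \mid E⅋ A,\qquad E ::= \bot \mid E⅋ E .$$ The sequent calculus has the rules ax ($\vdash A,A^\perp$); cut (from $\vdash\Gamma,A$ and $\vdash A^\perp,\Delta$ infer $\vdash\Gamma,\Delta$); exchange of two consecutive formulae; $\otimes$ (from $\vdash\Gamma,A$ and $\vdash B,\Delta$ infer $\vdash\Gamma,A\otimes B,\Delta$); $\mathbf 1$ ($\vdash\mathbf 1$); $⅋$ (from $\vdash\Gamma,A,B$ infer $\vdash\Gamma,A⅋ B$); $\bot$ (from $\vdash\Gamma$ infer $\vdash\Gamma,\bot$).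 A proof is in a fragment if all formulae of all its sequents are in it. **Proof-structures.** A proof-structure $R$ is a finite directed multigraph without directed cycles, whose nodes are labelled by $\mathtt{ax},\mathtt{cut},\mathtt 1,\bot,\otimes,⅋,\bullet$ and have respectively $0,2,0,0,2,2,1$ premises (incoming arcs) and $2,0,1,1,1,1,0$ conclusions (outgoing arcs); the two premises of each $\otimes$ or $⅋$ node are ordered (left, right), the conclusions of $R$ (the premises of $\bullet$ nodes) are totally ordered, and arcs are typed by formulae: dual types for the two conclusions of an $\mathtt{ax}$ node and for the two premises of a $\mathtt{cut}$ node, $\mathbf 1$ (resp. $\bot$) for the conclusion of a $\mathtt 1$ (resp. $\bot$) node, and $A\otimes B$ (resp. $A⅋ B$) for the conclusion of a $\otimes$ (resp. $⅋$) node with left and right premises of types $A$, $B$. Moreover $R$ comes with a partial jump function $J_R$ from its $\bot$ nodes to its nodes; $R$ is jump-free if $\operatorname{dom}(J_R)=\emptyset$. $R$ is a proof-structure of a fragment if all its arcs are typed in the fragment, and cut-free if it has no $\mathtt{cut}$ node. Write $n\prec n'$ if there is a non-empty directed path from $n$ to $n'$ (jumps are not used). Erasing nodes are defined by induction on $\prec$: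 a node is erasing if it is a $\bot$, $⅋$ or $\bullet$ node all of whose premises are conclusions of erasing nodes. **Correctness.** A switching $\varphi$ chooses one premise of each $⅋$ node. The switching graph $R^\varphi$ is obtained from $R$ by redirecting the other premise of each $⅋$ node to a fresh $\bullet$ node, and adding an arc from $n$ to $J_R(n)$ for every $n\in\operatorname{dom}(J_R)$. Then $R\models \mathsf{ACC}_{\sharp\mathsf w}$ means that, for every switching $\varphi$, $R^\varphi$ has no undirected cycle and the number of its connected components is the number of $\bot$ nodes of $R$, minus the cardinality of $\operatorname{dom}(J_R)$, plus one. **Canonical jumps.** Let $\mathsf w_⅋(R)$ be the set of the $\bot$ nodes $n$ such that $n\prec n_0$ for some non-erasing $⅋$ node $n_0$, and $\mathsf w_{\mathsf e}(R)$ the set of the other $\bot$ nodes. For $R$ a cut-free proof-structure of $(\neg\bot\otimes)LL$ and $m$ a node of $R$, $\langle R\rangle_{\mathsf w}^m$ is the proof-structure obtained from $R$ by replacing the jump function as follows: each $n\in\mathsf w_⅋(R)$ jumps to the (unique) non-erasing node whose conclusion is a premise of the $\prec$-least non-erasing $⅋$ node $n_0$ such that $n\prec n_0$, and each $n\in\mathsf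 w_{\mathsf e}(R)$ jumps to $m$. **Desequentialization with jumps.** The relation $\pi\Mapsto R$ between proofs $\pi$ and proof-structures $R$ is defined by induction on $\pi$, up to the names of nodes and arcs. An ax (resp. $\mathbf 1$) rule gives a single $\mathtt{ax}$ (resp. $\mathtt 1$) node with its conclusions; exchange exchanges the two conclusions; a $⅋$ rule plugs the last two conclusions into a new $⅋$ node; a $\otimes$ (resp. cut) rule plugs the last conclusion of the first structure and the first conclusion of the second one into a new $\otimes$ (resp. $\mathtt{cut}$) node, the two structures being disjoint (the $\bullet$ nodes of the plugged conclusions are removed, and must not be targets of jumps); a $\bot$ rule adds a new $\bot$ node, whose conclusion is the last one, with a jump to an arbitrary node of the structure obtained so far. The ordered conclusions of $R$ have as types the formulae of the conclusion of $\pi$. **Theorem.** Let $R$ be a cut-free, jump-free proof-structure of $(\neg\bot\otimes)LL$ such that $R\models\mathsf{ACC}_{\sharp\mathsf w}$, and let $m$ be a non-erasing node of $R$. Then there exists a cut-free sequent calculus proof $\pi$ in $(\neg\bot\otimes)LL$, whose conclusion is the sequence of the types of the conclusions of $R$, such that $\pi\Mapsto\langle R\rangle_{\mathsf w}^m$. 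-/

import Mathlib

namespace LL

/-! ### Formulae, fragments, sequent calculus -/

/-- Formulae of multiplicative linear logic with units. The atoms are `atom i b` with `i : ℕ` and
`b : Bool`: countably many, and negation exchanges `atom i true` with `atom i false`. -/
inductive Formula : Type
  | atom (i : ℕ) (b : Bool)
  | one
  | bot
  | tensor (A B : Formula)
  | par (A B : Formula)

/-- Linear negation. -/
def Formula.neg : Formula → Formula
  | .atom i b => .atom i (!b)
  | .one => .bot
  | .bot => .one
  | .tensor A B => .par A.neg B.neg
  | .par A B => .tensor A.neg B.neg

/-- Formulae of kind `E`:  `E ::= ⊥ | E ⅋ E`. -/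
inductive Formula.KindE : Formula → Prop
  | bot : KindE .bot
  | par {E E' : Formula} : KindE E → KindE E' → KindE (.par E E')

/-- Formulae of kind `A`:  `A ::= X | 1 | A ⊗ A | A ⅋ A | A ⅋ E | E ⅋ A`. -/
inductive Formula.KindA : Formula → Prop
  | atom (i : ℕ) (b : Bool) : KindA (.atom i b)
  | one : KindA .one
  | tensor {A B : Formula} : KindA A → KindA B → KindA (.tensor A B)
  | par {A B : Formula} : KindA A → KindA B → KindA (.par A B)
  | parE {A E : Formula} : KindA A → KindE E → KindA (.par A E)
  | Epar {E A : Formula} : KindE E → KindA A → KindA (.par E A)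

/-- The fragment `(¬⊥⊗)LL`: the formulae of kind `A` or of kind `E`. -/
def NBT : Set Formula := {F | F.KindA ∨ F.KindE}

/-- Sequent calculus proofs with a given conclusion. -/
inductive Proof : List Formula → Type
  | ax (A : Formula) : Proof [A, A.neg]
  | cut {Γ Δ : List Formula} {A : Formula} :
      Proof (Γ ++ [A]) → Proof (A.neg :: Δ) → Proof (Γ ++ Δ)
  | ex {Γ Δ : List Formula} {A B : Formula} :
      Proof (Γ ++ A :: B :: Δ) → Proof (Γ ++ B :: A :: Δ)
  | tensor {Γ Δ : List Formula} {A B : Formula} :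
      Proof (Γ ++ [A]) → Proof (B :: Δ) → Proof (Γ ++ Formula.tensor A B :: Δ)
  | one : Proof [Formula.one]
  | par {Γ : List Formula} {A B : Formula} :
      Proof (Γ ++ [A, B]) → Proof (Γ ++ [Formula.par A B])
  | bot {Γ : List Formula} : Proof Γ → Proof (Γ ++ [Formula.bot])

/-- A proof with no cut rule. -/
def Proof.CutFree : {Γ : List Formula} → Proof Γ → Prop
  | _, .ax _ => True
  | _, .cut _ _ => False
  | _, .ex p => p.CutFree
  | _, .tensor p q => p.CutFree ∧ q.CutFree
  | _, .one => True
  | _, .par p => p.CutFree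
  | _, .bot p => p.CutFree

/-- The sequents that occur in a proof. -/
def Proof.sequents {Γ : List Formula} (p : Proof Γ) : Set (List Formula) :=
  {Γ} ∪ match p with
    | .ax _ => ∅
    | .cut p q => p.sequents ∪ q.sequents
    | .ex p => p.sequents
    | .tensor p q => p.sequents ∪ q.sequents
    | .one => ∅
    | .par p => p.sequents
    | .bot p => p.sequents

/-- A proof in `F`: every sequent of the tree consists of formulae of `F`. -/
def Proof.InFragment (F : Set Formula) {Γ : List Formula} (p : Proof Γ) : Prop :=
  ∀ Δ ∈ p.sequents, ∀ A ∈ Δ, A ∈ F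

/-! ### Directed graphs (with possibly several arcs between two nodes) -/

/-- Directed multigraphs. An arc `a` is a conclusion of `tail a` and a premise of `head a`. -/
structure Multidigraph where
  Node : Type
  Arc : Type
  tail : Arc → Node
  head : Arc → Node

namespace Multidigraph

variable (G : Multidigraph)

/-- There is an arc from `m` to `n`. -/
def Step (m n : G.Node) : Prop := ∃ a, G.tail a = m ∧ G.head a = n

/-- `m ≺ n`: there is a non-empty directed path from `m` to `n`. -/
def Prec : G.Node → G.Node → Prop := Relation.TransGen G.Step

/-- The ends of the arc `a` are `m` and `n` (directions are ignored). -/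
def Joins (a : G.Arc) (m n : G.Node) : Prop :=
  (G.tail a = m ∧ G.head a = n) ∨ (G.tail a = n ∧ G.head a = m)

/-- The (undirected) cycle `ν 0, α 0, ν 1, …, α (k - 1), ν k = ν 0` of length `k > 0`: there is no
repetition of nodes except that the last one is the first one, and the first and the last arcs
differ when `k ≥ 2`. -/
structure IsCycle (k : ℕ) (ν : ℕ → G.Node) (α : ℕ → G.Arc) : Prop where
  pos : 0 < k
  joins : ∀ i < k, G.Joins (α i) (ν i) (ν (i + 1))
  closed : ν k = ν 0
  inj : ∀ i < k, ∀ j < k, ν i = ν j → i = j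
  arc_ne : 2 ≤ k → α 0 ≠ α (k - 1)

/-- No undirected cycle. -/
def Acyclic : Prop := ∀ k ν α, ¬ G.IsCycle k ν α

/-- The number of connected components. -/
noncomputable def numComponents : ℕ :=
  Nat.card (SimpleGraph.fromRel G.Step).ConnectedComponent

end Multidigraph

/-! ### Proof-structures -/

/-- Labels of nodes. -/
inductive Label : Type
  | ax | cut | one | bot | tensor | par | bullet

/-- Number of premises of a node. -/
def Label.numPremises : Label → ℕ
  | .ax => 0
  | .cut => 2
  | .one => 0
  | .bot => 0
  | .tensor => 2
  | .par => 2
  | .bullet => 1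

/-- Number of conclusions of a node. -/
def Label.numConclusions : Label → ℕ
  | .ax => 2
  | .cut => 0
  | .one => 1
  | .bot => 1
  | .tensor => 1
  | .par => 1
  | .bullet => 0

/-- The labels of the nodes whose two premises are ordered. -/
def Label.Binary (l : Label) : Prop := l = .tensor ∨ l = .par

/-- A (finite, typed) proof-structure of multiplicative linear logic with units, which comes with a
partial jump function from its `⊥` nodes to its nodes. -/
structure ProofStructure extends Multidigraph where
  finite_node : Finite Node
  finite_arc : Finite Arc
  /-- no directed cycle -/
  dag : ∀ n, ¬ toMultidigraph.Prec n n
  label : Node → Label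
  card_premises : ∀ n, {a | head a = n}.ncard = (label n).numPremises
  card_conclusions : ∀ n, {a | tail a = n}.ncard = (label n).numConclusions
  /-- the left premise of a `⊗` or `⅋` node -/
  left : ∀ n, (label n).Binary → Arc
  /-- the right premise of a `⊗` or `⅋` node -/
  right : ∀ n, (label n).Binary → Arc
  head_left : ∀ n h, head (left n h) = n
  head_right : ∀ n h, head (right n h) = n
  left_ne_right : ∀ n h, left n h ≠ right n h
  /-- the ordered conclusions, i.e. the premises of `•` nodes -/
  concl : List Arc
  concl_nodup : concl.Nodup
  mem_concl : ∀ a, a ∈ concl ↔ label (head a) = .bullet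
  /-- the types of the arcs -/
  ty : Arc → Formula
  ty_ax : ∀ a b, a ≠ b → tail a = tail b → label (tail a) = .ax → ty a = (ty b).neg
  ty_cut : ∀ a b, a ≠ b → head a = head b → label (head a) = .cut → ty a = (ty b).neg
  ty_one : ∀ a, label (tail a) = .one → ty a = .one
  ty_bot : ∀ a, label (tail a) = .bot → ty a = .bot
  ty_tensor : ∀ a (h : label (tail a) = .tensor),
    ty a = .tensor (ty (left (tail a) (Or.inl h))) (ty (right (tail a) (Or.inl h)))
  ty_par : ∀ a (h : label (tail a) = .par),
    ty a = .par (ty (left (tail a) (Or.inr h))) (ty (right (tail a) (Or.inr h)))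
  /-- the partial jump function -/
  jump : Node → Option Node
  jump_bot : ∀ n, (jump n).isSome → label n = .bot

namespace ProofStructure

/-- All the arcs are typed by formulae of `F`. -/
def InFragment (R : ProofStructure) (F : Set Formula) : Prop := ∀ a, R.ty a ∈ F

/-- No cut node. -/
def CutFree (R : ProofStructure) : Prop := ∀ n, R.label n ≠ .cut

/-- The jump function has an empty domain. -/
def JumpFree (R : ProofStructure) : Prop := ∀ n, R.jump n = none

/-- Erasing nodes: the `⊥`, `⅋` or `•` nodes whose premises are all conclusions of erasing nodes. -/
inductive Erasing (R : ProofStructure) : R.Node → Prop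
  | intro (n : R.Node) (hl : R.label n = .bot ∨ R.label n = .par ∨ R.label n = .bullet)
      (hp : ∀ a, R.head a = n → Erasing R (R.tail a)) : Erasing R n

/-! #### Switchings and correctness -/

/-- A switching chooses a premise of every `⅋` node. -/
structure Switching (R : ProofStructure) where
  choice : {n // R.label n = .par} → R.Arc
  head_choice : ∀ n, R.head (choice n) = n

open Classical in
/-- The switching graph: there is a fresh `•` node `Sum.inr n` for every `⅋` node `n`, which becomes
the head of the premise of `n` that is not chosen, and an arc `Sum.inr n` from `n` to the target of
its jump for every `n` in the domain of the jump function. -/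
noncomputable def switchingGraph (R : ProofStructure) (φ : R.Switching) : Multidigraph where
  Node := R.Node ⊕ {n // R.label n = .par}
  Arc := R.Arc ⊕ {n // (R.jump n).isSome}
  tail
    | .inl a => .inl (R.tail a)
    | .inr n => .inl n.1
  head
    | .inl a =>
      if h : R.label (R.head a) = .par then
        if a = φ.choice ⟨R.head a, h⟩ then .inl (R.head a) else .inr ⟨R.head a, h⟩
      else .inl (R.head a)
    | .inr n => .inl ((R.jump n.1).get n.2)

/-- The condition `AC`: every switching graph is acyclic. -/
def AC (R : ProofStructure) : Prop := ∀ φ : R.Switching, (R.switchingGraph φ).Acyclic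

/-- The condition `C_#w`: the number of connected components of every switching graph is one more
than the number of `⊥` nodes without a jump. -/
def Cw (R : ProofStructure) : Prop := ∀ φ : R.Switching,
  (R.switchingGraph φ).numComponents =
    {n | R.label n = .bot}.ncard - {n | (R.jump n).isSome}.ncard + 1

/-- The condition `ACC_#w`. -/
def ACCw (R : ProofStructure) : Prop := R.AC ∧ R.Cw

/-! #### Canonical jumps -/

/-- `n₀` is a non-erasing `⅋` node below `n`. -/
def NonErasingParBelow (R : ProofStructure) (n n₀ : R.Node) : Prop :=
  R.label n₀ = .par ∧ ¬ R.Erasing n₀ ∧ R.Prec n n₀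

/-- The `⊥` nodes with a non-erasing `⅋` node below them. -/
def wPar (R : ProofStructure) : Set R.Node :=
  {n | R.label n = .bot ∧ ∃ n₀, R.NonErasingParBelow n n₀}

/-- The other `⊥` nodes. -/
def wE (R : ProofStructure) : Set R.Node := {n | R.label n = .bot} \ R.wPar

/-- `n'` is a non-erasing node whose conclusion is a premise of the least non-erasing `⅋` node below
`n`. In a cut-free proof-structure of `(¬⊥⊗)LL`, every `n ∈ R.wPar` has exactly one such `n'`. -/
def IsCanonicalTarget (R : ProofStructure) (n n' : R.Node) : Prop :=
  ∃ n₀, R.NonErasingParBelow n n₀ ∧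
    (∀ n₁, R.NonErasingParBelow n n₁ → n₀ = n₁ ∨ R.Prec n₀ n₁) ∧
    ¬ R.Erasing n' ∧ ∃ a, R.tail a = n' ∧ R.head a = n₀

open Classical in
/-- The jump function of `⟨R⟩_w^m`: every node of `wPar` jumps to its canonical target, every node of
`wE` jumps to `m`, and there is no other jump. -/
noncomputable def canonicalJump (R : ProofStructure) (m n : R.Node) : Option R.Node :=
  if n ∈ R.wPar then
    if h : ∃ n', R.IsCanonicalTarget n n' then some h.choose else none
  else if n ∈ R.wE then some m
  else none

/-- The proof-structure `⟨R⟩_w^m`: the jumps of `R` are replaced by the canonical ones. -/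
noncomputable def canonicalExt (R : ProofStructure) (m : R.Node) : ProofStructure where
  toMultidigraph := R.toMultidigraph
  finite_node := R.finite_node
  finite_arc := R.finite_arc
  dag := R.dag
  label := R.label
  card_premises := R.card_premises
  card_conclusions := R.card_conclusions
  left := R.left
  right := R.right
  head_left := R.head_left
  head_right := R.head_right
  left_ne_right := R.left_ne_right
  concl := R.concl
  concl_nodup := R.concl_nodup
  mem_concl := R.mem_concl
  ty := R.ty
  ty_ax := R.ty_ax
  ty_cut := R.ty_cut
  ty_one := R.ty_one
  ty_bot := R.ty_bot
  ty_tensor := R.ty_tensor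
  ty_par := R.ty_par
  jump := R.canonicalJump m
  jump_bot := by
    intro n hn
    unfold canonicalJump at hn
    split_ifs at hn with h1 h2 h3
    · exact h1.1
    · simp at hn
    · exact h3.1
    · simp at hn

/-! #### Desequentialization with jumps -/

/-- `R₁` is a part of `R`, except that the `•` nodes of `R₁` in `S` do not survive in `R`: their
premises are plugged into other nodes of `R`. Thus `node x`, for `x ∈ S`, is the new head of the
premise of `x`. Everything else of `R₁` is kept as it is in `R`, and no jump of `R₁` goes to a node
that does not survive. -/
structure Part (R₁ R : ProofStructure) (S : Set R₁.Node) where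
  node : R₁.Node → R.Node
  arc : R₁.Arc → R.Arc
  arc_inj : Function.Injective arc
  node_inj : Set.InjOn node Sᶜ
  tail_arc : ∀ a, R.tail (arc a) = node (R₁.tail a)
  head_arc : ∀ a, R.head (arc a) = node (R₁.head a)
  label_node : ∀ x, x ∉ S → R.label (node x) = R₁.label x
  left_node : ∀ x, x ∉ S → ∀ h h', R.left (node x) h' = arc (R₁.left x h)
  right_node : ∀ x, x ∉ S → ∀ h h', R.right (node x) h' = arc (R₁.right x h)
  ty_arc : ∀ a, R.ty (arc a) = R₁.ty a
  jump_node : ∀ x, x ∉ S → R.jump (node x) = (R₁.jump x).map node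
  jump_survives : ∀ x t, R₁.jump x = some t → t ∉ S

/-- The nodes of `R` that come from `R₁`. -/
def Part.nodes {R₁ R : ProofStructure} {S : Set R₁.Node} (i : Part R₁ R S) : Set R.Node :=
  i.node '' Sᶜ

/-- The arcs of `R` that come from `R₁`. -/
def Part.arcs {R₁ R : ProofStructure} {S : Set R₁.Node} (i : Part R₁ R S) : Set R.Arc :=
  Set.range i.arc

/-- `R` is made of an `ax` node with ordered conclusions of types `A` and `A^⊥`. -/
def IsAx (R : ProofStructure) (A : Formula) : Prop :=
  ∃ (n : R.Node) (a b : R.Arc), R.label n = .ax ∧ R.tail a = n ∧ R.tail b = n ∧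
    R.head a ≠ R.head b ∧ R.concl = [a, b] ∧ R.ty a = A ∧ R.ty b = A.neg ∧
    (∀ x, x = n ∨ x = R.head a ∨ x = R.head b) ∧ (∀ c, c = a ∨ c = b)

/-- `R` is made of a terminal `1` node. -/
def IsOne (R : ProofStructure) : Prop :=
  ∃ (n : R.Node) (a : R.Arc), R.label n = .one ∧ R.tail a = n ∧ R.concl = [a] ∧
    (∀ x, x = n ∨ x = R.head a) ∧ (∀ c, c = a)

/-- `R` is obtained from `R₁` by exchanging two consecutive conclusions, the first of them being
preceded by `k` conclusions. -/
def IsEx (k : ℕ) (R₁ R : ProofStructure) : Prop :=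
  ∃ (i : Part R₁ R ∅) (γ δ : List R₁.Arc) (a b : R₁.Arc),
    γ.length = k ∧ R₁.concl = γ ++ a :: b :: δ ∧
    R.concl = γ.map i.arc ++ i.arc b :: i.arc a :: δ.map i.arc ∧
    i.nodes = Set.univ ∧ i.arcs = Set.univ

/-- `R` is obtained from `R₁` by adding a terminal `⊥` node `n`, whose conclusion `c` is the last
conclusion of `R`, with a jump from `n` to an arbitrary node `m` of `R₁`. -/
def IsBot (R₁ R : ProofStructure) : Prop :=
  ∃ (i : Part R₁ R ∅) (n : R.Node) (c : R.Arc) (m : R₁.Node),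
    R.label n = .bot ∧ R.tail c = n ∧ R.jump n = some (i.node m) ∧
    R.concl = R₁.concl.map i.arc ++ [c] ∧
    n ∉ i.nodes ∧ R.head c ∉ i.nodes ∧ i.nodes ∪ {n, R.head c} = Set.univ ∧
    c ∉ i.arcs ∧ i.arcs ∪ {c} = Set.univ

/-- `R` is obtained from `R₁` by plugging its last two conclusions into a new terminal `⅋` node `n`,
whose conclusion `c` is the last conclusion of `R`. -/
def IsPar (R₁ R : ProofStructure) : Prop :=
  ∃ (γ : List R₁.Arc) (a b : R₁.Arc) (i : Part R₁ R {R₁.head a, R₁.head b})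
    (n : R.Node) (hn : R.label n = .par) (c : R.Arc),
    R₁.concl = γ ++ [a, b] ∧ R.concl = γ.map i.arc ++ [c] ∧
    R.left n (Or.inr hn) = i.arc a ∧ R.right n (Or.inr hn) = i.arc b ∧ R.tail c = n ∧
    n ∉ i.nodes ∧ R.head c ∉ i.nodes ∧ i.nodes ∪ {n, R.head c} = Set.univ ∧
    c ∉ i.arcs ∧ i.arcs ∪ {c} = Set.univ

/-- `R` is obtained from the disjoint union of `R₁` and `R₂` by plugging the last conclusion of `R₁`
and the first conclusion of `R₂` into a new terminal `⊗` node `n` with conclusion `c`. -/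
def IsTensor (R₁ R₂ R : ProofStructure) : Prop :=
  ∃ (γ : List R₁.Arc) (a : R₁.Arc) (b : R₂.Arc) (δ : List R₂.Arc)
    (i : Part R₁ R {R₁.head a}) (j : Part R₂ R {R₂.head b})
    (n : R.Node) (hn : R.label n = .tensor) (c : R.Arc),
    R₁.concl = γ ++ [a] ∧ R₂.concl = b :: δ ∧
    R.concl = γ.map i.arc ++ c :: δ.map j.arc ∧
    R.left n (Or.inl hn) = i.arc a ∧ R.right n (Or.inl hn) = j.arc b ∧ R.tail c = n ∧
    Disjoint i.nodes j.nodes ∧ n ∉ i.nodes ∪ j.nodes ∧ R.head c ∉ i.nodes ∪ j.nodes ∧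
    i.nodes ∪ j.nodes ∪ {n, R.head c} = Set.univ ∧
    Disjoint i.arcs j.arcs ∧ c ∉ i.arcs ∪ j.arcs ∧ i.arcs ∪ j.arcs ∪ {c} = Set.univ

/-- `R` is obtained from the disjoint union of `R₁` and `R₂` by plugging the last conclusion of `R₁`
and the first conclusion of `R₂` into a new cut node `n`. -/
def IsCut (R₁ R₂ R : ProofStructure) : Prop :=
  ∃ (γ : List R₁.Arc) (a : R₁.Arc) (b : R₂.Arc) (δ : List R₂.Arc)
    (i : Part R₁ R {R₁.head a}) (j : Part R₂ R {R₂.head b}) (n : R.Node),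
    R.label n = .cut ∧ R₁.concl = γ ++ [a] ∧ R₂.concl = b :: δ ∧
    R.concl = γ.map i.arc ++ δ.map j.arc ∧
    R.head (i.arc a) = n ∧ R.head (j.arc b) = n ∧
    Disjoint i.nodes j.nodes ∧ n ∉ i.nodes ∪ j.nodes ∧
    i.nodes ∪ j.nodes ∪ {n} = Set.univ ∧
    Disjoint i.arcs j.arcs ∧ i.arcs ∪ j.arcs = Set.univ

end ProofStructure

/-- Desequentialization with jumps, by induction on the proof. The ordered conclusions of the
proof-structure correspond to the formulae of the conclusion of the proof, in the same order. In the
`⊥` rule, the new `⊥` node jumps to an arbitrary node of the structure obtained so far. -/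
inductive Deseq : {Γ : List Formula} → Proof Γ → ProofStructure → Prop
  | ax {A : Formula} {R : ProofStructure} (h : R.IsAx A) : Deseq (Proof.ax A) R
  | cut {Γ Δ : List Formula} {A : Formula} {p : Proof (Γ ++ [A])} {q : Proof (A.neg :: Δ)}
      {R₁ R₂ R : ProofStructure} (hp : Deseq p R₁) (hq : Deseq q R₂)
      (h : ProofStructure.IsCut R₁ R₂ R) : Deseq (Proof.cut p q) R
  | ex {Γ Δ : List Formula} {A B : Formula} {p : Proof (Γ ++ A :: B :: Δ)}
      {R₁ R : ProofStructure} (hp : Deseq p R₁)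
      (h : ProofStructure.IsEx Γ.length R₁ R) : Deseq (Proof.ex p) R
  | tensor {Γ Δ : List Formula} {A B : Formula} {p : Proof (Γ ++ [A])} {q : Proof (B :: Δ)}
      {R₁ R₂ R : ProofStructure} (hp : Deseq p R₁) (hq : Deseq q R₂)
      (h : ProofStructure.IsTensor R₁ R₂ R) : Deseq (Proof.tensor p q) R
  | one {R : ProofStructure} (h : R.IsOne) : Deseq Proof.one R
  | par {Γ : List Formula} {A B : Formula} {p : Proof (Γ ++ [A, B])}
      {R₁ R : ProofStructure} (hp : Deseq p R₁)
      (h : ProofStructure.IsPar R₁ R) : Deseq (Proof.par p) R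
  | bot {Γ : List Formula} {p : Proof Γ} {R₁ R : ProofStructure} (hp : Deseq p R₁)
      (h : ProofStructure.IsBot R₁ R) : Deseq (Proof.bot p) R

end LL

/-! Sequentialization is carried out on the non-erasing nodes, the erasing ones being treated as
weakenings. The fragment makes this possible: the conclusion of an erasing node has kind `E`, which
is not allowed under `⊗`, so an erasing node only leads to a `⅋` or `•` node. Hence a switching may
choose a non-erasing premise at every non-erasing `⅋`, and the arcs that it keeps between
non-erasing nodes form a forest.

Give weight `-1` to `⊗`, `0` to a non-erasing `⅋` and `1` to `ax` and `1`. On a set containing the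
non-erasing premises of its nodes, the weight is the number of components of the forest, whatever
the switching. It is thus at least `1` on nonempty sets, and the count of components in `Cw` bounds
the total weight by `1` (`sum_nodeWeight_mainNodes`). The non-erasing part therefore has weight
exactly `1`. Since weight is modular, two meeting sets of weight `1` have a union of weight `1`. An
empire-style argument (`exists_up_of_terminal`, `SwitchingSystem.exists_splitting`) then gives a
splitting `⊗` when no terminal node is a `⅋`.

A proof is built by induction on pieces, sets of nodes closed upwards
(`sequentializable_of_weight`). Terminal erasing nodes are removed first, by `⊥` and `⅋` rules.
Canonical jumps go to non-erasing nodes, so their targets are still present; in particular the `⊥`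
nodes of `wE` disappear while `m` is available. Afterwards every `⊥` node left lies above a
non-erasing `⅋` of the piece and jumps to a premise of such a `⅋`, so removing a terminal `⅋` or
splitting at a `⊗` never separates it from its target. The process ends with a single `ax` or `1`
node. -/

namespace LL

/-! ### Counting arcs inside sets of nodes -/

section InnerArcs

variable {V E : Type} [DecidableEq V] (tail head : E → V)

/-- The arcs of `F` with both ends in `S`. -/
def innerArcs (F : Finset E) (S : Finset V) : Finset E :=
  F.filter fun a => tail a ∈ S ∧ head a ∈ S

/-- Every nonempty set of nodes contains fewer arcs of `F` than nodes. -/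
def Sparse (F : Finset E) : Prop :=
  ∀ S : Finset V, S.Nonempty → (innerArcs tail head F S).card + 1 ≤ S.card

/-- `C ⊆ D` and no arc of `F` inside `D` has exactly one end in `C`. -/
def ClosedIn (F : Finset E) (C D : Finset V) : Prop :=
  C ⊆ D ∧ ∀ a ∈ F, tail a ∈ D → head a ∈ D → (tail a ∈ C ↔ head a ∈ C)

/-- `S` contains exactly one arc less than nodes. -/
def Tight (F : Finset E) (S : Finset V) : Prop :=
  (innerArcs tail head F S).card + 1 = S.card

variable {tail head}

theorem mem_innerArcs {F : Finset E} {S : Finset V} {a : E} :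
    a ∈ innerArcs tail head F S ↔ a ∈ F ∧ tail a ∈ S ∧ head a ∈ S := by
  simp [innerArcs]

theorem ClosedIn.card_innerArcs {F : Finset E} {C D : Finset V}
    (h : ClosedIn tail head F C D) :
    (innerArcs tail head F D).card =
      (innerArcs tail head F C).card + (innerArcs tail head F (D \ C)).card := by
  classical
  rw [← Finset.card_union_of_disjoint]
  · congr 1
    ext a
    have h1 := @h.1 (tail a)
    have h2 := @h.1 (head a)
    have h3 := h.2 a
    simp only [Finset.mem_union, mem_innerArcs, Finset.mem_sdiff]
    tauto
  · rw [Finset.disjoint_left]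
    intro a
    simp only [mem_innerArcs, Finset.mem_sdiff]
    tauto

theorem ClosedIn.mono {F : Finset E} {C D D' : Finset V} (h : ClosedIn tail head F C D)
    (hD : D' ⊆ D) : ClosedIn tail head F (D' ∩ C) D' := by
  refine ⟨Finset.inter_subset_left, fun a ha h1 h2 => ?_⟩
  have := h.2 a ha (hD h1) (hD h2)
  simp [h1, h2, this]

/-- A tight set is connected. If `C` cut `X` into two nonempty parts, no arc would cross, and
sparsity would cost one arc in each part, whereas only one is missing in all. -/
theorem Tight.subset_of_closedIn {F : Finset E} (hF : Sparse tail head F)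
    {X C D : Finset V} (hX : Tight tail head F X) (hC : ClosedIn tail head F C D) (hXD : X ⊆ D)
    (hne : (X ∩ C).Nonempty) : X ⊆ C := by
  by_contra hsub
  have h1 := (hC.mono hXD).card_innerArcs
  have h2 := hF _ hne
  have h3 : (X \ (X ∩ C)).Nonempty := by
    rw [Finset.not_subset] at hsub
    obtain ⟨x, hx, hx'⟩ := hsub
    exact ⟨x, by simp [hx, hx']⟩
  have h4 := hF _ h3
  have h5 := Finset.card_sdiff_add_card_eq_card (Finset.inter_subset_left (s₁ := X) (s₂ := C))
  unfold Tight at hX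
  omega

/-- This is the connected component of `y` in `D`. A largest tight set is closed: an arc to a new
node adds one arc and one node, so by sparsity the enlarged set would still be tight. -/
theorem exists_tight_closedIn {F : Finset E} (hF : Sparse tail head F)
    {D : Finset V} {y : V} (hy : y ∈ D) :
    ∃ A, y ∈ A ∧ Tight tail head F A ∧ ClosedIn tail head F A D := by
  classical
  let cand : Finset (Finset V) := D.powerset.filter fun A => y ∈ A ∧ Tight tail head F A
  have hne : cand.Nonempty := by
    have h1 := hF {y} (by simp)
    rw [Finset.card_singleton] at h1
    refine ⟨{y}, Finset.mem_filter.2 ⟨by simpa using hy, by simp, ?_⟩⟩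
    rw [Tight, Finset.card_singleton]
    omega
  obtain ⟨A, hA, hmax⟩ := Finset.exists_max_image cand Finset.card hne
  simp only [cand, Finset.mem_filter, Finset.mem_powerset] at hA hmax
  refine ⟨A, hA.2.1, hA.2.2, hA.1, ?_⟩
  have key : ∀ a ∈ F, ∀ x ∈ D, x ∉ A → tail a ∈ insert x A → head a ∈ insert x A →
      (tail a = x ∨ head a = x) → False := by
    intro a ha x hx hxA h1 h2 h3
    have hins : (insert x A).card = A.card + 1 := Finset.card_insert_of_notMem hxA
    have hsub : insert a (innerArcs tail head F A) ⊆ innerArcs tail head F (insert x A) := by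
      intro b hb
      rw [Finset.mem_insert] at hb
      rcases hb with rfl | hb
      · exact mem_innerArcs.2 ⟨ha, h1, h2⟩
      · rw [mem_innerArcs] at hb ⊢
        exact ⟨hb.1, Finset.mem_insert_of_mem hb.2.1, Finset.mem_insert_of_mem hb.2.2⟩
    have hnot : a ∉ innerArcs tail head F A := by
      rw [mem_innerArcs]
      rintro ⟨-, h4, h5⟩
      rcases h3 with rfl | rfl <;> contradiction
    have h4 := Finset.card_le_card hsub
    rw [Finset.card_insert_of_notMem hnot] at h4
    have h5 := hF (insert x A) (by simp)
    have h6 : Tight tail head F A := hA.2.2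
    unfold Tight at h6
    have := hmax (insert x A) ⟨Finset.insert_subset hx hA.1, by simp [hA.2.1], by
      unfold Tight; omega⟩
    omega
  intro a ha h1 h2
  constructor
  · intro h3
    by_contra h4
    exact key a ha _ h2 h4 (by simp [h3]) (by simp) (Or.inr rfl)
  · intro h3
    by_contra h4
    exact key a ha _ h1 h4 (by simp) (by simp [h3]) (Or.inl rfl)

end InnerArcs

/-! ### Splitting -/

/-- The data of an acyclic graph with a family `sel` of switchings, given by the sets of arcs that
they keep. The nodes have weights such that `1 - wt x` of the arcs into `x` are kept. -/
structure SwitchingSystem (V E : Type) [DecidableEq V] where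
  tail : E → V
  head : E → V
  arcs : Finset E
  sel : Set (Finset E)
  wt : V → ℤ
  rk : V → ℕ
  rk_lt : ∀ a ∈ arcs, rk (tail a) < rk (head a)
  sel_subset : ∀ F ∈ sel, F ⊆ arcs
  sel_nonempty : sel.Nonempty
  exchange : ∀ F ∈ sel, ∀ a ∈ arcs, ∃ F' ∈ sel, a ∈ F' ∧ ∀ b, head b ≠ head a → (b ∈ F' ↔ b ∈ F)
  card_sel : ∀ F ∈ sel, ∀ x, ((F.filter fun a => head a = x).card : ℤ) = 1 - wt x
  sparse : ∀ F ∈ sel, Sparse tail head F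

namespace SwitchingSystem

variable {V E : Type} [DecidableEq V] (G : SwitchingSystem V E)

/-- Sets of nodes that contain the premises of their nodes. -/
def Up (M : Finset V) : Prop := ∀ a ∈ G.arcs, G.head a ∈ M → G.tail a ∈ M

/-- The total weight. -/
def weight (M : Finset V) : ℤ := ∑ x ∈ M, G.wt x

/-- No arc goes from `x` to a node of `N`. -/
def Terminal (N : Finset V) (x : V) : Prop := ∀ a ∈ G.arcs, G.tail a = x → G.head a ∉ N

/-- `x` is a node with two premises `a` and `b` that are kept by every switching. -/
structure IsTensor (x : V) (a b : E) : Prop where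
  ne : a ≠ b
  mem_left : a ∈ G.arcs
  mem_right : b ∈ G.arcs
  head_left : G.head a = x
  head_right : G.head b = x
  eq_or_eq : ∀ c ∈ G.arcs, G.head c = x → c = a ∨ c = b
  sel_left : ∀ F ∈ G.sel, a ∈ F
  sel_right : ∀ F ∈ G.sel, b ∈ F
  wt_eq : G.wt x = -1

variable {G}

theorem IsTensor.symm {x : V} {a b : E} (h : G.IsTensor x a b) : G.IsTensor x b a :=
  ⟨h.ne.symm, h.mem_right, h.mem_left, h.head_right, h.head_left,
    fun c hc hx => (h.eq_or_eq c hc hx).symm, h.sel_right, h.sel_left, h.wt_eq⟩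

theorem Up.union {M M' : Finset V} (h : G.Up M) (h' : G.Up M') : G.Up (M ∪ M') := by
  intro a ha hh
  have := h a ha
  have := h' a ha
  simp only [Finset.mem_union] at hh ⊢
  tauto

theorem Up.inter {M M' : Finset V} (h : G.Up M) (h' : G.Up M') : G.Up (M ∩ M') := by
  intro a ha hh
  have := h a ha
  have := h' a ha
  simp only [Finset.mem_inter] at hh ⊢
  tauto

/-- All the kept arcs with head in `M` lie inside `M`, and `x` is the head of `1 - wt x` of them. As
the kept arcs form a forest, the weight is the number of components of `M`, the same for every
selection. -/
theorem Up.card_eq {M : Finset V} (h : G.Up M) {F : Finset E} (hF : F ∈ G.sel) :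
    ((innerArcs G.tail G.head F M).card : ℤ) = M.card - G.weight M := by
  have h1 : ∀ a ∈ innerArcs G.tail G.head F M, G.head a ∈ M := fun a ha => (mem_innerArcs.1 ha).2.2
  rw [Finset.card_eq_sum_card_fiberwise h1]
  have h2 : ∀ x ∈ M, (((innerArcs G.tail G.head F M).filter fun a => G.head a = x).card : ℤ)
      = 1 - G.wt x := by
    intro x hx
    rw [← G.card_sel F hF x]
    congr 2
    ext a
    simp only [Finset.mem_filter, mem_innerArcs]
    constructor
    · tauto
    · rintro ⟨h3, rfl⟩
      exact ⟨⟨h3, h a (G.sel_subset F hF h3) hx, hx⟩, rfl⟩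
  push_cast
  rw [Finset.sum_congr rfl h2]
  simp [weight]

theorem Up.weight_pos {M : Finset V} (h : G.Up M) (hne : M.Nonempty) : 1 ≤ G.weight M := by
  obtain ⟨F, hF⟩ := G.sel_nonempty
  have h1 := h.card_eq hF
  have h2 := G.sparse F hF M hne
  omega

theorem weight_union_add_inter (M M' : Finset V) :
    G.weight (M ∪ M') + G.weight (M ∩ M') = G.weight M + G.weight M' :=
  Finset.sum_union_inter

/-- Union and intersection have total weight `2`, and each weighs at least `1`. -/
theorem Up.weight_union {M M' : Finset V} (h : G.Up M) (h' : G.Up M') (hM : G.weight M = 1)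
    (hM' : G.weight M' = 1) (hne : (M ∩ M').Nonempty) : G.weight (M ∪ M') = 1 := by
  have h1 := weight_union_add_inter (G := G) M M'
  have h2 := (h.inter h').weight_pos hne
  have h3 := (h.union h').weight_pos (hne.mono (by
    intro x; simp only [Finset.mem_inter, Finset.mem_union]; tauto))
  omega

theorem IsTensor.up_insert {x : V} {a b : E} (ht : G.IsTensor x a b) {M : Finset V} (h : G.Up M)
    (ha : G.tail a ∈ M) (hb : G.tail b ∈ M) : G.Up (insert x M) := by
  intro c hc hh
  rw [Finset.mem_insert] at hh ⊢
  rcases hh with hh | hh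
  · rcases ht.eq_or_eq c hc hh with rfl | rfl <;> exact Or.inr ‹_›
  · exact Or.inr (h c hc hh)

theorem IsTensor.weight_insert {x : V} {a b : E} (ht : G.IsTensor x a b) {M : Finset V}
    (hx : x ∉ M) : G.weight (insert x M) = G.weight M - 1 := by
  rw [weight, Finset.sum_insert hx, ht.wt_eq, weight]
  ring

/-- A set of weight `1` does not contain both premises of a tensor without containing it. -/
theorem IsTensor.not_both {x : V} {a b : E} (ht : G.IsTensor x a b) {M : Finset V} (h : G.Up M)
    (hx : x ∉ M) (hw : G.weight M = 1) (ha : G.tail a ∈ M) (hb : G.tail b ∈ M) : False := by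
  have h1 := (ht.up_insert h ha hb).weight_pos (by simp)
  rw [ht.weight_insert hx] at h1
  omega

theorem Up.erase {N : Finset V} (h : G.Up N) {t : V} (ht : G.Terminal N t) : G.Up (N.erase t) := by
  intro a ha hh
  rw [Finset.mem_erase] at hh ⊢
  exact ⟨fun h1 => ht a ha h1 hh.2, h a ha hh.2⟩

/-- A tight set does not contain both premises of a tensor without containing it. -/
theorem IsTensor.not_both_of_tight {t : V} {a b : E} (htt : G.IsTensor t a b) {F : Finset E}
    (hF : F ∈ G.sel) {A : Finset V} (hA : Tight G.tail G.head F A) (htA : t ∉ A)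
    (ha : G.tail a ∈ A) (hb : G.tail b ∈ A) : False := by
  classical
  have h1 := G.sparse F hF (insert t A) (by simp)
  rw [Finset.card_insert_of_notMem htA] at h1
  -- Adding `t` to `A` adds one node but two arcs, one too many for sparsity.
  have hsub : insert a (insert b (innerArcs G.tail G.head F A)) ⊆
      innerArcs G.tail G.head F (insert t A) := by
    intro c hc
    rw [Finset.mem_insert, Finset.mem_insert] at hc
    rcases hc with rfl | rfl | hc
    · exact mem_innerArcs.2 ⟨htt.sel_left F hF, by simp [ha], by simp [htt.head_left]⟩
    · exact mem_innerArcs.2 ⟨htt.sel_right F hF, by simp [hb], by simp [htt.head_right]⟩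
    · rw [mem_innerArcs] at hc ⊢
      exact ⟨hc.1, Finset.mem_insert_of_mem hc.2.1, Finset.mem_insert_of_mem hc.2.2⟩
  have hb' : b ∉ innerArcs G.tail G.head F A := by
    rw [mem_innerArcs, htt.head_right]; tauto
  have ha' : a ∉ insert b (innerArcs G.tail G.head F A) := by
    rw [Finset.mem_insert, mem_innerArcs, htt.head_left]
    have := htt.ne
    tauto
  have h2 := Finset.card_le_card hsub
  rw [Finset.card_insert_of_notMem ha', Finset.card_insert_of_notMem hb'] at h2
  unfold Tight at hA
  omega

/-- A premise of a terminal tensor of a set of weight `1` belongs to a subset of weight `1` which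
does not contain the tensor. -/
theorem exists_up_of_terminal {N : Finset V} (hN : G.Up N) (hw : G.weight N = 1) {t : V}
    (htN : t ∈ N) (ht : G.Terminal N t) {a b : E} (htt : G.IsTensor t a b) :
    ∃ M, M ⊆ N ∧ G.Up M ∧ G.weight M = 1 ∧ G.tail a ∈ M ∧ t ∉ M := by
  classical
  -- Without the tensor, of weight `-1`, the weight becomes `2`. Every selection thus has two
  -- components in `D`, and they separate the premises of `t`.
  set D := N.erase t with hD
  have hDup : G.Up D := hN.erase ht
  have hDw : G.weight D = 2 := by
    have := htt.weight_insert (Finset.notMem_erase t N)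
    rw [Finset.insert_erase htN, hw] at this
    rw [hD]; omega
  have haD : G.tail a ∈ D := Finset.mem_erase.2
    ⟨fun h => ht a htt.mem_left h (htt.head_left ▸ htN), hN a htt.mem_left (htt.head_left ▸ htN)⟩
  have hbD : G.tail b ∈ D := Finset.mem_erase.2
    ⟨fun h => ht b htt.mem_right h (htt.head_right ▸ htN),
      hN b htt.mem_right (htt.head_right ▸ htN)⟩
  -- Among the components of `tail a` for all the selections, a smallest one is taken. Its
  -- minimality forces it to contain the premises of its nodes.
  let P : ℕ → Prop := fun k => ∃ F ∈ G.sel, ∃ A : Finset V, A.card = k ∧ G.tail a ∈ A ∧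
    Tight G.tail G.head F A ∧ ClosedIn G.tail G.head F A D
  have hP : ∃ k, P k := by
    obtain ⟨F, hF⟩ := G.sel_nonempty
    obtain ⟨A, h1, h2, h3⟩ := exists_tight_closedIn (G.sparse F hF) haD
    exact ⟨_, F, hF, A, rfl, h1, h2, h3⟩
  obtain ⟨F, hF, A, hAk, haA, hAt, hAc⟩ := Nat.find_spec hP
  have hmin : ∀ F' ∈ G.sel, ∀ A' : Finset V, G.tail a ∈ A' → Tight G.tail G.head F' A' →
      ClosedIn G.tail G.head F' A' D → A.card ≤ A'.card := fun F' hF' A' h1 h2 h3 => by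
    rw [hAk]; exact Nat.find_min' hP ⟨F', hF', A', rfl, h1, h2, h3⟩
  have htA : t ∉ A := fun h => Finset.notMem_erase t N (hAc.1 h)
  have hbA : G.tail b ∉ A := fun hb => htt.not_both_of_tight hF hAt htA haA hb
  -- Of the `|D| - 2` kept arcs inside `D`, `A` takes `|A| - 1`, so the rest of `D` is one
  -- component.
  have hBt : Tight G.tail G.head F (D \ A) := by
    have h1 := hAc.card_innerArcs
    have h2 := hDup.card_eq hF
    have h3 := Finset.card_sdiff_add_card_eq_card hAc.1
    unfold Tight at hAt ⊢
    omega
  -- Suppose that an arc `c` enters `A` from outside. The selection is changed at `head c` so as to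
  -- keep `c`, and the new component `A'` of `tail a` is compared with `A`.
  have hAup : G.Up A := by
    intro c hc hhA
    by_contra hu
    have huD : G.tail c ∈ D := hDup c hc (hAc.1 hhA)
    obtain ⟨F', hF', hcF', hag⟩ := G.exchange F hF c hc
    have same : ∀ S : Finset V, G.head c ∉ S →
        innerArcs G.tail G.head F' S = innerArcs G.tail G.head F S := by
      intro S hS
      ext e
      simp only [mem_innerArcs]
      by_cases he : G.head e = G.head c
      · rw [he]; tauto
      · rw [hag e he]
    obtain ⟨A', h1, h2, h3⟩ := exists_tight_closedIn (G.sparse F' hF') haD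
    by_cases hx : G.head c ∈ A'
    · have huA' : G.tail c ∈ A' := (h3.2 c hcF' huD (hAc.1 hhA)).2 hx
      have hBt' : Tight G.tail G.head F' (D \ A) := by
        unfold Tight
        rw [same _ (by simp [hhA])]
        exact hBt
      have hsub := hBt'.subset_of_closedIn (G.sparse F' hF') h3 Finset.sdiff_subset
        ⟨G.tail c, by simp [huD, hu, huA']⟩
      exact htt.not_both_of_tight hF' h2 (fun h => Finset.notMem_erase t N (h3.1 h)) h1
        (hsub (by simp [hbD, hbA]))
    -- If `A'` avoids `head c`, it is untouched by the change, so it is tight for `F` too and lies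
    -- strictly inside `A`, against minimality.
    · have h2' : Tight G.tail G.head F A' := by
        unfold Tight
        rw [← same _ hx]
        exact h2
      have hsub := h2'.subset_of_closedIn (G.sparse F hF) hAc h3.1 ⟨G.tail a, by simp [h1, haA]⟩
      have hlt := Finset.card_lt_card (Finset.ssubset_iff_subset_ne.2
        ⟨hsub, fun h => hx (h ▸ hhA)⟩)
      have := hmin F' hF' A' h1 h2 h3
      omega
  refine ⟨A, hAc.1.trans (Finset.erase_subset _ _), hAup, ?_, haA, htA⟩
  have h1 := hAup.card_eq hF
  unfold Tight at hAt
  omega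

/-- Every node of `N` is a terminal one or there is a directed path from it to a premise of a
terminal node. -/
theorem exists_terminal_below {N : Finset V} {w : V} (hw : w ∈ N) :
    G.Terminal N w ∨ ∃ c ∈ G.arcs, G.head c ∈ N ∧ G.Terminal N (G.head c) ∧
      ∀ K, G.Up K → G.tail c ∈ K → w ∈ K := by
  classical
  by_contra hcon
  rw [not_or] at hcon
  obtain ⟨h1, h2⟩ := hcon
  -- Belonging to every up set that contains `tail c` expresses that `w` is above `tail c` or equal
  -- to it. A node of `Q` of maximal rank is terminal, since an arc from it to a node of `N` would
  -- yield a node of `Q` of larger rank.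
  let Q := N.filter fun x => ∃ c ∈ G.arcs, G.head c = x ∧ ∀ K, G.Up K → G.tail c ∈ K → w ∈ K
  have hQ : Q.Nonempty := by
    simp only [Terminal, not_forall, not_not] at h1
    obtain ⟨a, ha, rfl, h3⟩ := h1
    exact ⟨G.head a, by simp only [Q, Finset.mem_filter]; exact ⟨h3, a, ha, rfl, fun K _ h => h⟩⟩
  obtain ⟨x, hx, hmax⟩ := Finset.exists_max_image Q G.rk hQ
  simp only [Q, Finset.mem_filter] at hx hmax
  obtain ⟨hxN, c, hc, rfl, hK⟩ := hx
  refine h2 ⟨c, hc, hxN, fun a ha hta hhN => ?_, hK⟩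
  have h3 := hmax (G.head a) ⟨hhN, a, ha, rfl, fun K hKu hKa => hK K hKu (hKu c hc (hta ▸ hKa))⟩
  have h4 := G.rk_lt a ha
  rw [hta] at h4
  omega

/-- A set of weight `1` whose terminal nodes with premises are tensors has a splitting tensor, if it
has a node with a premise. -/
theorem exists_splitting {N : Finset V} (hN : G.Up N) (hw : G.weight N = 1)
    (hT : ∀ c ∈ G.arcs, G.head c ∈ N → G.Terminal N (G.head c) →
      ∃ a b, G.IsTensor (G.head c) a b)
    (hne : ∃ c ∈ G.arcs, G.head c ∈ N) :
    ∃ t a b A B, t ∈ N ∧ G.Terminal N t ∧ G.IsTensor t a b ∧ G.Up A ∧ G.Up B ∧ Disjoint A B ∧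
      t ∉ A ∧ t ∉ B ∧ A ∪ B ∪ {t} = N ∧ G.tail a ∈ A ∧ G.tail b ∈ B ∧
      G.weight A = 1 ∧ G.weight B = 1 := by
  classical
  have hT' : ∀ c ∈ G.arcs, G.head c ∈ N → G.Terminal N (G.head c) →
      ∃ d, G.IsTensor (G.head c) c d := by
    intro c hc h1 h2
    obtain ⟨a, b, hab⟩ := hT c hc h1 h2
    rcases hab.eq_or_eq c hc rfl with h | h
    · exact ⟨b, by rw [← h] at hab; exact hab⟩
    · exact ⟨a, by rw [← h] at hab; exact hab.symm⟩
  -- A largest candidate is one half of the splitting: by maximality, the only arc that can leave it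
  -- inside `N` goes to its tensor.
  let cand : Finset (Finset V) := N.powerset.filter fun M => G.Up M ∧ G.weight M = 1 ∧
    ∃ t a b, t ∈ N ∧ G.Terminal N t ∧ G.IsTensor t a b ∧ G.tail a ∈ M ∧ t ∉ M
  have hcand : cand.Nonempty := by
    obtain ⟨c, hc, hcN⟩ := hne
    have : ∃ c ∈ G.arcs, G.head c ∈ N ∧ G.Terminal N (G.head c) := by
      rcases exists_terminal_below (G := G) hcN with h | ⟨d, hd, h1, h2, -⟩
      · exact ⟨c, hc, hcN, h⟩
      · exact ⟨d, hd, h1, h2⟩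
    obtain ⟨c, hc, h1, h2⟩ := this
    obtain ⟨d, hd⟩ := hT' c hc h1 h2
    obtain ⟨M, h3, h4, h5, h6, h7⟩ := exists_up_of_terminal hN hw h1 h2 hd
    refine ⟨M, ?_⟩
    simp only [cand, Finset.mem_filter, Finset.mem_powerset]
    exact ⟨h3, h4, h5, _, c, d, h1, h2, hd, h6, h7⟩
  obtain ⟨M, hM, hmax⟩ := Finset.exists_max_image cand Finset.card hcand
  simp only [cand, Finset.mem_filter, Finset.mem_powerset] at hM hmax
  obtain ⟨hMN, hMup, hMw, t, a, b, htN, htT, hten, haM, htM⟩ := hM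
  have hmax' : ∀ M', M' ⊆ N → G.Up M' → G.weight M' = 1 → ∀ c d, G.head c ∈ N →
      G.Terminal N (G.head c) → G.IsTensor (G.head c) c d → G.tail c ∈ M' → G.head c ∉ M' →
      M ⊆ M' → ∀ x ∈ M', x ∈ M := by
    intro M' h1 h2 h3 c d h4 h5 h6 h7 h8 h9 x hx
    have h10 := hmax M' ⟨h1, h2, h3, _, c, d, h4, h5, h6, h7, h8⟩
    rwa [Finset.eq_of_subset_of_card_le h9 h10]
  obtain rfl := hten.head_left
  have border : ∀ c ∈ G.arcs, G.head c ∈ N → G.tail c ∈ M → G.head c ≠ G.head a →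
      G.head c ∈ M := by
    intro c hc hcN hcM hca
    by_contra hcM'
    rcases exists_terminal_below (G := G) hcN with h | ⟨d, hd, h1, h2, h3⟩
    -- Here `head c` is a terminal tensor. The set `K` of its other premise is disjoint from `M`, as
    -- otherwise `M ∪ K`, of weight `1`, would contain both premises. Joining `M`, `K` and the
    -- tensor gives weight `1 + 1 - 1`, a larger candidate for the same `t`.
    · obtain ⟨d, hd⟩ := hT' c hc hcN h
      obtain ⟨K, k1, k2, k3, k4, k5⟩ := exists_up_of_terminal hN hw hcN h hd.symm
      have hdisj : ¬ (M ∩ K).Nonempty := fun hne =>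
        hd.not_both (hMup.union k2) (by simp [hcM', k5]) (hMup.weight_union k2 hMw k3 hne)
          (by simp [hcM]) (by simp [k4])
      have hdis : Disjoint M K := Finset.disjoint_iff_inter_eq_empty.2
        (Finset.not_nonempty_iff_eq_empty.1 hdisj)
      have htK : G.head a ∉ K := fun h1 =>
        hdisj ⟨G.tail a, by simp [haM, k2 a hten.mem_left h1]⟩
      refine hcM' (hmax' (insert (G.head c) (M ∪ K)) ?_ ?_ ?_ a b htN htT hten ?_ ?_ ?_ _
        (Finset.mem_insert_self _ _))
      · exact Finset.insert_subset hcN (Finset.union_subset hMN k1)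
      · exact hd.up_insert (hMup.union k2) (by simp [hcM]) (by simp [k4])
      · rw [hd.weight_insert (by simp [hcM', k5]), weight, Finset.sum_union hdis]
        unfold weight at hMw k3
        omega
      · simp [haM]
      · simp [htM, htK, hca.symm]
      · intro x hx; simp [hx]
    -- Here a terminal tensor lies further below. The set `K` of its premise `d` contains `head c`,
    -- hence meets `M` at `tail c`, and `M ∪ K` is a larger candidate for that tensor.
    · obtain ⟨e, he⟩ := hT' d hd h1 h2
      obtain ⟨K, k1, k2, k3, k4, k5⟩ := exists_up_of_terminal hN hw h1 h2 he
      have hcK := h3 K k2 k4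
      refine hcM' (hmax' (M ∪ K) (Finset.union_subset hMN k1) (hMup.union k2)
        (hMup.weight_union k2 hMw k3 ⟨G.tail c, by simp [hcM, k2 c hc hcK]⟩) d e h1 h2 he
        (by simp [k4]) ?_ Finset.subset_union_left _ (by simp [hcK]))
      rw [Finset.mem_union, not_or]
      exact ⟨fun h => hcM' (h3 M hMup (hMup d hd h)), k5⟩
  have htB : G.head a ∉ (N \ M) \ {G.head a} := by simp
  have hunion : M ∪ ((N \ M) \ {G.head a}) ∪ {G.head a} = N := by
    ext x
    have := @hMN x
    by_cases hx : x = G.head a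
    · simp [hx, htN]
    · simp [hx]; tauto
  have hdisj : Disjoint M ((N \ M) \ {G.head a}) := by
    rw [Finset.disjoint_left]; intro x; simp; tauto
  refine ⟨G.head a, a, b, M, (N \ M) \ {G.head a}, htN, htT, hten, hMup, ?_, hdisj, htM, htB, hunion,
    haM, ?_, hMw, ?_⟩
  · intro c hc hh
    simp only [Finset.mem_sdiff, Finset.mem_singleton] at hh ⊢
    refine ⟨⟨hN c hc hh.1.1, fun h => hh.1.2 (border c hc hh.1.1 h hh.2)⟩, fun h => ?_⟩
    exact htT c hc h hh.1.1
  · simp only [Finset.mem_sdiff, Finset.mem_singleton]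
    refine ⟨⟨hN b hten.mem_right (hten.head_right ▸ htN), fun h => ?_⟩, fun h => ?_⟩
    · exact hten.not_both hMup htM hMw haM h
    · exact htT b hten.mem_right h (hten.head_right ▸ htN)
  · have h1 : G.weight (insert (G.head a) (M ∪ ((N \ M) \ {G.head a}))) = 1 := by
      rw [Finset.insert_eq, Finset.union_comm, hunion, hw]
    rw [hten.weight_insert (by simp [htM]), weight, Finset.sum_union hdisj] at h1
    unfold weight at hMw ⊢
    omega

end SwitchingSystem

/-! ### Cycles and components -/

namespace Multidigraph

variable {G : Multidigraph}

theorem Joins.symm {a : G.Arc} {m n : G.Node} (h : G.Joins a m n) : G.Joins a n m :=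
  Or.symm h

theorem Joins.right_eq {a : G.Arc} {m n n' : G.Node} (h : G.Joins a m n) (h' : G.Joins a m n') :
    n = n' := by
  rcases h with ⟨h1, h2⟩ | ⟨h1, h2⟩ <;> rcases h' with ⟨h3, h4⟩ | ⟨h3, h4⟩ <;> simp_all

theorem Acyclic.tail_ne_head (hG : G.Acyclic) (a : G.Arc) : G.tail a ≠ G.head a := by
  intro h
  refine hG 1 (fun _ => G.tail a) (fun _ => a) ⟨one_pos, fun i _ => Or.inl ⟨rfl, h.symm⟩, rfl, ?_, ?_⟩
  · intros; omega
  · intro h; omega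

/-- An infinite walk without backtracking in a finite set of nodes contains a cycle. -/
theorem Acyclic.not_walk (hG : G.Acyclic) (S : Finset G.Node) (ν : ℕ → G.Node) (α : ℕ → G.Arc)
    (hS : ∀ i, ν i ∈ S) (hj : ∀ i, G.Joins (α i) (ν i) (ν (i + 1))) (hα : ∀ i, α i ≠ α (i + 1)) :
    False := by
  classical
  have hP : ∃ j, ∃ i < j, ν i = ν j := by
    obtain ⟨x, -, y, -, hne, h⟩ := Set.infinite_univ.exists_ne_map_eq_of_mapsTo
      (f := ν) (t := (S : Set G.Node)) (fun i _ => hS i) S.finite_toSet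
    rcases lt_or_gt_of_ne hne with h1 | h1
    · exact ⟨y, x, h1, h⟩
    · exact ⟨x, y, h1, h.symm⟩
  -- The first repetition is taken, so that the nodes before it are distinct.
  obtain ⟨i, hi, hij⟩ := Nat.find_spec hP
  set j := Nat.find hP with hjdef
  have hmin : ∀ l < j, ∀ l' < l, ν l' ≠ ν l := fun l hl l' hl' h =>
    Nat.find_min hP hl ⟨l', hl', h⟩
  have hinj : ∀ l < j, ∀ l' < j, ν l = ν l' → l = l' := by
    intro l hl l' hl' h
    rcases lt_trichotomy l l' with h1 | h1 | h1
    · exact (hmin l' hl' l h1 h).elim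
    · exact h1
    · exact (hmin l hl l' h1 h.symm).elim
  refine hG (j - i) (fun l => ν (i + l)) (fun l => α (i + l)) ⟨by omega, fun l hl => hj _, ?_, ?_, ?_⟩
  · simp only [add_zero]
    rw [hij]; congr 1; omega
  · intro l hl l' hl' h
    have := hinj _ (by omega) _ (by omega) h
    omega
  -- If the first and last arcs were equal, this arc would join `ν i` to both `ν (i + 1)` and `ν (j
  -- - 1)`. Then `i + 1 = j - 1`, and the walk would backtrack at once.
  · intro h2 h
    simp only [add_zero] at h
    have e : i + (j - i - 1) = j - 1 := by omega
    rw [e] at h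
    have h3 := hj i
    have h4 := (hj (j - 1)).symm
    rw [show j - 1 + 1 = j by omega, ← hij, ← h] at h4
    have h5 := hinj _ (by omega) _ (by omega) (h3.right_eq h4)
    apply hα i
    rw [h, h5]

/-- Induction by removal of a node with at most one incident arc. If every node of `S` has at least
two, one can always leave by another arc than the one of arrival, which yields an endless walk
without backtracking. -/
theorem Acyclic.sparse [DecidableEq G.Node] (hG : G.Acyclic) (F : Finset G.Arc) :
    Sparse G.tail G.head F := by
  classical
  intro S
  induction hn : S.card generalizing S with
  | zero => intro h; simp_all
  | succ n ih =>
    intro hne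
    let inc (v : G.Node) : Finset G.Arc :=
      (innerArcs G.tail G.head F S).filter fun a => G.tail a = v ∨ G.head a = v
    by_cases hdeg : ∃ v ∈ S, (inc v).card ≤ 1
    · obtain ⟨v, hv, hc⟩ := hdeg
      have hsub : innerArcs G.tail G.head F S ⊆ innerArcs G.tail G.head F (S.erase v) ∪ inc v := by
        intro a ha
        simp only [inc, Finset.mem_union, Finset.mem_filter, mem_innerArcs, Finset.mem_erase] at ha ⊢
        tauto
      have h1 := Finset.card_le_card hsub
      have h2 := Finset.card_union_le (innerArcs G.tail G.head F (S.erase v)) (inc v)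
      have h3 := Finset.card_erase_of_mem hv
      rcases (S.erase v).eq_empty_or_nonempty with he | he
      · have h4 : innerArcs G.tail G.head F S = ∅ := by
          rw [Finset.eq_empty_iff_forall_notMem]
          intro a ha
          rw [mem_innerArcs] at ha
          have h5 : ∀ x ∈ S, x = v := fun x hx => by
            by_contra hxv
            have : x ∈ S.erase v := Finset.mem_erase.2 ⟨hxv, hx⟩
            simp [he] at this
          exact hG.tail_ne_head a ((h5 _ ha.2.1).trans (h5 _ ha.2.2).symm)
        simp [h4]
      · have := ih (S.erase v) (by omega) he
        omega
    · exfalso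
      push Not at hdeg
      -- A state of the walk is a node together with the arc by which it will be left.
      let P (p : G.Node × G.Arc) : Prop := p.1 ∈ S ∧ p.2 ∈ inc p.1
      have step : ∀ p : {p // P p}, ∃ q : {p // P p},
          G.Joins p.1.2 p.1.1 q.1.1 ∧ p.1.2 ≠ q.1.2 := by
        rintro ⟨⟨v, a⟩, hv, ha⟩
        simp only [inc, Finset.mem_filter, mem_innerArcs] at ha
        have : ∃ w ∈ S, G.Joins a v w := by
          rcases ha.2 with h | h
          · exact ⟨G.head a, ha.1.2.2, Or.inl ⟨h, rfl⟩⟩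
          · exact ⟨G.tail a, ha.1.2.1, Or.inr ⟨rfl, h⟩⟩
        obtain ⟨w, hw, hj⟩ := this
        obtain ⟨b, hb, hba⟩ := Finset.exists_mem_ne (hdeg w hw) a
        exact ⟨⟨(w, b), hw, hb⟩, hj, hba.symm⟩
      choose g hg using step
      obtain ⟨v, hv⟩ := hne
      obtain ⟨b, hb⟩ := Finset.card_pos.1 (lt_trans one_pos (hdeg v hv))
      let s (i : ℕ) : {p // P p} := g^[i] ⟨(v, b), hv, hb⟩
      have hs : ∀ i, s (i + 1) = g (s i) := fun i => Function.iterate_succ_apply' _ _ _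
      refine hG.not_walk S (fun i => (s i).1.1) (fun i => (s i).1.2) (fun i => (s i).2.1) ?_ ?_
      · intro i; simp only [hs]; exact (hg _).1
      · intro i; simp only [hs]; exact (hg _).2

/-- A representative is chosen in each component and sent to its component; any other node is sent
to the first arc of a shortest path to its representative. This is injective: two nodes with the
same arc would be its two ends, each nearer to the representative than the other. -/
theorem card_node_le (G : Multidigraph) [Finite G.Node] [Finite G.Arc] :
    Nat.card G.Node ≤ Nat.card G.Arc + G.numComponents := by
  classical
  let H := SimpleGraph.fromRel G.Step
  let rep (c : H.ConnectedComponent) : G.Node := c.out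
  let cm (v : G.Node) : H.ConnectedComponent := H.connectedComponentMk v
  have hrep : ∀ v, H.Reachable v (rep (cm v)) := fun v =>
    SimpleGraph.ConnectedComponent.exact (Quot.out_eq (cm v)).symm
  have step : ∀ v, v ≠ rep (cm v) → ∃ a w, G.Joins a v w ∧ cm w = cm v ∧
      H.dist w (rep (cm v)) < H.dist v (rep (cm v)) := by
    intro v hv
    obtain ⟨p, hp⟩ := (hrep v).exists_walk_length_eq_dist
    generalize rep (cm v) = r at *
    cases p with
    | nil => exact absurd rfl hv
    | @cons _ w _ h p =>
      obtain ⟨-, ⟨a, h1⟩ | ⟨a, h1⟩⟩ := (SimpleGraph.fromRel_adj _ _ _).1 h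
      · refine ⟨a, w, Or.inl h1, SimpleGraph.ConnectedComponent.sound h.symm.reachable, ?_⟩
        have := SimpleGraph.dist_le p
        rw [SimpleGraph.Walk.length_cons] at hp
        omega
      · refine ⟨a, w, Or.inr h1, SimpleGraph.ConnectedComponent.sound h.symm.reachable, ?_⟩
        have := SimpleGraph.dist_le p
        rw [SimpleGraph.Walk.length_cons] at hp
        omega
  choose α β h1 h2 h3 using step
  have hfin : Finite H.ConnectedComponent := Quot.finite _
  let f (v : G.Node) : G.Arc ⊕ H.ConnectedComponent :=
    if h : v = rep (cm v) then Sum.inr (cm v) else Sum.inl (α v h)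
  have hf : Function.Injective f := by
    intro v w hvw
    simp only [f] at hvw
    split_ifs at hvw with e1 e2 e2
    · rw [e1, e2, Sum.inr.inj hvw]
    · have e3 := Sum.inl.inj hvw
      have j1 := h1 v e1
      have j2 := h1 w e2
      rw [← e3] at j2
      by_contra hne
      have k1 : β v e1 = w ∧ β w e2 = v := by
        rcases j1 with ⟨a1, a2⟩ | ⟨a1, a2⟩ <;> rcases j2 with ⟨b1, b2⟩ | ⟨b1, b2⟩
        · exact absurd (a1.symm.trans b1) hne
        · exact ⟨a2.symm.trans b2, b1.symm.trans a1⟩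
        · exact ⟨a1.symm.trans b1, b2.symm.trans a2⟩
        · exact absurd (a2.symm.trans b2) hne
      have d1 := h3 v e1
      have d2 := h3 w e2
      have c1 := h2 v e1
      rw [k1.1] at d1 c1
      rw [k1.2, c1] at d2
      omega
  have := Nat.card_le_card_of_injective f hf
  rwa [Nat.card_sum] at this

end Multidigraph

/-- A `⅋` of kind `A` has an immediate subformula of kind `A`, whereas both are of kind `E` in a `⅋`
of kind `E`. -/
theorem Formula.KindA.not_kindE {F : Formula} (h : F.KindA) : ¬ F.KindE := by
  induction h with
  | atom => intro h; cases h
  | one => intro h; cases h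
  | tensor => intro h; cases h
  | par _ _ ih _ => intro h; cases h with | par h1 h2 => exact ih h1
  | parE _ _ ih => intro h; cases h with | par h1 h2 => exact ih h1
  | Epar _ _ ih => intro h; cases h with | par h1 h2 => exact ih h2

namespace ProofStructure

variable {R : ProofStructure}

/-! ### Premises, conclusions and erasing nodes -/

noncomputable instance : DecidableEq R.Node := Classical.decEq _
noncomputable instance : DecidableEq R.Arc := Classical.decEq _
noncomputable instance : Fintype R.Node := @Fintype.ofFinite _ R.finite_node
noncomputable instance : Fintype R.Arc := @Fintype.ofFinite _ R.finite_arc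

theorem label_head_ne_of_numPremises_eq_zero {a : R.Arc} {n : R.Node} (h : R.head a = n) :
    (R.label n).numPremises ≠ 0 := by
  rw [← R.card_premises, Ne, Set.ncard_eq_zero (Set.toFinite _)]
  exact Set.Nonempty.ne_empty ⟨a, h⟩

theorem label_tail_ne_bullet (a : R.Arc) : R.label (R.tail a) ≠ .bullet := by
  intro h
  have h1 := R.card_conclusions (R.tail a)
  rw [h, Label.numConclusions, Set.ncard_eq_zero (Set.toFinite _)] at h1
  exact Set.notMem_empty a (h1 ▸ (rfl : R.tail a = R.tail a))

theorem eq_of_tail_eq {a b : R.Arc} (h : R.tail a = R.tail b) (hax : R.label (R.tail a) ≠ .ax) :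
    a = b := by
  have h1 := R.card_conclusions (R.tail a)
  have h2 : {c | R.tail c = R.tail a}.ncard ≤ 1 := by
    rw [h1]
    cases hl : R.label (R.tail a) <;> simp_all [Label.numConclusions]
  exact (Set.ncard_le_one (Set.toFinite _)).1 h2 a rfl b h.symm

theorem exists_tail_eq {n : R.Node} (hcut : R.label n ≠ .cut) (hb : R.label n ≠ .bullet) :
    ∃ a, R.tail a = n := by
  have h1 := R.card_conclusions n
  by_contra hcon
  have h2 : {c | R.tail c = n} = ∅ := by
    rw [Set.eq_empty_iff_forall_notMem]
    exact fun a ha => hcon ⟨a, ha⟩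
  rw [h2, Set.ncard_empty] at h1
  cases hl : R.label n <;> simp_all [Label.numConclusions]

theorem premises_eq {n : R.Node} (h : (R.label n).Binary) :
    {a | R.head a = n} = {R.left n h, R.right n h} := by
  refine (Set.eq_of_subset_of_ncard_le ?_ ?_ (Set.toFinite _)).symm
  · rintro a (rfl | rfl)
    · exact R.head_left _ _
    · exact R.head_right _ _
  · rw [R.card_premises, Set.ncard_pair (R.left_ne_right n h)]
    rcases h with h | h <;> simp [h, Label.numPremises]

theorem eq_left_or_eq_right {a : R.Arc} {n : R.Node} (h : (R.label n).Binary) (ha : R.head a = n) :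
    a = R.left n h ∨ a = R.right n h := by
  have : a ∈ {a | R.head a = n} := ha
  rwa [premises_eq h] at this

theorem eq_of_head_eq_of_bullet {a b : R.Arc} (h : R.head a = R.head b)
    (hb : R.label (R.head a) = .bullet) : a = b := by
  have h1 := R.card_premises (R.head a)
  have h2 : {c | R.head c = R.head a}.ncard ≤ 1 := by
    rw [h1, hb, Label.numPremises]
  exact (Set.ncard_le_one (Set.toFinite _)).1 h2 a rfl b h.symm

theorem exists_head_eq_of_bullet {n : R.Node} (hb : R.label n = .bullet) : ∃ a, R.head a = n := by
  have h1 := R.card_premises n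
  by_contra hcon
  have h2 : {c | R.head c = n} = ∅ := by
    rw [Set.eq_empty_iff_forall_notMem]
    exact fun a ha => hcon ⟨a, ha⟩
  rw [h2, Set.ncard_empty, hb] at h1
  simp [Label.numPremises] at h1

theorem Erasing.label {n : R.Node} (h : R.Erasing n) :
    R.label n = .bot ∨ R.label n = .par ∨ R.label n = .bullet := by
  cases h; assumption

theorem Erasing.tail {a : R.Arc} (h : R.Erasing (R.head a)) : R.Erasing (R.tail a) := by
  generalize hn : R.head a = n at h
  cases h with | intro _ _ hp => exact hp a hn

theorem Erasing.label_tail {a : R.Arc} (h : R.Erasing (R.tail a)) :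
    R.label (R.tail a) = .bot ∨ R.label (R.tail a) = .par := by
  have := label_tail_ne_bullet a
  have := h.label
  tauto

theorem Erasing.eq_of_tail_eq {a b : R.Arc} (h : R.Erasing (R.tail a)) (hab : R.tail a = R.tail b) :
    a = b := by
  apply ProofStructure.eq_of_tail_eq hab
  rcases h.label_tail with h | h <;> simp [h]

theorem erasing_of_bot {n : R.Node} (h : R.label n = .bot) : R.Erasing n :=
  ⟨n, Or.inl h, fun a ha => absurd (by rw [h]; rfl) (label_head_ne_of_numPremises_eq_zero ha)⟩

theorem exists_not_erasing_tail {n : R.Node} (h : R.label n = .par) (hn : ¬ R.Erasing n) :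
    ∃ a, R.head a = n ∧ ¬ R.Erasing (R.tail a) := by
  by_contra hcon
  push Not at hcon
  exact hn ⟨n, Or.inr (Or.inl h), hcon⟩

theorem Erasing.kindE {n : R.Node} (h : R.Erasing n) : ∀ a, R.tail a = n → (R.ty a).KindE := by
  induction h with
  | intro n hl hp ih =>
    rintro a rfl
    rcases hl with hl | hl | hl
    · rw [R.ty_bot a hl]; exact .bot
    · rw [R.ty_par a hl]
      exact .par (ih _ (R.head_left _ _) _ rfl) (ih _ (R.head_right _ _) _ rfl)
    · exact absurd hl (label_tail_ne_bullet a)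

/-- This is where the restriction on `⊗` enters: the conclusion of an erasing node has kind `E`, but
both sides of a tensor of the fragment have kind `A`. -/
theorem not_erasing_of_tensor (hF : R.InFragment NBT) {a : R.Arc}
    (h : R.label (R.head a) = .tensor) : ¬ R.Erasing (R.tail a) := by
  intro he
  have hk := he.kindE a rfl
  obtain ⟨c, hc⟩ := exists_tail_eq (n := R.head a) (by simp [h]) (by simp [h])
  have hty := R.ty_tensor c (by rw [hc, h])
  have hA : (R.ty c).KindA := by
    rcases hF c with h1 | h1
    · exact h1
    · rw [hty] at h1; cases h1
  rw [hty] at hA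
  cases hA with
  | tensor h1 h2 =>
    have := eq_left_or_eq_right (n := R.tail c) (Or.inl (by rw [hc, h])) hc.symm
    rcases this with e | e
    · exact h1.not_kindE (e ▸ hk)
    · exact h2.not_kindE (e ▸ hk)

/-- The node below an erasing node is a `⅋` or `•` node. -/
theorem Erasing.label_head (hF : R.InFragment NBT) (hcut : R.CutFree) {a : R.Arc}
    (h : R.Erasing (R.tail a)) : R.label (R.head a) = .par ∨ R.label (R.head a) = .bullet := by
  have h1 := label_head_ne_of_numPremises_eq_zero (R := R) (a := a) rfl
  have h2 := hcut (R.head a)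
  have h3 : R.label (R.head a) ≠ .tensor := fun h3 => not_erasing_of_tensor hF h3 h
  cases hl : R.label (R.head a) <;> simp_all [Label.numPremises]

/-- The rank of a node: the number of nodes above it. -/
noncomputable def rank (R : ProofStructure) (n : R.Node) : ℕ := {x | R.Prec x n}.ncard

theorem rank_lt (a : R.Arc) : R.rank (R.tail a) < R.rank (R.head a) := by
  have hs : R.Prec (R.tail a) (R.head a) := Relation.TransGen.single ⟨a, rfl, rfl⟩
  apply Set.ncard_lt_ncard _ (Set.toFinite _)
  refine ⟨fun x hx => Relation.TransGen.trans hx hs, fun h => ?_⟩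
  exact R.dag _ (h hs)

/-! ### The non-erasing part as a switching system -/

open Classical in
/-- The arcs between two non-erasing nodes that are not `•` nodes. -/
noncomputable def mainArcs (R : ProofStructure) : Finset R.Arc :=
  Finset.univ.filter fun a => ¬ R.Erasing (R.tail a) ∧ R.label (R.head a) ≠ .bullet

theorem mem_mainArcs {a : R.Arc} :
    a ∈ R.mainArcs ↔ ¬ R.Erasing (R.tail a) ∧ R.label (R.head a) ≠ .bullet := by
  simp [mainArcs]

open Classical in
/-- The non-erasing nodes that are not `•` nodes. -/
noncomputable def mainNodes (R : ProofStructure) : Finset R.Node :=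
  Finset.univ.filter fun n => ¬ R.Erasing n ∧ R.label n ≠ .bullet

theorem mem_mainNodes {n : R.Node} : n ∈ R.mainNodes ↔ ¬ R.Erasing n ∧ R.label n ≠ .bullet := by
  simp [mainNodes]

open Classical in
/-- The arcs of `mainArcs` kept by a switching. -/
noncomputable def keptArcs (R : ProofStructure) (φ : R.Switching) : Finset R.Arc :=
  R.mainArcs.filter fun a => ∀ h : R.label (R.head a) = .par, a = φ.choice ⟨R.head a, h⟩

theorem mem_keptArcs {φ : R.Switching} {a : R.Arc} :
    a ∈ R.keptArcs φ ↔
      a ∈ R.mainArcs ∧ ∀ h : R.label (R.head a) = .par, a = φ.choice ⟨R.head a, h⟩ := by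
  simp [keptArcs]

/-- The switchings that choose a non-erasing premise of every non-erasing `⅋` node. -/
def MainSwitching (φ : R.Switching) : Prop :=
  ∀ n, ¬ R.Erasing n.1 → ¬ R.Erasing (R.tail (φ.choice n))

open Classical in
/-- The weight of a node: `-1` for `⊗`, `0` for a non-erasing `⅋`, `1` for the other nodes. -/
noncomputable def nodeWeight (R : ProofStructure) (n : R.Node) : ℤ :=
  if R.label n = .tensor then -1 else if R.label n = .par ∧ ¬ R.Erasing n then 0 else 1

theorem exists_mainSwitching : ∃ φ : R.Switching, MainSwitching φ := by
  classical
  have h : ∀ n : {n // R.label n = .par}, ∃ a, R.head a = n.1 ∧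
      (¬ R.Erasing n.1 → ¬ R.Erasing (R.tail a)) := by
    intro n
    by_cases hn : R.Erasing n.1
    · exact ⟨R.left n.1 (Or.inr n.2), R.head_left _ _, fun h => absurd hn h⟩
    · obtain ⟨a, h1, h2⟩ := exists_not_erasing_tail n.2 hn
      exact ⟨a, h1, fun _ => h2⟩
  choose f h1 h2 using h
  exact ⟨⟨f, h1⟩, h2⟩

theorem not_erasing_head {a : R.Arc} (h : ¬ R.Erasing (R.tail a)) : ¬ R.Erasing (R.head a) :=
  fun h' => h h'.tail

/-- Only the choice at the `⅋` node below `a` is changed, and `a` is an admissible choice since its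
tail is not erasing. If `a` does not enter a `⅋`, every switching keeps it already. -/
theorem exchange_mainSwitching {φ : R.Switching} (hφ : MainSwitching φ) {a : R.Arc}
    (ha : a ∈ R.mainArcs) : ∃ φ' : R.Switching, MainSwitching φ' ∧ a ∈ R.keptArcs φ' ∧
      ∀ b, R.head b ≠ R.head a → (b ∈ R.keptArcs φ' ↔ b ∈ R.keptArcs φ) := by
  classical
  by_cases hp : R.label (R.head a) = .par
  · refine ⟨⟨Function.update φ.choice ⟨R.head a, hp⟩ a, ?_⟩, ?_, ?_, ?_⟩
    · intro n
      by_cases h : n = ⟨R.head a, hp⟩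
      · subst h; simp
      · rw [Function.update_of_ne h]; exact φ.head_choice n
    · intro n hn
      by_cases h : n = ⟨R.head a, hp⟩
      · subst h; simpa using (mem_mainArcs.1 ha).1
      · simp only [Function.update_of_ne h]; exact hφ n hn
    · rw [mem_keptArcs]
      exact ⟨ha, fun _ => by simp⟩
    · intro b hb
      simp only [mem_keptArcs]
      refine and_congr_right fun _ => forall_congr' fun h => ?_
      rw [Function.update_of_ne]
      simpa using hb
  · refine ⟨φ, hφ, ?_, fun _ _ => Iff.rfl⟩
    rw [mem_keptArcs]
    exact ⟨ha, fun h => absurd h hp⟩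

/-- A `⊗` keeps both premises, none being erasing, and a non-erasing `⅋` keeps the chosen one. The
other nodes, including erasing and `•` nodes, receive no main arc; weight `1` for them makes the
formula uniform. -/
theorem card_keptArcs (hF : R.InFragment NBT) (hcut : R.CutFree) {φ : R.Switching}
    (hφ : MainSwitching φ) (x : R.Node) :
    (((R.keptArcs φ).filter fun a => R.head a = x).card : ℤ) = 1 - R.nodeWeight x := by
  classical
  unfold nodeWeight
  split_ifs with h1 h2
  · have hb : (R.label x).Binary := Or.inl h1
    have : ((R.keptArcs φ).filter fun a => R.head a = x) = {R.left x hb, R.right x hb} := by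
      ext a
      rw [Finset.mem_filter, Finset.mem_insert, Finset.mem_singleton]
      refine ⟨fun h => eq_left_or_eq_right hb h.2, fun h => ?_⟩
      have hx : R.head a = x := by
        rcases h with rfl | rfl
        · exact R.head_left _ _
        · exact R.head_right _ _
      refine ⟨mem_keptArcs.2 ⟨mem_mainArcs.2 ⟨?_, ?_⟩, ?_⟩, hx⟩
      · exact not_erasing_of_tensor hF (by rw [hx, h1])
      · rw [hx, h1]; simp
      · intro h'; rw [hx, h1] at h'; cases h'
    rw [this, Finset.card_pair (R.left_ne_right x hb)]
    norm_num
  · have : ((R.keptArcs φ).filter fun a => R.head a = x) = {φ.choice ⟨x, h2.1⟩} := by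
      ext a
      rw [Finset.mem_filter, Finset.mem_singleton]
      constructor
      · rintro ⟨h, rfl⟩
        exact (mem_keptArcs.1 h).2 h2.1
      · rintro rfl
        have hx := φ.head_choice ⟨x, h2.1⟩
        refine ⟨mem_keptArcs.2 ⟨mem_mainArcs.2 ⟨hφ _ h2.2, ?_⟩, ?_⟩, hx⟩
        · rw [hx, h2.1]; simp
        · intro h; congr 2; exact hx.symm
    rw [this]
    simp
  · have : ((R.keptArcs φ).filter fun a => R.head a = x) = ∅ := by
      rw [Finset.eq_empty_iff_forall_notMem]
      intro a ha
      rw [Finset.mem_filter, mem_keptArcs, mem_mainArcs] at ha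
      obtain ⟨⟨⟨h3, h4⟩, -⟩, rfl⟩ := ha
      have h5 := label_head_ne_of_numPremises_eq_zero (R := R) (a := a) rfl
      have h6 := hcut (R.head a)
      have h7 := not_erasing_head h3
      cases hl : R.label (R.head a) <;> simp_all [Label.numPremises]
    rw [this]
    simp

/-- A kept arc has the same ends in the switching graph, so the kept arcs inside `S` are among the
arcs of an acyclic graph inside a copy of `S`. -/
theorem sparse_keptArcs (hAC : R.AC) (φ : R.Switching) :
    Sparse R.tail R.head (R.keptArcs φ) := by
  classical
  intro S hS
  let S' : Finset (R.switchingGraph φ).Node :=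
    (S.map Function.Embedding.inl : Finset (R.Node ⊕ {n // R.label n = .par}))
  have hS' : S'.card = S.card := Finset.card_map _
  have h := (hAC φ).sparse ((R.keptArcs φ).map Function.Embedding.inl) S'
    (Finset.card_pos.1 (hS' ▸ hS.card_pos))
  rw [hS'] at h
  refine le_trans (Nat.succ_le_succ ?_) h
  rw [← Finset.card_map (Function.Embedding.inl : R.Arc ↪ R.Arc ⊕ {n // (R.jump n).isSome})]
  apply Finset.card_le_card
  intro e he
  rw [Finset.mem_map] at he
  obtain ⟨a, ha, rfl⟩ := he
  rw [mem_innerArcs] at ha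
  have hh : (R.switchingGraph φ).head (Sum.inl a) = Sum.inl (R.head a) := by
    simp only [switchingGraph]
    split_ifs with h1 h2
    · rfl
    · exact absurd ((mem_keptArcs.1 ha.1).2 h1) h2
    · rfl
  refine mem_innerArcs.2 ⟨Finset.mem_map_of_mem _ ha.1, ?_, ?_⟩
  · exact Finset.mem_map_of_mem Function.Embedding.inl ha.2.1
  · change (R.switchingGraph φ).head (Sum.inl a) ∈ _
    rw [hh]
    exact Finset.mem_map_of_mem Function.Embedding.inl ha.2.2

/-- The switching system of the non-erasing part of a cut-free proof-structure. -/
noncomputable def switchingSystem (R : ProofStructure) (hF : R.InFragment NBT) (hcut : R.CutFree)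
    (hAC : R.AC) : SwitchingSystem R.Node R.Arc where
  tail := R.tail
  head := R.head
  arcs := R.mainArcs
  sel := {F | ∃ φ, MainSwitching φ ∧ R.keptArcs φ = F}
  wt := R.nodeWeight
  rk := R.rank
  rk_lt := fun a _ => rank_lt a
  sel_subset := by
    rintro _ ⟨φ, -, rfl⟩ a ha
    exact (mem_keptArcs.1 ha).1
  sel_nonempty := by
    obtain ⟨φ, hφ⟩ := exists_mainSwitching (R := R)
    exact ⟨_, φ, hφ, rfl⟩
  exchange := by
    rintro _ ⟨φ, hφ, rfl⟩ a ha
    obtain ⟨φ', h1, h2, h3⟩ := exchange_mainSwitching hφ ha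
    exact ⟨_, ⟨φ', h1, rfl⟩, h2, h3⟩
  card_sel := by
    rintro _ ⟨φ, hφ, rfl⟩ x
    exact card_keptArcs hF hcut hφ x
  sparse := by
    rintro _ ⟨φ, hφ, rfl⟩
    exact sparse_keptArcs hAC φ

theorem isTensor_switchingSystem (hF : R.InFragment NBT) (hcut : R.CutFree) (hAC : R.AC)
    {x : R.Node} (h : R.label x = .tensor) :
    (R.switchingSystem hF hcut hAC).IsTensor x (R.left x (Or.inl h)) (R.right x (Or.inl h)) := by
  have hm : ∀ a, R.head a = x → a ∈ R.mainArcs := fun a ha =>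
    mem_mainArcs.2 ⟨not_erasing_of_tensor hF (by rw [ha, h]), by rw [ha, h]; simp⟩
  have hk : ∀ a, R.head a = x → ∀ F ∈ (R.switchingSystem hF hcut hAC).sel, a ∈ F := by
    rintro a ha _ ⟨φ, -, rfl⟩
    exact mem_keptArcs.2 ⟨hm a ha, fun h' => by rw [ha, h] at h'; cases h'⟩
  exact ⟨R.left_ne_right _ _, hm _ (R.head_left _ _), hm _ (R.head_right _ _), R.head_left _ _,
    R.head_right _ _, fun c _ hc => eq_left_or_eq_right _ hc, hk _ (R.head_left _ _),
    hk _ (R.head_right _ _), by simp [switchingSystem, nodeWeight, h]⟩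

/-- The inequality between numbers of nodes, arcs and components is applied to one switching graph,
each number being written as a sum over the nodes of `R`. Only the upper bound is needed here, since
acyclicity gives the lower one. -/
theorem sum_nodeWeight_mainNodes (hcut : R.CutFree) (hJ : R.JumpFree) (hR : R.Cw) :
    ∑ n ∈ R.mainNodes, R.nodeWeight n ≤ 1 := by
  classical
  obtain ⟨φ, -⟩ := exists_mainSwitching (R := R)
  have hfa : Finite R.Arc := R.finite_arc
  have hfn : Finite R.Node := R.finite_node
  have i1 : Finite (R.switchingGraph φ).Node :=
    inferInstanceAs (Finite (R.Node ⊕ {n // R.label n = .par}))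
  have i2 : Finite (R.switchingGraph φ).Arc :=
    inferInstanceAs (Finite (R.Arc ⊕ {n // (R.jump n).isSome}))
  have h1 := (R.switchingGraph φ).card_node_le
  have h2 : Nat.card (R.switchingGraph φ).Node =
      ∑ n : R.Node, (1 + if R.label n = .par then 1 else 0) := by
    change Nat.card (R.Node ⊕ {n // R.label n = .par}) = _
    rw [Nat.card_sum, Finset.sum_add_distrib, Finset.sum_boole, Nat.card_eq_fintype_card,
      Nat.card_eq_fintype_card, Fintype.card_subtype]
    simp
  have h3 : Nat.card (R.switchingGraph φ).Arc = ∑ n : R.Node, (R.label n).numPremises := by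
    change Nat.card (R.Arc ⊕ {n // (R.jump n).isSome}) = _
    have : IsEmpty {n // (R.jump n).isSome} := ⟨fun n => by have := n.2; simp [hJ n.1] at this⟩
    rw [Nat.card_sum, Nat.card_of_isEmpty (α := {n // (R.jump n).isSome}), add_zero,
      Nat.card_eq_fintype_card, ← Finset.card_univ,
      Finset.card_eq_sum_card_fiberwise (f := R.head) (t := Finset.univ) (fun _ _ => by simp)]
    refine Finset.sum_congr rfl fun n _ => ?_
    rw [← R.card_premises, Set.ncard_eq_toFinset_card']
    congr 1
    ext a
    simp
  have h4 : (R.switchingGraph φ).numComponents =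
      ∑ n : R.Node, (if R.label n = .bot then 1 else 0) + 1 := by
    rw [hR φ]
    have : {n | (R.jump n).isSome} = (∅ : Set R.Node) := by
      ext n; simp [hJ n]
    rw [this, Set.ncard_empty, Nat.sub_zero, Set.ncard_eq_toFinset_card', Finset.sum_boole]
    simp
  rw [h2, h3, h4] at h1
  -- The contribution of a node is `1` for `ax` and `1`, `-1` for `⊗`, and `0` for `⊥`, `⅋` and `•`.
  -- Erasing nodes and `•` nodes thus contribute nothing.
  have h5 : ∑ n ∈ R.mainNodes, R.nodeWeight n = ∑ n : R.Node,
      ((1 + if R.label n = .par then 1 else 0) - (R.label n).numPremises -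
        if R.label n = .bot then 1 else 0 : ℤ) := by
    rw [mainNodes, Finset.sum_filter]
    refine Finset.sum_congr rfl fun n _ => ?_
    unfold nodeWeight
    by_cases he : R.Erasing n
    · rcases he.label with h | h | h <;> simp [he, h, Label.numPremises]
    · have hbot : R.label n ≠ .bot := fun h => he (erasing_of_bot h)
      have hcn := hcut n
      clear h1 h2 h3 h4
      cases hl : R.label n <;> simp_all [Label.numPremises]
  rw [h5]
  zify at h1
  simp only [Finset.sum_sub_distrib]
  linarith

/-! ### Canonical targets -/

/-- An erasing node has at most one conclusion, so the way down is forced until the first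
non-erasing node. That node is not a `•`, since `n₁` is still below, so it is a `⅋`, and it precedes
all the other non-erasing `⅋` nodes below `n`. -/
theorem Erasing.exists_isCanonicalTarget (hF : R.InFragment NBT) (hcut : R.CutFree) {n n₁ : R.Node}
    (hn : R.Erasing n) (h : R.NonErasingParBelow n n₁) : ∃ n', R.IsCanonicalTarget n n' := by
  obtain ⟨h1, h2, h3⟩ := h
  suffices ∃ n₀, R.NonErasingParBelow n n₀ ∧
      (∀ n₁, R.NonErasingParBelow n n₁ → n₀ = n₁ ∨ R.Prec n₀ n₁) by
    obtain ⟨n₀, h4, h5⟩ := this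
    obtain ⟨a, h6, h7⟩ := exists_not_erasing_tail h4.1 h4.2.1
    exact ⟨R.tail a, n₀, h4, h5, h7, a, rfl, h6⟩
  have key : ∀ a, R.Erasing (R.tail a) → ∀ y, R.Prec (R.tail a) y →
      R.head a = y ∨ R.Prec (R.head a) y := by
    intro a ha y hy
    obtain ⟨z, ⟨b, hb, rfl⟩, hz⟩ := Relation.TransGen.head'_iff.1 hy
    rw [ha.eq_of_tail_eq hb.symm]
    exact (Relation.reflTransGen_iff_eq_or_transGen.1 hz).imp Eq.symm id
  induction h3 using Relation.TransGen.head_induction_on with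
  | single h =>
    obtain ⟨a, rfl, rfl⟩ := h
    exact ⟨R.head a, ⟨h1, h2, .single ⟨a, rfl, rfl⟩⟩, fun n₂ h4 => key a hn n₂ h4.2.2⟩
  | head h h3 ih =>
    obtain ⟨a, rfl, rfl⟩ := h
    by_cases he : R.Erasing (R.head a)
    · obtain ⟨n₀, h4, h5⟩ := ih he
      refine ⟨n₀, ⟨h4.1, h4.2.1, .head ⟨a, rfl, rfl⟩ h4.2.2⟩, fun n₂ h6 => h5 n₂ ⟨h6.1, h6.2.1, ?_⟩⟩
      rcases key a hn n₂ h6.2.2 with h7 | h7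
      · exact absurd he (h7 ▸ h6.2.1)
      · exact h7
    · have hp : R.label (R.head a) = .par := by
        refine (hn.label_head hF hcut).resolve_right fun hb => ?_
        obtain ⟨z, ⟨b, hb', rfl⟩, hz⟩ := Relation.TransGen.head'_iff.1 h3
        exact label_tail_ne_bullet b (hb' ▸ hb)
      exact ⟨R.head a, ⟨hp, he, .single ⟨a, rfl, rfl⟩⟩, fun n₂ h4 => key a hn n₂ h4.2.2⟩

theorem canonicalJump_of_mem_wPar (hF : R.InFragment NBT) (hcut : R.CutFree) (m : R.Node)
    {n : R.Node} (hn : n ∈ R.wPar) :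
    ∃ n', R.canonicalJump m n = some n' ∧ R.IsCanonicalTarget n n' := by
  have h : ∃ n', R.IsCanonicalTarget n n' := by
    obtain ⟨h1, n₁, h2⟩ := hn
    exact (erasing_of_bot h1).exists_isCanonicalTarget hF hcut h2
  refine ⟨h.choose, ?_, h.choose_spec⟩
  rw [canonicalJump, if_pos hn, dif_pos h]

theorem canonicalJump_of_notMem_wPar (m : R.Node) {n : R.Node} (hb : R.label n = .bot)
    (hn : n ∉ R.wPar) : R.canonicalJump m n = some m := by
  rw [canonicalJump, if_neg hn, if_pos ⟨hb, hn⟩]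

end ProofStructure

namespace ProofStructure

/-! ### Pieces of a proof-structure -/

/-- A set of nodes of `R` that contains the nodes above its nodes and no `•` node, with an order on
the arcs that leave it. -/
structure Piece (R : ProofStructure) where
  nodes : Set R.Node
  concl : List R.Arc
  up : ∀ a, R.head a ∈ nodes → R.tail a ∈ nodes
  ne_bullet : ∀ n ∈ nodes, R.label n ≠ .bullet
  nodup : concl.Nodup
  mem_concl : ∀ a, a ∈ concl ↔ R.tail a ∈ nodes ∧ R.head a ∉ nodes

namespace Piece

variable {R : ProofStructure} (P : R.Piece)

/-- The nodes of the proof-structure of a piece: there is a `•` node for every conclusion. -/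
abbrev Node : Type := {n // n ∈ P.nodes} ⊕ {a // a ∈ P.concl}

/-- The arcs of the proof-structure of a piece. -/
abbrev Arc : Type := {a // R.tail a ∈ P.nodes}

open Classical in
/-- The heads of the arcs of a piece. -/
noncomputable def head (a : P.Arc) : P.Node :=
  if h : R.head a.1 ∈ P.nodes then .inl ⟨R.head a.1, h⟩
  else .inr ⟨a.1, (P.mem_concl a.1).2 ⟨a.2, h⟩⟩

variable {P}

theorem head_eq_inl {a : P.Arc} {n : {n // n ∈ P.nodes}} :
    P.head a = .inl n ↔ R.head a.1 = n.1 := by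
  unfold head
  split_ifs with h
  · rw [Sum.inl.injEq, Subtype.ext_iff]
  · simp only [false_iff]
    intro h'
    exact h (h' ▸ n.2)

theorem head_eq_inr {a : P.Arc} {b : {a // a ∈ P.concl}} :
    P.head a = .inr b ↔ a.1 = b.1 := by
  unfold head
  split_ifs with h
  · simp only [false_iff]
    intro h'
    rw [h'] at h
    exact ((P.mem_concl _).1 b.2).2 h
  · rw [Sum.inr.injEq, Subtype.ext_iff]

variable (P)

/-- The node of `R` that corresponds to a node of a piece. -/
def proj : P.Node → R.Node
  | .inl n => n.1
  | .inr a => R.head a.1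

/-- The node itself or the node whose conclusion is the premise of the node, for a `•` node. -/
def origin : P.Node → R.Node
  | .inl n => n.1
  | .inr a => R.tail a.1

/-- The nodes of the piece which are not `•` nodes, and its `•` nodes which are nodes of `R`. -/
def Stable : P.Node → Prop
  | .inl _ => True
  | .inr a => R.label (R.head a.1) = .bullet

/-- The labels of the nodes of a piece. -/
def label : P.Node → Label
  | .inl n => R.label n.1
  | .inr _ => .bullet

variable {P}

theorem proj_head (a : P.Arc) : P.proj (P.head a) = R.head a.1 := by
  unfold head
  split_ifs <;> rfl

/-- In general `proj` is not injective: the `•` node added under a plugged conclusion has the same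
image as the node it is plugged into. On stable nodes it is injective, so a jump target in `R` lifts
in at most one way. -/
theorem Stable.eq {t t' : P.Node} (h : P.Stable t) (h' : P.Stable t') (ht : P.proj t = P.proj t') :
    t = t' := by
  rcases t with n | a <;> rcases t' with n' | a'
  · exact congrArg _ (Subtype.ext ht)
  · exact absurd n.2 ((show n.1 = R.head a'.1 from ht) ▸ ((P.mem_concl _).1 a'.2).2)
  · exact absurd n'.2 ((show R.head a.1 = n'.1 from ht) ▸ ((P.mem_concl _).1 a.2).2)
  · exact congrArg _ (Subtype.ext (eq_of_head_eq_of_bullet ht h))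

variable (P)

open Classical in
/-- The jumps of a piece of a proof-structure with the jumps `J`. -/
noncomputable def jump (J : R.Node → Option R.Node) : P.Node → Option P.Node
  | .inl n => if h : ∃ t, P.Stable t ∧ J n.1 = some (P.proj t) then some h.choose else none
  | .inr _ => none

/-- The jumps of the nodes of a piece go to the piece or to a `•` node below it. -/
def JumpClosed (J : R.Node → Option R.Node) : Prop :=
  ∀ n ∈ P.nodes, ∀ x, J n = some x →
    x ∈ P.nodes ∨ R.label x = .bullet ∧ ∃ a, R.tail a ∈ P.nodes ∧ R.head a = x

variable {P}

theorem exists_stable {x : R.Node}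
    (h : x ∈ P.nodes ∨ R.label x = .bullet ∧ ∃ a, R.tail a ∈ P.nodes ∧ R.head a = x) :
    ∃ t, P.Stable t ∧ P.proj t = x := by
  rcases h with h | ⟨h, a, h1, rfl⟩
  · exact ⟨.inl ⟨x, h⟩, trivial, rfl⟩
  · exact ⟨.inr ⟨a, (P.mem_concl a).2 ⟨h1, fun h2 => P.ne_bullet _ h2 h⟩⟩, h, rfl⟩

theorem jump_eq_some {J : R.Node → Option R.Node} {n : {n // n ∈ P.nodes}} {t : P.Node} :
    P.jump J (.inl n) = some t ↔ P.Stable t ∧ J n.1 = some (P.proj t) := by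
  classical
  have e : P.jump J (.inl n) =
    if h : ∃ t, P.Stable t ∧ J n.1 = some (P.proj t) then some h.choose else none := rfl
  rw [e]
  constructor
  · intro h
    split_ifs at h with h1
    obtain rfl := Option.some.inj h
    exact h1.choose_spec
  · intro h
    have h1 : ∃ t, P.Stable t ∧ J n.1 = some (P.proj t) := ⟨t, h⟩
    rw [dif_pos h1]
    congr 1
    refine h1.choose_spec.1.eq h.1 (Option.some.inj ?_)
    rw [← h1.choose_spec.2, h.2]

theorem jump_eq_none {J : R.Node → Option R.Node} {n : {n // n ∈ P.nodes}} (h : J n.1 = none) :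
    P.jump J (.inl n) = none := by
  rw [Option.eq_none_iff_forall_ne_some]
  intro t ht
  rw [jump_eq_some, h] at ht
  simp at ht

variable (P)

/-- The proof-structure of a piece, with the jumps that come from `J`. -/
noncomputable def toPS (J : R.Node → Option R.Node) (hJ : ∀ n, (J n).isSome → R.label n = .bot) :
    ProofStructure where
  Node := P.Node
  Arc := P.Arc
  tail a := .inl ⟨R.tail a.1, a.2⟩
  head := P.head
  finite_node := by
    have := R.finite_node
    have := R.finite_arc
    infer_instance
  finite_arc := by
    have := R.finite_arc
    infer_instance
  dag := by
    intro n hn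
    refine R.dag (P.proj n) (Relation.TransGen.lift P.proj ?_ _ _ hn)
    rintro _ _ ⟨a, rfl, rfl⟩
    exact ⟨a.1, rfl, (proj_head a).symm⟩
  label := P.label
  card_premises := by
    rintro (n | b)
    · rw [label, ← R.card_premises, ← Set.ncard_image_of_injective _ Subtype.val_injective]
      congr 1
      ext a
      simp only [head_eq_inl, Set.mem_image, Set.mem_ofPred_eq, Subtype.exists, exists_and_left,
        exists_prop, exists_eq_right_right, and_iff_left_iff_imp]
      exact fun h => P.up a (h ▸ n.2)
    · have : {a | P.head a = .inr b} = {⟨b.1, ((P.mem_concl _).1 b.2).1⟩} := by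
        ext a
        simp [head_eq_inr, Subtype.ext_iff]
      rw [this, Set.ncard_singleton]
      rfl
  card_conclusions := by
    rintro (n | b)
    · rw [label, ← R.card_conclusions, ← Set.ncard_image_of_injective _ Subtype.val_injective]
      congr 1
      ext a
      simp only [Sum.inl.injEq, Subtype.ext_iff, Set.mem_image, Set.mem_ofPred_eq, Subtype.exists,
        exists_and_left, exists_prop, exists_eq_right_right, and_iff_left_iff_imp]
      exact fun h => h ▸ n.2
    · simp [label, Label.numConclusions]
  left
    | .inl n, h => ⟨R.left n.1 h, P.up _ ((R.head_left n.1 h).symm ▸ n.2)⟩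
    | .inr _, h => absurd h (by simp [label, Label.Binary])
  right
    | .inl n, h => ⟨R.right n.1 h, P.up _ ((R.head_right n.1 h).symm ▸ n.2)⟩
    | .inr _, h => absurd h (by simp [label, Label.Binary])
  head_left := by
    rintro (n | b) h
    · exact head_eq_inl.2 (R.head_left _ _)
    · exact absurd h (by simp [label, Label.Binary])
  head_right := by
    rintro (n | b) h
    · exact head_eq_inl.2 (R.head_right _ _)
    · exact absurd h (by simp [label, Label.Binary])
  left_ne_right := by
    rintro (n | b) h
    · intro h'
      exact R.left_ne_right _ _ (congrArg Subtype.val h')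
    · exact absurd h (by simp [label, Label.Binary])
  concl := P.concl.attachWith (fun a => R.tail a ∈ P.nodes) fun a h => ((P.mem_concl a).1 h).1
  concl_nodup := List.Nodup.of_map Subtype.val (by simpa using P.nodup)
  mem_concl := by
    rintro ⟨a, ha⟩
    rw [List.mem_attachWith]
    unfold head
    split_ifs with h
    · simp only [P.mem_concl, label]
      exact ⟨fun h' => absurd h h'.2, fun h' => absurd h' (P.ne_bullet _ h)⟩
    · simp only [P.mem_concl, label]
      exact ⟨fun _ => trivial, fun _ => ⟨ha, h⟩⟩
  ty a := R.ty a.1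
  ty_ax a b hab h1 h2 := R.ty_ax a.1 b.1 (fun h => hab (Subtype.ext h))
    (congrArg P.proj h1) h2
  ty_cut a b hab h1 h2 := by
    refine R.ty_cut a.1 b.1 (fun h => hab (Subtype.ext h)) ?_ ?_
    · rw [← proj_head, h1, proj_head]
    · rw [← proj_head]
      rcases h : P.head a with n | c
      · rw [h] at h2; exact h2
      · rw [h] at h2; cases h2
  ty_one a h := R.ty_one a.1 h
  ty_bot a h := R.ty_bot a.1 h
  ty_tensor a h := R.ty_tensor a.1 h
  ty_par a h := R.ty_par a.1 h
  jump := P.jump J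
  jump_bot := by
    rintro (n | b) h
    · obtain ⟨t, ht⟩ := Option.isSome_iff_exists.1 h
      exact hJ n.1 (by rw [(jump_eq_some.1 ht).2]; rfl)
    · cases h

variable {P} {P₁ : R.Piece} {J : R.Node → Option R.Node}
  {hJ : ∀ n, (J n).isSome → R.label n = .bot}

/-- The inclusion of arcs. -/
def incArc (h : P₁.nodes ⊆ P.nodes) (a : P₁.Arc) : P.Arc := ⟨a.1, h a.2⟩

theorem incArc_injective (h : P₁.nodes ⊆ P.nodes) : Function.Injective (incArc h) :=
  fun _ _ hab => Subtype.ext (Subtype.mk.inj hab)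

/-- The map of nodes of the inclusion of a piece into another one. -/
noncomputable def incNode (h : P₁.nodes ⊆ P.nodes) : P₁.Node → P.Node
  | .inl n => .inl ⟨n.1, h n.2⟩
  | .inr a => P.head ⟨a.1, h ((P₁.mem_concl _).1 a.2).1⟩

theorem proj_incNode (h : P₁.nodes ⊆ P.nodes) (t : P₁.Node) :
    P.proj (incNode h t) = P₁.proj t := by
  rcases t with n | a
  · rfl
  · exact proj_head _

theorem incNode_inr (h : P₁.nodes ⊆ P.nodes) {a : {a // a ∈ P₁.concl}} (ha : R.head a.1 ∉ P.nodes) :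
    incNode h (.inr a) = .inr ⟨a.1, (P.mem_concl _).2 ⟨h ((P₁.mem_concl _).1 a.2).1, ha⟩⟩ :=
  head_eq_inr.2 rfl

theorem Stable.incNode (h : P₁.nodes ⊆ P.nodes) {t : P₁.Node} (ht : P₁.Stable t) :
    P.Stable (incNode h t) := by
  rcases t with n | a
  · trivial
  · rw [incNode_inr h fun h' => P.ne_bullet _ h' ht]
    exact ht

theorem head_incArc (h : P₁.nodes ⊆ P.nodes) (a : P₁.Arc) :
    P.head (incArc h a) = incNode h (P₁.head a) := by
  rcases hx : P₁.head a with n | b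
  · rw [head_eq_inl] at hx
    exact head_eq_inl.2 hx
  · rw [head_eq_inr] at hx
    rw [incNode]
    congr 1
    exact Subtype.ext hx

/-- Without `JumpClosed`, a jump that leaves `P₁` would be lost in `P₁` but might exist in `P`. -/
theorem jump_incNode (h : P₁.nodes ⊆ P.nodes) (hc : P₁.JumpClosed J) (n : {n // n ∈ P₁.nodes}) :
    P.jump J (.inl ⟨n.1, h n.2⟩) = (P₁.jump J (.inl n)).map (incNode h) := by
  rcases hn : J n.1 with _ | y
  · rw [jump_eq_none (P := P₁) hn, jump_eq_none (P := P) (n := ⟨n.1, h n.2⟩) hn]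
    rfl
  · obtain ⟨t, ht, rfl⟩ := exists_stable (hc n.1 n.2 y hn)
    rw [jump_eq_some.2 ⟨ht, hn⟩]
    exact jump_eq_some.2 ⟨ht.incNode h, by rw [proj_incNode]; exact hn⟩

/-- The nodes of `P₁` that do not survive in `P`. -/
def Plugged (P P₁ : R.Piece) (x : P₁.Node) : Prop := ∃ a, x = .inr a ∧ R.head a.1 ∈ P.nodes

theorem eq_of_incNode_eq (h : P₁.nodes ⊆ P.nodes) {x y : P₁.Node} (hx : ¬ Plugged P P₁ x)
    (hy : ¬ Plugged P P₁ y) (hxy : incNode h x = incNode h y) : x = y := by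
  rcases x with n | b <;> rcases y with n' | b'
  · exact congrArg _ (Subtype.ext (congrArg P.proj hxy))
  · rw [incNode_inr h fun h' => hy ⟨b', rfl, h'⟩] at hxy
    cases hxy
  · rw [incNode_inr h fun h' => hx ⟨b, rfl, h'⟩] at hxy
    cases hxy
  · rw [incNode_inr h fun h' => hx ⟨b, rfl, h'⟩, incNode_inr h fun h' => hy ⟨b', rfl, h'⟩] at hxy
    have h1 := Subtype.mk.inj (Sum.inr.inj hxy)
    exact congrArg _ (Subtype.ext h1)

/-- The inclusion of a piece into another one. -/
noncomputable def part (h : P₁.nodes ⊆ P.nodes) (hc : P₁.JumpClosed J)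
    (S : Set (P₁.toPS J hJ).Node) (hS : ∀ x, x ∈ S ↔ Plugged P P₁ x) :
    Part (P₁.toPS J hJ) (P.toPS J hJ) S where
  node := incNode h
  arc := incArc h
  arc_inj := incArc_injective h
  node_inj x hx y hy hxy :=
    eq_of_incNode_eq h (fun h' => hx ((hS x).2 h')) (fun h' => hy ((hS y).2 h')) hxy
  tail_arc _ := rfl
  head_arc := head_incArc h
  label_node := by
    rintro (n | b) hx
    · rfl
    · have h1 : R.head b.1 ∉ P.nodes := fun h' => hx ((hS _).2 ⟨b, rfl, h'⟩)
      rw [incNode_inr h h1]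
      rfl
  left_node := by
    rintro (n | b) hx h1 h2
    · rfl
    · rcases h1 with h1 | h1 <;> cases h1
  right_node := by
    rintro (n | b) hx h1 h2
    · rfl
    · rcases h1 with h1 | h1 <;> cases h1
  ty_arc _ := rfl
  jump_node := by
    rintro (n | b) hx
    · exact jump_incNode h hc n
    · have h1 : R.head b.1 ∉ P.nodes := fun h' => hx ((hS _).2 ⟨b, rfl, h'⟩)
      rw [incNode_inr h h1]
      rfl
  -- A jump target is stable, whereas a plugged `•` node stands for a node of `P`, which is never a
  -- `•` node of `R`.
  jump_survives := by
    rintro (n | b) t ht hS'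
    · obtain ⟨a, rfl, h1⟩ := (hS t).1 hS'
      exact P.ne_bullet _ h1 (jump_eq_some.1 ht).1
    · cases ht

section

variable {h : P₁.nodes ⊆ P.nodes} {hc : P₁.JumpClosed J} {S : Set (P₁.toPS J hJ).Node}
  {hS : ∀ x, x ∈ S ↔ Plugged P P₁ x}

/-- A surviving `•` node comes from the smaller piece exactly when the tail of its premise does,
which is what `origin` records. -/
theorem mem_part_nodes {y : P.Node} :
    y ∈ (part (hJ := hJ) h hc S hS).nodes ↔ P.origin y ∈ P₁.nodes := by
  constructor
  · rintro ⟨n | b, hx, rfl⟩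
    · exact n.2
    · have h1 : R.head b.1 ∉ P.nodes := fun h' => hx ((hS _).2 ⟨b, rfl, h'⟩)
      change P.origin (incNode h (.inr b)) ∈ _
      rw [incNode_inr h h1]
      exact ((P₁.mem_concl _).1 b.2).1
  · intro hy
    rcases y with n | b
    · refine ⟨.inl ⟨n.1, hy⟩, fun h' => ?_, rfl⟩
      obtain ⟨_, h1, -⟩ := (hS _).1 h'
      cases h1
    · have h1 := ((P.mem_concl _).1 b.2).2
      refine ⟨.inr ⟨b.1, (P₁.mem_concl _).2 ⟨hy, fun h' => h1 (h h')⟩⟩, fun h' => ?_,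
        incNode_inr h h1⟩
      obtain ⟨_, h2, h3⟩ := (hS _).1 h'
      obtain rfl := Sum.inr.inj h2
      exact h1 h3

theorem mem_part_arcs {a : P.Arc} :
    a ∈ (part (hJ := hJ) h hc S hS).arcs ↔ R.tail a.1 ∈ P₁.nodes :=
  ⟨fun ⟨b, hb⟩ => hb ▸ b.2, fun ha => ⟨⟨a.1, ha⟩, rfl⟩⟩

end

theorem concl_eq {l : List P.Arc} (h : l.map Subtype.val = P.concl) :
    (P.toPS J hJ).concl = l := by
  apply List.map_injective_iff.2 Subtype.val_injective
  rw [h]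
  exact List.attachWith_map_subtype_val _

end Piece

end ProofStructure

namespace ProofStructure

namespace Piece

variable {R : ProofStructure} {P P₁ P₂ : R.Piece} {J : R.Node → Option R.Node}
  {hJ : ∀ n, (J n).isSome → R.label n = .bot}

/-! ### The rules on pieces -/

theorem tail_mem {a : R.Arc} (h : a ∈ P.concl) : R.tail a ∈ P.nodes := ((P.mem_concl a).1 h).1

/-- A conclusion of a piece, as an arc of its proof-structure. -/
def mkArc (P : R.Piece) (a : R.Arc) (h : R.tail a ∈ P.nodes) : P.Arc := ⟨a, h⟩

/-- A list of arcs of `R` as a list of arcs of a piece. -/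
def mkList (P : R.Piece) (l : List R.Arc) (h : ∀ a ∈ l, R.tail a ∈ P.nodes) : List P.Arc :=
  l.attachWith _ h

theorem map_val_mkList {l : List R.Arc} (h : ∀ a ∈ l, R.tail a ∈ P.nodes) :
    (P.mkList l h).map Subtype.val = l := List.attachWith_map_subtype_val _

theorem map_val_map_incArc (h : P₁.nodes ⊆ P.nodes) (l : List P₁.Arc) :
    (l.map (incArc h)).map Subtype.val = l.map Subtype.val := by
  rw [List.map_map]; rfl

theorem not_plugged (h : P.nodes = P₁.nodes) (x : P₁.Node) : ¬ Plugged P P₁ x := by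
  rintro ⟨a, -, h'⟩
  exact ((P₁.mem_concl _).1 a.2).2 (h ▸ h')

/-- Only one node has a given origin, except for the `•` nodes below it. -/
theorem eq_of_origin_eq {y : P.Node} {n : R.Node} (hn : n ∈ P.nodes) {c : R.Arc}
    (hc : c ∈ P.concl) (hu : ∀ a, R.tail a = n → a = c) (h : P.origin y = n) :
    y = .inl ⟨n, hn⟩ ∨ y = .inr ⟨c, hc⟩ := by
  rcases y with n' | b
  · exact Or.inl (congrArg _ (Subtype.ext h))
  · exact Or.inr (congrArg _ (Subtype.ext (hu _ h)))

theorem head_eq_inr_of_mem {c : P.Arc} (hc : c.1 ∈ P.concl) : P.head c = .inr ⟨c.1, hc⟩ :=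
  head_eq_inr.2 rfl

theorem origin_head {c : P.Arc} (hc : c.1 ∈ P.concl) : P.origin (P.head c) = R.tail c.1 := by
  rw [head_eq_inr_of_mem hc]; rfl

theorem isEx {γ δ : List R.Arc} {a b : R.Arc} (hn : P.nodes = P₁.nodes) (hc : P₁.JumpClosed J)
    (h₁ : P₁.concl = γ ++ a :: b :: δ) (h : P.concl = γ ++ b :: a :: δ) :
    IsEx γ.length (P₁.toPS J hJ) (P.toPS J hJ) := by
  have hsub : P₁.nodes ⊆ P.nodes := hn.ge
  have hγ : ∀ x ∈ γ, R.tail x ∈ P₁.nodes := fun x hx => tail_mem (by simp [h₁, hx])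
  have hδ : ∀ x ∈ δ, R.tail x ∈ P₁.nodes := fun x hx => tail_mem (by simp [h₁, hx])
  have ha : R.tail a ∈ P₁.nodes := tail_mem (by simp [h₁])
  have hb : R.tail b ∈ P₁.nodes := tail_mem (by simp [h₁])
  refine ⟨part hsub hc ∅ (fun x => iff_of_false (Set.notMem_empty x) (not_plugged hn x)),
    P₁.mkList γ hγ, P₁.mkList δ hδ, P₁.mkArc a ha, P₁.mkArc b hb, ?_, ?_, ?_, ?_, ?_⟩
  · exact List.length_attachWith
  · exact concl_eq (l := P₁.mkList γ hγ ++ P₁.mkArc a ha :: P₁.mkArc b hb :: P₁.mkList δ hδ)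
      (by simp only [List.map_append, List.map_cons, map_val_mkList, mkArc, h₁])
  · exact concl_eq (l := (P₁.mkList γ hγ).map (incArc hsub) ++ P.mkArc b (hsub hb) ::
      P.mkArc a (hsub ha) :: (P₁.mkList δ hδ).map (incArc hsub))
      (by simp only [List.map_append, List.map_cons, map_val_map_incArc, map_val_mkList, mkArc, h])
  · refine Set.eq_univ_of_forall fun y => mem_part_nodes.2 ?_
    rcases y with n | c
    · exact hn ▸ n.2
    · exact hn ▸ tail_mem c.2
  · exact Set.eq_univ_of_forall fun y => mem_part_arcs.2 (hn ▸ y.2)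

theorem isBot {n : R.Node} {c : R.Arc} (hl : R.label n = .bot) (hnP : n ∈ P.nodes)
    (hn : P₁.nodes = P.nodes \ {n}) (hc : R.tail c = n) (hcc : P.concl = P₁.concl ++ [c])
    (hj₁ : P₁.JumpClosed J) {x : R.Node} (hx : J n = some x)
    (hxs : x ∈ P₁.nodes ∨ R.label x = .bullet ∧ ∃ a, R.tail a ∈ P₁.nodes ∧ R.head a = x) :
    IsBot (P₁.toPS J hJ) (P.toPS J hJ) := by
  have hsub : P₁.nodes ⊆ P.nodes := hn ▸ Set.sdiff_subset
  have hu : ∀ a, R.tail a = n → a = c := fun a ha =>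
    eq_of_tail_eq (ha.trans hc.symm) (by rw [ha, hl]; simp)
  have hcP : c ∈ P.concl := by simp [hcc]
  have hcn : R.tail c ∈ P.nodes := hc ▸ hnP
  have hoc : P.origin (P.head (P.mkArc c hcn)) = n := (origin_head hcP).trans hc
  have hplug : ∀ y, ¬ Plugged P P₁ y := by
    rintro _ ⟨a, -, h2⟩
    exact ((P.mem_concl a.1).1 (by simp [hcc, a.2])).2 h2
  have hn1 : n ∉ P₁.nodes := by simp [hn]
  obtain ⟨t, ht, rfl⟩ := exists_stable hxs
  refine ⟨part hsub hj₁ ∅ (fun y => iff_of_false (Set.notMem_empty y) (hplug y)),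
    .inl ⟨n, hnP⟩, P.mkArc c hcn, t, hl, ?_, ?_, ?_, ?_, ?_, ?_, ?_, ?_⟩
  · exact congrArg Sum.inl (Subtype.ext hc)
  · exact jump_eq_some.2 ⟨ht.incNode hsub, hx.trans (congrArg some (proj_incNode hsub t).symm)⟩
  · exact concl_eq
      (l := (P₁.mkList P₁.concl fun a ha => tail_mem ha).map (incArc hsub) ++ [P.mkArc c hcn])
      (by simp only [List.map_append, List.map_cons, List.map_nil, map_val_map_incArc,
        map_val_mkList, mkArc, hcc])
  · exact mem_part_nodes.not.2 hn1
  · exact mem_part_nodes.not.2 (fun h => hn1 (hoc ▸ h))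
  · refine Set.eq_univ_of_forall fun y => ?_
    by_cases hy : P.origin y = n
    · refine Or.inr ?_
      rcases eq_of_origin_eq hnP hcP hu hy with h | h
      · exact Or.inl h
      · exact Or.inr (h.trans (head_eq_inr_of_mem (c := P.mkArc c hcn) hcP).symm)
    · refine Or.inl (mem_part_nodes.2 ?_)
      rw [hn]
      refine ⟨?_, hy⟩
      rcases y with n' | b
      · exact n'.2
      · exact tail_mem b.2
  · exact mem_part_arcs.not.2 (fun h => hn1 (hc ▸ h))
  · refine Set.eq_univ_of_forall fun a => ?_
    by_cases ha : R.tail a.1 = n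
    · exact Or.inr (Subtype.ext (hu _ ha))
    · exact Or.inl (mem_part_arcs.2 (hn ▸ ⟨a.2, ha⟩))

theorem isPar {n : R.Node} {c : R.Arc} {γ : List R.Arc} (hl : R.label n = .par)
    (hnP : n ∈ P.nodes) (hn : P₁.nodes = P.nodes \ {n}) (hc : R.tail c = n)
    (h₁ : P₁.concl = γ ++ [R.left n (Or.inr hl), R.right n (Or.inr hl)])
    (hcc : P.concl = γ ++ [c]) (hj₁ : P₁.JumpClosed J) :
    IsPar (P₁.toPS J hJ) (P.toPS J hJ) := by
  have hsub : P₁.nodes ⊆ P.nodes := hn ▸ Set.sdiff_subset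
  have hu : ∀ a, R.tail a = n → a = c := fun a ha =>
    eq_of_tail_eq (ha.trans hc.symm) (by rw [ha, hl]; simp)
  have hcP : c ∈ P.concl := by simp [hcc]
  have hcn : R.tail c ∈ P.nodes := hc ▸ hnP
  have hoc : P.origin (P.head (P.mkArc c hcn)) = n := (origin_head hcP).trans hc
  have hn1 : n ∉ P₁.nodes := by simp [hn]
  have hL : R.left n (Or.inr hl) ∈ P₁.concl := by simp [h₁]
  have hR : R.right n (Or.inr hl) ∈ P₁.concl := by simp [h₁]
  have hγ : ∀ x ∈ γ, R.tail x ∈ P₁.nodes := fun x hx => tail_mem (by simp [h₁, hx])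
  have hplug : ∀ y, y ∈ ({P₁.head (P₁.mkArc _ (tail_mem hL)),
      P₁.head (P₁.mkArc _ (tail_mem hR))} : Set P₁.Node) ↔ Plugged P P₁ y := by
    intro y
    rw [head_eq_inr_of_mem (c := P₁.mkArc _ (tail_mem hL)) hL,
      head_eq_inr_of_mem (c := P₁.mkArc _ (tail_mem hR)) hR]
    constructor
    · rintro (rfl | rfl)
      · exact ⟨_, rfl, (R.head_left n _).symm ▸ hnP⟩
      · exact ⟨_, rfl, (R.head_right n _).symm ▸ hnP⟩
    · rintro ⟨⟨a, ha⟩, rfl, h2⟩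
      have h3 := ((P₁.mem_concl a).1 ha).2
      have h4 : R.head a = n := by
        by_contra h4
        exact h3 (hn ▸ ⟨h2, h4⟩)
      rcases eq_left_or_eq_right (Or.inr hl) h4 with rfl | rfl
      · exact Or.inl rfl
      · exact Or.inr rfl
  refine ⟨P₁.mkList γ hγ, P₁.mkArc _ (tail_mem hL), P₁.mkArc _ (tail_mem hR),
    part hsub hj₁ _ hplug, .inl ⟨n, hnP⟩, hl, P.mkArc c hcn,
    ?_, ?_, rfl, rfl, ?_, ?_, ?_, ?_, ?_, ?_⟩
  · exact concl_eq (l := P₁.mkList γ hγ ++ [P₁.mkArc _ (tail_mem hL), P₁.mkArc _ (tail_mem hR)])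
      (by simp only [List.map_append, List.map_cons, List.map_nil, map_val_mkList, mkArc, h₁])
  · exact concl_eq (l := (P₁.mkList γ hγ).map (incArc hsub) ++ [P.mkArc c hcn])
      (by simp only [List.map_append, List.map_cons, List.map_nil, map_val_map_incArc,
        map_val_mkList, mkArc, hcc])
  · exact congrArg Sum.inl (Subtype.ext hc)
  · exact mem_part_nodes.not.2 hn1
  · exact mem_part_nodes.not.2 (fun h => hn1 (hoc ▸ h))
  · refine Set.eq_univ_of_forall fun y => ?_
    by_cases hy : P.origin y = n
    · refine Or.inr ?_
      rcases eq_of_origin_eq hnP hcP hu hy with h | h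
      · exact Or.inl h
      · exact Or.inr (h.trans (head_eq_inr_of_mem (c := P.mkArc c hcn) hcP).symm)
    · refine Or.inl (mem_part_nodes.2 ?_)
      rw [hn]
      refine ⟨?_, hy⟩
      rcases y with n' | b
      · exact n'.2
      · exact tail_mem b.2
  · exact mem_part_arcs.not.2 (fun h => hn1 (hc ▸ h))
  · refine Set.eq_univ_of_forall fun a => ?_
    by_cases ha : R.tail a.1 = n
    · exact Or.inr (Subtype.ext (hu _ ha))
    · exact Or.inl (mem_part_arcs.2 (hn ▸ ⟨a.2, ha⟩))

theorem isTensor {n : R.Node} {c : R.Arc} {γ δ : List R.Arc} (hl : R.label n = .tensor)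
    (hnP : n ∈ P.nodes) (hn : P.nodes = P₁.nodes ∪ P₂.nodes ∪ {n})
    (hdis : Disjoint P₁.nodes P₂.nodes) (hn₁ : n ∉ P₁.nodes) (hn₂ : n ∉ P₂.nodes)
    (hc : R.tail c = n) (h₁ : P₁.concl = γ ++ [R.left n (Or.inl hl)])
    (h₂ : P₂.concl = R.right n (Or.inl hl) :: δ) (hcc : P.concl = γ ++ c :: δ)
    (hj₁ : P₁.JumpClosed J) (hj₂ : P₂.JumpClosed J) :
    IsTensor (P₁.toPS J hJ) (P₂.toPS J hJ) (P.toPS J hJ) := by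
  have hsub₁ : P₁.nodes ⊆ P.nodes := hn ▸ fun x hx => Or.inl (Or.inl hx)
  have hsub₂ : P₂.nodes ⊆ P.nodes := hn ▸ fun x hx => Or.inl (Or.inr hx)
  have hu : ∀ a, R.tail a = n → a = c := fun a ha =>
    eq_of_tail_eq (ha.trans hc.symm) (by rw [ha, hl]; simp)
  have hcP : c ∈ P.concl := by simp [hcc]
  have hcn : R.tail c ∈ P.nodes := hc ▸ hnP
  have hoc : P.origin (P.head (P.mkArc c hcn)) = n := (origin_head hcP).trans hc
  have hL : R.left n (Or.inl hl) ∈ P₁.concl := by simp [h₁]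
  have hR : R.right n (Or.inl hl) ∈ P₂.concl := by simp [h₂]
  have hγ : ∀ x ∈ γ, R.tail x ∈ P₁.nodes := fun x hx => tail_mem (by simp [h₁, hx])
  have hδ : ∀ x ∈ δ, R.tail x ∈ P₂.nodes := fun x hx => tail_mem (by simp [h₂, hx])
  rw [Set.disjoint_left] at hdis
  -- A conclusion of `P₁` cannot enter `P₂`, which would then contain its tail. If it is plugged, it
  -- is thus a premise of `n`, and the left one, since the right one comes from `P₂`.
  have hplug₁ : ∀ y, y ∈ ({P₁.head (P₁.mkArc _ (tail_mem hL))} : Set P₁.Node) ↔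
      Plugged P P₁ y := by
    intro y
    rw [head_eq_inr_of_mem (c := P₁.mkArc _ (tail_mem hL)) hL]
    constructor
    · rintro rfl
      exact ⟨_, rfl, (R.head_left n _).symm ▸ hnP⟩
    · rintro ⟨⟨a, ha⟩, rfl, h2⟩
      have h3 := (P₁.mem_concl a).1 ha
      have h4 : R.head a = n := by
        rw [hn] at h2
        rcases h2 with (h2 | h2) | h2
        · exact absurd h2 h3.2
        · exact absurd (P₂.up a h2) (hdis h3.1)
        · exact h2
      rcases eq_left_or_eq_right (Or.inl hl) h4 with rfl | rfl
      · rfl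
      · exact absurd (tail_mem hR) (hdis h3.1)
  have hplug₂ : ∀ y, y ∈ ({P₂.head (P₂.mkArc _ (tail_mem hR))} : Set P₂.Node) ↔
      Plugged P P₂ y := by
    intro y
    rw [head_eq_inr_of_mem (c := P₂.mkArc _ (tail_mem hR)) hR]
    constructor
    · rintro rfl
      exact ⟨_, rfl, (R.head_right n _).symm ▸ hnP⟩
    · rintro ⟨⟨a, ha⟩, rfl, h2⟩
      have h3 := (P₂.mem_concl a).1 ha
      have h4 : R.head a = n := by
        rw [hn] at h2
        rcases h2 with (h2 | h2) | h2
        · exact absurd h3.1 (hdis (P₁.up a h2))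
        · exact absurd h2 h3.2
        · exact h2
      rcases eq_left_or_eq_right (Or.inl hl) h4 with rfl | rfl
      · exact absurd h3.1 (hdis (tail_mem hL))
      · rfl
  refine ⟨P₁.mkList γ hγ, P₁.mkArc _ (tail_mem hL), P₂.mkArc _ (tail_mem hR), P₂.mkList δ hδ,
    part hsub₁ hj₁ _ hplug₁, part hsub₂ hj₂ _ hplug₂, .inl ⟨n, hnP⟩, hl, P.mkArc c hcn,
    ?_, ?_, ?_, rfl, rfl, ?_, ?_, ?_, ?_, ?_, ?_, ?_, ?_⟩
  · exact concl_eq (l := P₁.mkList γ hγ ++ [P₁.mkArc _ (tail_mem hL)])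
      (by simp only [List.map_append, List.map_cons, List.map_nil, map_val_mkList, mkArc, h₁])
  · exact concl_eq (l := P₂.mkArc _ (tail_mem hR) :: P₂.mkList δ hδ)
      (by simp only [List.map_cons, map_val_mkList, mkArc, h₂])
  · exact concl_eq (l := (P₁.mkList γ hγ).map (incArc hsub₁) ++ P.mkArc c hcn ::
      (P₂.mkList δ hδ).map (incArc hsub₂))
      (by simp only [List.map_append, List.map_cons, map_val_map_incArc, map_val_mkList, mkArc, hcc])
  · exact congrArg Sum.inl (Subtype.ext hc)
  · rw [Set.disjoint_left]
    exact fun y hy => mem_part_nodes.not.2 (hdis (mem_part_nodes.1 hy))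
  · exact fun h => h.elim (fun h => hn₁ (mem_part_nodes.1 h)) fun h => hn₂ (mem_part_nodes.1 h)
  · exact fun h => h.elim (fun h => hn₁ (hoc ▸ mem_part_nodes.1 h))
      fun h => hn₂ (hoc ▸ mem_part_nodes.1 h)
  · refine Set.eq_univ_of_forall fun y => ?_
    have hy : P.origin y ∈ P.nodes := by
      rcases y with n' | b
      · exact n'.2
      · exact tail_mem b.2
    rw [hn] at hy
    rcases hy with (hy | hy) | hy
    · exact Or.inl (Or.inl (mem_part_nodes.2 hy))
    · exact Or.inl (Or.inr (mem_part_nodes.2 hy))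
    · refine Or.inr ?_
      rcases eq_of_origin_eq hnP hcP hu hy with h | h
      · exact Or.inl h
      · exact Or.inr (h.trans (head_eq_inr_of_mem (c := P.mkArc c hcn) hcP).symm)
  · rw [Set.disjoint_left]
    exact fun y hy => mem_part_arcs.not.2 (hdis (mem_part_arcs.1 hy))
  · exact fun h => h.elim (fun h => hn₁ (hc ▸ mem_part_arcs.1 h))
      fun h => hn₂ (hc ▸ mem_part_arcs.1 h)
  · refine Set.eq_univ_of_forall fun a => ?_
    have ha := hn.subset a.2
    rcases ha with (ha | ha) | ha
    · exact Or.inl (Or.inl (mem_part_arcs.2 ha))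
    · exact Or.inl (Or.inr (mem_part_arcs.2 ha))
    · exact Or.inr (Subtype.ext (hu _ ha))

theorem isAx {n : R.Node} {a b : R.Arc} (hl : R.label n = .ax) (hn : P.nodes = {n})
    (hcc : P.concl = [a, b]) : IsAx (P.toPS J hJ) (R.ty a) ∧ R.ty b = (R.ty a).neg := by
  have ha : a ∈ P.concl := by simp [hcc]
  have hb : b ∈ P.concl := by simp [hcc]
  have hta : R.tail a = n := by have := tail_mem ha; rwa [hn] at this
  have htb : R.tail b = n := by have := tail_mem hb; rwa [hn] at this
  have hab : a ≠ b := by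
    have := P.nodup
    rw [hcc] at this
    simpa using this
  have hty : R.ty b = (R.ty a).neg :=
    R.ty_ax b a hab.symm (htb.trans hta.symm) (by rw [htb, hl])
  have hall : ∀ c, R.tail c = n → c = a ∨ c = b := by
    intro c hc
    by_contra hcon
    push Not at hcon
    have h1 : ({c, a, b} : Set R.Arc) ⊆ {x | R.tail x = n} := by
      rintro x (rfl | rfl | rfl) <;> assumption
    have h2 := Set.ncard_le_ncard h1 (Set.toFinite _)
    rw [R.card_conclusions, hl, Set.ncard_insert_of_notMem (by simp [hcon]),
      Set.ncard_pair hab] at h2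
    simp [Label.numConclusions] at h2
  have hnP : n ∈ P.nodes := by simp [hn]
  refine ⟨⟨.inl ⟨n, hnP⟩, P.mkArc a (tail_mem ha), P.mkArc b (tail_mem hb), hl,
    congrArg Sum.inl (Subtype.ext hta), congrArg Sum.inl (Subtype.ext htb), ?_, ?_, rfl, hty,
    ?_, ?_⟩, hty⟩
  · intro h
    have h1 : P.head (P.mkArc a (tail_mem ha)) = P.head (P.mkArc b (tail_mem hb)) := h
    rw [head_eq_inr_of_mem (c := P.mkArc b (tail_mem hb)) hb, head_eq_inr] at h1
    exact hab h1
  · exact concl_eq hcc.symm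
  · rintro (n' | c)
    · exact Or.inl (congrArg _ (Subtype.ext (hn.subset n'.2)))
    · have hc : c.1 = a ∨ c.1 = b := by have := c.2; simpa [hcc] using this
      rcases hc with hc | hc
      · exact Or.inr (Or.inl (head_eq_inr.2 hc.symm).symm)
      · exact Or.inr (Or.inr (head_eq_inr.2 hc.symm).symm)
  · rintro ⟨c, hc⟩
    rw [hn] at hc
    exact (hall c hc).imp (fun h => Subtype.ext h) fun h => Subtype.ext h

theorem isOne {n : R.Node} {a : R.Arc} (hl : R.label n = .one) (hn : P.nodes = {n})
    (hcc : P.concl = [a]) : IsOne (P.toPS J hJ) ∧ R.ty a = .one := by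
  have ha : a ∈ P.concl := by simp [hcc]
  have hta : R.tail a = n := by have := tail_mem ha; rwa [hn] at this
  have hnP : n ∈ P.nodes := by simp [hn]
  refine ⟨⟨.inl ⟨n, hnP⟩, P.mkArc a (tail_mem ha), hl, congrArg Sum.inl (Subtype.ext hta),
    concl_eq hcc.symm, ?_, ?_⟩, R.ty_one a (by rw [hta, hl])⟩
  · rintro (n' | c)
    · exact Or.inl (congrArg _ (Subtype.ext (hn.subset n'.2)))
    · have hc : c.1 = a := by have := c.2; simpa [hcc] using this
      exact Or.inr (head_eq_inr.2 hc.symm).symm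
  · rintro ⟨c, hc⟩
    rw [hn] at hc
    refine Subtype.ext (eq_of_tail_eq (Eq.trans hc hta.symm) ?_)
    rw [Set.mem_singleton_iff.1 hc, hl]
    simp

end Piece

end ProofStructure

/-! ### Proofs in a fragment -/

section InFragment

variable {F : Set Formula} {Γ Δ : List Formula} {A B : Formula}

theorem Proof.InFragment.ax (h : ∀ C ∈ [A, A.neg], C ∈ F) : (Proof.ax A).InFragment F := by
  intro Θ hΘ
  rw [Proof.sequents] at hΘ
  rcases hΘ with rfl | hΘ
  · exact h
  · exact absurd hΘ (Set.notMem_empty _)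

theorem Proof.InFragment.one (h : Formula.one ∈ F) : Proof.one.InFragment F := by
  intro Θ hΘ
  rw [Proof.sequents] at hΘ
  rcases hΘ with rfl | hΘ
  · simpa using h
  · exact absurd hΘ (Set.notMem_empty _)

theorem Proof.InFragment.ex {p : Proof (Γ ++ A :: B :: Δ)} (hp : p.InFragment F)
    (h : ∀ C ∈ Γ ++ B :: A :: Δ, C ∈ F) : p.ex.InFragment F := by
  intro Θ hΘ
  rw [Proof.sequents] at hΘ
  rcases hΘ with rfl | hΘ
  · exact h
  · exact hp _ hΘ

theorem Proof.InFragment.tensor {p : Proof (Γ ++ [A])} {q : Proof (B :: Δ)} (hp : p.InFragment F)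
    (hq : q.InFragment F) (h : ∀ C ∈ Γ ++ Formula.tensor A B :: Δ, C ∈ F) :
    (p.tensor q).InFragment F := by
  intro Θ hΘ
  rw [Proof.sequents] at hΘ
  rcases hΘ with rfl | hΘ | hΘ
  · exact h
  · exact hp _ hΘ
  · exact hq _ hΘ

theorem Proof.InFragment.par {p : Proof (Γ ++ [A, B])} (hp : p.InFragment F)
    (h : ∀ C ∈ Γ ++ [Formula.par A B], C ∈ F) : p.par.InFragment F := by
  intro Θ hΘ
  rw [Proof.sequents] at hΘ
  rcases hΘ with rfl | hΘ
  · exact h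
  · exact hp _ hΘ

theorem Proof.InFragment.bot {p : Proof Γ} (hp : p.InFragment F)
    (h : ∀ C ∈ Γ ++ [Formula.bot], C ∈ F) : p.bot.InFragment F := by
  intro Θ hΘ
  rw [Proof.sequents] at hΘ
  rcases hΘ with rfl | hΘ
  · exact h
  · exact hp _ hΘ

end InFragment

namespace ProofStructure

/-! ### Sequentializable pieces -/

namespace Piece

variable {R : ProofStructure} {P P₁ P₂ : R.Piece} {J : R.Node → Option R.Node}
  {hJ : ∀ n, (J n).isSome → R.label n = .bot}

/-- The piece comes from a cut-free proof of the fragment. -/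
def Sequentializable (P : R.Piece) (J : R.Node → Option R.Node)
    (hJ : ∀ n, (J n).isSome → R.label n = .bot) : Prop :=
  ∃ (Γ : List Formula) (π : Proof Γ), Γ = P.concl.map R.ty ∧ π.CutFree ∧ π.InFragment NBT ∧
    Deseq π (P.toPS J hJ)

theorem mem_of_mem_map_ty (hF : R.InFragment NBT) {l : List R.Arc} :
    ∀ C ∈ l.map R.ty, C ∈ NBT := by
  intro C hC
  obtain ⟨a, -, rfl⟩ := List.mem_map.1 hC
  exact hF a

theorem Sequentializable.swap (hF : R.InFragment NBT) (hs : P₁.Sequentializable J hJ)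
    {γ δ : List R.Arc} {a b : R.Arc} (hn : P.nodes = P₁.nodes) (hc : P₁.JumpClosed J)
    (h₁ : P₁.concl = γ ++ a :: b :: δ) (h : P.concl = γ ++ b :: a :: δ) :
    P.Sequentializable J hJ := by
  obtain ⟨Γ, π, hΓ, h2, h3, h4⟩ := hs
  rw [h₁, List.map_append, List.map_cons, List.map_cons] at hΓ
  subst hΓ
  refine ⟨_, π.ex, by simp [h], h2, h3.ex ?_, Deseq.ex h4 ?_⟩
  · have := mem_of_mem_map_ty hF (l := γ ++ b :: a :: δ)
    rwa [List.map_append, List.map_cons, List.map_cons] at this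
  · rw [List.length_map]
    exact isEx hn hc h₁ h

/-- The same piece with its conclusions in another order. -/
def reorder (P : R.Piece) (l : List R.Arc) (h : l.Perm P.concl) : R.Piece where
  nodes := P.nodes
  concl := l
  up := P.up
  ne_bullet := P.ne_bullet
  nodup := h.nodup_iff.2 P.nodup
  mem_concl a := h.mem_iff.trans (P.mem_concl a)

theorem eq_of_nodes_eq (h : P.nodes = P₁.nodes) (h' : P.concl = P₁.concl) : P = P₁ := by
  cases P; cases P₁; cases h; cases h'; rfl

theorem JumpClosed.congr (hc : P₁.JumpClosed J) (h : P.nodes = P₁.nodes) : P.JumpClosed J := by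
  unfold JumpClosed
  rw [h]
  exact hc

/-- The prefix `γ` is carried along because a transposition may occur at any depth of the list: the
head of a `cons` passes into the prefix. -/
theorem Sequentializable.perm (hF : R.InFragment NBT) {l l' : List R.Arc} (h : l.Perm l')
    (hs : P₁.Sequentializable J hJ) (hn : P.nodes = P₁.nodes) (hc : P₁.JumpClosed J) (γ : List R.Arc)
    (h₁ : P₁.concl = γ ++ l) (h' : P.concl = γ ++ l') : P.Sequentializable J hJ := by
  induction h generalizing γ P P₁ with
  | nil => rwa [eq_of_nodes_eq hn (h'.trans h₁.symm)]
  | cons x _ ih => exact ih hs hn hc (γ ++ [x]) (by simp [h₁]) (by simp [h'])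
  | swap x y l => exact hs.swap hF hn hc h₁ h'
  | @trans l₁ l₂ l₃ hp hp' ih ih' =>
    have hperm : (γ ++ l₂).Perm P₁.concl := by
      rw [h₁]
      exact List.Perm.append_left γ hp.symm
    have h2 : (P₁.reorder _ hperm).Sequentializable J hJ := ih hs rfl hc γ h₁ rfl
    exact ih' (P₁ := P₁.reorder _ hperm) h2 hn (hc.congr rfl) γ rfl h'

/-- The order of the conclusions does not matter. -/
theorem Sequentializable.of_nodes_eq (hF : R.InFragment NBT) (hs : P₁.Sequentializable J hJ)
    (hn : P.nodes = P₁.nodes) (hc : P₁.JumpClosed J) : P.Sequentializable J hJ := by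
  refine hs.perm hF ((List.perm_ext_iff_of_nodup P₁.nodup P.nodup).2 fun a => ?_) hn hc [] rfl rfl
  rw [P.mem_concl, P₁.mem_concl, hn]

theorem Sequentializable.bot (hF : R.InFragment NBT) (hs : P₁.Sequentializable J hJ)
    {n : R.Node} {c : R.Arc} (hl : R.label n = .bot) (hnP : n ∈ P.nodes)
    (hn : P₁.nodes = P.nodes \ {n}) (hc : R.tail c = n) (hcc : P.concl = P₁.concl ++ [c])
    (hj₁ : P₁.JumpClosed J) {x : R.Node} (hx : J n = some x)
    (hxs : x ∈ P₁.nodes ∨ R.label x = .bullet ∧ ∃ a, R.tail a ∈ P₁.nodes ∧ R.head a = x) :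
    P.Sequentializable J hJ := by
  obtain ⟨Γ, π, rfl, h2, h3, h4⟩ := hs
  have e : P.concl.map R.ty = P₁.concl.map R.ty ++ [Formula.bot] := by
    rw [hcc, List.map_append, List.map_singleton, R.ty_bot c (by rw [hc, hl])]
  refine ⟨_, π.bot, e.symm, h2, h3.bot ?_, Deseq.bot h4 (isBot hl hnP hn hc hcc hj₁ hx hxs)⟩
  exact e ▸ mem_of_mem_map_ty hF

theorem Sequentializable.par (hF : R.InFragment NBT) (hs : P₁.Sequentializable J hJ)
    {n : R.Node} {c : R.Arc} {γ : List R.Arc} (hl : R.label n = .par)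
    (hnP : n ∈ P.nodes) (hn : P₁.nodes = P.nodes \ {n}) (hc : R.tail c = n)
    (h₁ : P₁.concl = γ ++ [R.left n (Or.inr hl), R.right n (Or.inr hl)])
    (hcc : P.concl = γ ++ [c]) (hj₁ : P₁.JumpClosed J) : P.Sequentializable J hJ := by
  obtain ⟨Γ, π, hΓ, h2, h3, h4⟩ := hs
  rw [h₁, List.map_append, List.map_cons, List.map_singleton] at hΓ
  subst hΓ
  subst hc
  have e : P.concl.map R.ty = γ.map R.ty ++ [Formula.par (R.ty (R.left (R.tail c) (Or.inr hl)))
      (R.ty (R.right (R.tail c) (Or.inr hl)))] := by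
    rw [hcc, List.map_append, List.map_singleton, R.ty_par c hl]
  refine ⟨_, π.par, e.symm, h2, h3.par ?_, Deseq.par h4 (isPar hl hnP hn rfl h₁ hcc hj₁)⟩
  exact e ▸ mem_of_mem_map_ty hF

theorem Sequentializable.tensor (hF : R.InFragment NBT) (hs₁ : P₁.Sequentializable J hJ)
    (hs₂ : P₂.Sequentializable J hJ) {n : R.Node} {c : R.Arc} {γ δ : List R.Arc}
    (hl : R.label n = .tensor) (hnP : n ∈ P.nodes) (hn : P.nodes = P₁.nodes ∪ P₂.nodes ∪ {n})
    (hdis : Disjoint P₁.nodes P₂.nodes) (hn₁ : n ∉ P₁.nodes) (hn₂ : n ∉ P₂.nodes)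
    (hc : R.tail c = n) (h₁ : P₁.concl = γ ++ [R.left n (Or.inl hl)])
    (h₂ : P₂.concl = R.right n (Or.inl hl) :: δ) (hcc : P.concl = γ ++ c :: δ)
    (hj₁ : P₁.JumpClosed J) (hj₂ : P₂.JumpClosed J) : P.Sequentializable J hJ := by
  obtain ⟨Γ, π, hΓ, a2, a3, a4⟩ := hs₁
  obtain ⟨Δ, π', hΔ, b2, b3, b4⟩ := hs₂
  rw [h₁, List.map_append, List.map_singleton] at hΓ
  rw [h₂, List.map_cons] at hΔ
  subst hΓ hΔ
  subst hc
  have e : P.concl.map R.ty = γ.map R.ty ++ Formula.tensor (R.ty (R.left (R.tail c) (Or.inl hl)))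
      (R.ty (R.right (R.tail c) (Or.inl hl))) :: δ.map R.ty := by
    rw [hcc, List.map_append, List.map_cons, R.ty_tensor c hl]
  refine ⟨_, π.tensor π', e.symm, ⟨a2, b2⟩, a3.tensor b3 ?_, Deseq.tensor a4 b4
    (isTensor hl hnP hn hdis hn₁ hn₂ rfl h₁ h₂ hcc hj₁ hj₂)⟩
  exact e ▸ mem_of_mem_map_ty hF

theorem sequentializable_ax (hF : R.InFragment NBT) {n : R.Node} {a b : R.Arc}
    (hl : R.label n = .ax) (hn : P.nodes = {n}) (hcc : P.concl = [a, b]) :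
    P.Sequentializable J hJ := by
  obtain ⟨h1, h2⟩ := isAx (J := J) (hJ := hJ) hl hn hcc
  have e : P.concl.map R.ty = [R.ty a, (R.ty a).neg] := by simp [hcc, h2]
  exact ⟨_, .ax _, e.symm, trivial, .ax (e ▸ mem_of_mem_map_ty hF), .ax h1⟩

theorem sequentializable_one (hF : R.InFragment NBT) {n : R.Node} {a : R.Arc}
    (hl : R.label n = .one) (hn : P.nodes = {n}) (hcc : P.concl = [a]) :
    P.Sequentializable J hJ := by
  obtain ⟨h1, h2⟩ := isOne (J := J) (hJ := hJ) hl hn hcc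
  exact ⟨_, .one, by simp [hcc, h2], trivial, .one (h2 ▸ hF a), .one h1⟩

end Piece

/-! ### Renaming -/

section Renaming

variable {R₁ R₂ R R' : ProofStructure}

/-- Composition of an inclusion with a renaming. -/
def Part.comp {S : Set R₁.Node} (i : Part R₁ R S) (e : Part R R' ∅) : Part R₁ R' S where
  node x := e.node (i.node x)
  arc a := e.arc (i.arc a)
  arc_inj := e.arc_inj.comp i.arc_inj
  node_inj x hx y hy h := i.node_inj hx hy (e.node_inj (Set.notMem_empty _) (Set.notMem_empty _) h)
  tail_arc a := by rw [e.tail_arc, i.tail_arc]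
  head_arc a := by rw [e.head_arc, i.head_arc]
  label_node x hx := by rw [e.label_node _ (Set.notMem_empty _), i.label_node x hx]
  left_node x hx h h' := by
    rw [e.left_node _ (Set.notMem_empty _) (by rw [i.label_node x hx]; exact h),
      i.left_node x hx h]
  right_node x hx h h' := by
    rw [e.right_node _ (Set.notMem_empty _) (by rw [i.label_node x hx]; exact h),
      i.right_node x hx h]
  ty_arc a := by rw [e.ty_arc, i.ty_arc]
  jump_node x hx := by
    rw [e.jump_node _ (Set.notMem_empty _), i.jump_node x hx, Option.map_map]
    rfl
  jump_survives := i.jump_survives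

variable (e : Part R R' ∅)

theorem Part.node_eq {x y : R.Node} : e.node x = e.node y ↔ x = y :=
  ⟨fun h => e.node_inj (Set.notMem_empty _) (Set.notMem_empty _) h, fun h => h ▸ rfl⟩

theorem Part.node_mem_comp {S : Set R₁.Node} {i : Part R₁ R S} {y : R.Node} :
    e.node y ∈ (i.comp e).nodes ↔ y ∈ i.nodes := by
  constructor
  · rintro ⟨x, hx, h⟩
    exact ⟨x, hx, (e.node_eq).1 h⟩
  · rintro ⟨x, hx, rfl⟩
    exact ⟨x, hx, rfl⟩

theorem Part.arc_mem_comp {S : Set R₁.Node} {i : Part R₁ R S} {a : R.Arc} :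
    e.arc a ∈ (i.comp e).arcs ↔ a ∈ i.arcs := by
  constructor
  · rintro ⟨x, h⟩
    exact ⟨x, e.arc_inj h⟩
  · rintro ⟨x, rfl⟩
    exact ⟨x, rfl⟩

/-- `e` is a renaming of `R` into `R'`. -/
structure Part.IsRenaming : Prop where
  node_surj : Function.Surjective e.node
  arc_surj : Function.Surjective e.arc
  concl_eq : R'.concl = R.concl.map e.arc

variable {e}

theorem IsAx.rename (he : e.IsRenaming) {A : Formula} (h : R.IsAx A) : R'.IsAx A := by
  obtain ⟨n, a, b, h1, rfl, h3, h4, h5, h6, h7, h8, h9⟩ := h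
  refine ⟨e.node (R.tail a), e.arc a, e.arc b, ?_, e.tail_arc a, ?_, ?_, ?_, ?_, ?_, ?_, ?_⟩
  · rw [e.label_node _ (Set.notMem_empty _), h1]
  · rw [e.tail_arc, h3]
  · rw [e.head_arc, e.head_arc, Ne, e.node_eq]
    exact h4
  · rw [he.concl_eq, h5]; rfl
  · rw [e.ty_arc, h6]
  · rw [e.ty_arc, h7]
  · intro x
    obtain ⟨x, rfl⟩ := he.node_surj x
    rw [e.head_arc, e.head_arc, e.node_eq, e.node_eq, e.node_eq]
    exact h8 x
  · intro c
    obtain ⟨c, rfl⟩ := he.arc_surj c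
    rw [e.arc_inj.eq_iff, e.arc_inj.eq_iff]
    exact h9 c

theorem IsOne.rename (he : e.IsRenaming) (h : R.IsOne) : R'.IsOne := by
  obtain ⟨n, a, h1, rfl, h3, h4, h5⟩ := h
  refine ⟨e.node (R.tail a), e.arc a, ?_, e.tail_arc a, ?_, ?_, ?_⟩
  · rw [e.label_node _ (Set.notMem_empty _), h1]
  · rw [he.concl_eq, h3]; rfl
  · intro x
    obtain ⟨x, rfl⟩ := he.node_surj x
    rw [e.head_arc, e.node_eq, e.node_eq]
    exact h4 x
  · intro c
    obtain ⟨c, rfl⟩ := he.arc_surj c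
    rw [e.arc_inj.eq_iff]
    exact h5 c

theorem IsEx.rename (he : e.IsRenaming) {k : ℕ} (h : IsEx k R₁ R) : IsEx k R₁ R' := by
  obtain ⟨i, γ, δ, a, b, h1, h2, h3, h4, h5⟩ := h
  refine ⟨i.comp e, γ, δ, a, b, h1, h2, ?_, ?_, ?_⟩
  · rw [he.concl_eq, h3]
    simp [Part.comp, Function.comp_def]
  · refine Set.eq_univ_of_forall fun x => ?_
    obtain ⟨x, rfl⟩ := he.node_surj x
    rw [e.node_mem_comp, h4]
    trivial
  · refine Set.eq_univ_of_forall fun x => ?_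
    obtain ⟨x, rfl⟩ := he.arc_surj x
    rw [e.arc_mem_comp, h5]
    trivial

theorem IsBot.rename (he : e.IsRenaming) (h : IsBot R₁ R) : IsBot R₁ R' := by
  obtain ⟨i, n, c, m, h1, h2, h3, h4, h5, h6, h7, h8, h9⟩ := h
  refine ⟨i.comp e, e.node n, e.arc c, m, ?_, ?_, ?_, ?_, ?_, ?_, ?_, ?_, ?_⟩
  · rw [e.label_node _ (Set.notMem_empty _), h1]
  · rw [e.tail_arc, h2]
  · rw [e.jump_node _ (Set.notMem_empty _), h3]; rfl
  · rw [he.concl_eq, h4]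
    simp [Part.comp, Function.comp_def]
  · rwa [e.node_mem_comp]
  · rwa [e.head_arc, e.node_mem_comp]
  · refine Set.eq_univ_of_forall fun x => ?_
    obtain ⟨x, rfl⟩ := he.node_surj x
    rcases h7.ge (Set.mem_univ x) with h | rfl | rfl
    · exact Or.inl (e.node_mem_comp.2 h)
    · exact Or.inr (Or.inl rfl)
    · exact Or.inr (Or.inr (e.head_arc c).symm)
  · rwa [e.arc_mem_comp]
  · refine Set.eq_univ_of_forall fun x => ?_
    obtain ⟨x, rfl⟩ := he.arc_surj x
    rcases h9.ge (Set.mem_univ x) with h | rfl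
    · exact Or.inl (e.arc_mem_comp.2 h)
    · exact Or.inr rfl

theorem IsPar.rename (he : e.IsRenaming) (h : IsPar R₁ R) : IsPar R₁ R' := by
  obtain ⟨γ, a, b, i, n, hn, c, h1, h2, h3, h4, h5, h6, h7, h8, h9, h10⟩ := h
  refine ⟨γ, a, b, i.comp e, e.node n, (e.label_node _ (Set.notMem_empty _)).trans hn, e.arc c,
    h1, ?_, ?_, ?_, ?_, ?_, ?_, ?_, ?_, ?_⟩
  · rw [he.concl_eq, h2]
    simp [Part.comp, Function.comp_def]
  · exact (e.left_node _ (Set.notMem_empty _) (Or.inr hn) _).trans (congrArg e.arc h3)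
  · exact (e.right_node _ (Set.notMem_empty _) (Or.inr hn) _).trans (congrArg e.arc h4)
  · rw [e.tail_arc, h5]
  · rwa [e.node_mem_comp]
  · rwa [e.head_arc, e.node_mem_comp]
  · refine Set.eq_univ_of_forall fun x => ?_
    obtain ⟨x, rfl⟩ := he.node_surj x
    rcases h8.ge (Set.mem_univ x) with h | rfl | rfl
    · exact Or.inl (e.node_mem_comp.2 h)
    · exact Or.inr (Or.inl rfl)
    · exact Or.inr (Or.inr (e.head_arc c).symm)
  · rwa [e.arc_mem_comp]
  · refine Set.eq_univ_of_forall fun x => ?_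
    obtain ⟨x, rfl⟩ := he.arc_surj x
    rcases h10.ge (Set.mem_univ x) with h | rfl
    · exact Or.inl (e.arc_mem_comp.2 h)
    · exact Or.inr rfl

theorem IsTensor.rename (he : e.IsRenaming) (h : IsTensor R₁ R₂ R) : IsTensor R₁ R₂ R' := by
  obtain ⟨γ, a, b, δ, i, j, n, hn, c, h1, h2, h3, h4, h5, h6, h7, h8, h9, h10, h11, h12, h13⟩ := h
  refine ⟨γ, a, b, δ, i.comp e, j.comp e, e.node n,
    (e.label_node _ (Set.notMem_empty _)).trans hn, e.arc c,
    h1, h2, ?_, ?_, ?_, ?_, ?_, ?_, ?_, ?_, ?_, ?_, ?_⟩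
  · rw [he.concl_eq, h3]
    simp [Part.comp, Function.comp_def]
  · exact (e.left_node _ (Set.notMem_empty _) (Or.inl hn) _).trans (congrArg e.arc h4)
  · exact (e.right_node _ (Set.notMem_empty _) (Or.inl hn) _).trans (congrArg e.arc h5)
  · rw [e.tail_arc, h6]
  · rw [Set.disjoint_left] at h7 ⊢
    intro x
    obtain ⟨x, rfl⟩ := he.node_surj x
    rw [e.node_mem_comp, e.node_mem_comp]
    exact @h7 x
  · rwa [Set.mem_union, e.node_mem_comp, e.node_mem_comp]
  · rwa [e.head_arc, Set.mem_union, e.node_mem_comp, e.node_mem_comp]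
  · refine Set.eq_univ_of_forall fun x => ?_
    obtain ⟨x, rfl⟩ := he.node_surj x
    rcases h10.ge (Set.mem_univ x) with (h | h) | rfl | rfl
    · exact Or.inl (Or.inl (e.node_mem_comp.2 h))
    · exact Or.inl (Or.inr (e.node_mem_comp.2 h))
    · exact Or.inr (Or.inl rfl)
    · exact Or.inr (Or.inr (e.head_arc c).symm)
  · rw [Set.disjoint_left] at h11 ⊢
    intro x
    obtain ⟨x, rfl⟩ := he.arc_surj x
    rw [e.arc_mem_comp, e.arc_mem_comp]
    exact @h11 x
  · rwa [Set.mem_union, e.arc_mem_comp, e.arc_mem_comp]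
  · refine Set.eq_univ_of_forall fun x => ?_
    obtain ⟨x, rfl⟩ := he.arc_surj x
    rcases h13.ge (Set.mem_univ x) with (h | h) | rfl
    · exact Or.inl (Or.inl (e.arc_mem_comp.2 h))
    · exact Or.inl (Or.inr (e.arc_mem_comp.2 h))
    · exact Or.inr rfl

/-- Desequentialization is defined up to the names of nodes and arcs. -/
theorem _root_.LL.Deseq.rename (he : e.IsRenaming) {Γ : List Formula} {π : Proof Γ}
    (hπ : π.CutFree) (h : Deseq π R) : Deseq π R' := by
  -- Only the last rule is concerned, and it refers to `R` through inclusions that compose with the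
  -- renaming; the premises of the rule are unchanged.
  cases h with
  | ax h => exact .ax (h.rename he)
  | cut => exact hπ.elim
  | ex hp h => exact .ex hp (h.rename he)
  | tensor hp hq h => exact .tensor hp hq (h.rename he)
  | one h => exact .one (h.rename he)
  | par hp h => exact .par hp (h.rename he)
  | bot hp h => exact .bot hp (h.rename he)

end Renaming

/-! ### The whole proof-structure as a piece -/

/-- The piece made of all the nodes that are not `•` nodes. -/
def fullPiece (R : ProofStructure) : R.Piece where
  nodes := {n | R.label n ≠ .bullet}
  concl := R.concl
  up a _ := label_tail_ne_bullet a
  ne_bullet _ h := h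
  nodup := R.concl_nodup
  mem_concl a := by
    rw [R.mem_concl]
    exact ⟨fun h => ⟨label_tail_ne_bullet a, fun h' => h' h⟩, fun h => not_not.1 h.2⟩

variable {R : ProofStructure}

theorem stable_fullPiece (t : R.fullPiece.Node) : R.fullPiece.Stable t := by
  rcases t with n | a
  · trivial
  · exact (R.mem_concl a.1).1 a.2

theorem jumpClosed_fullPiece {J : R.Node → Option R.Node} : R.fullPiece.JumpClosed J := by
  intro n _ x _
  by_cases hx : R.label x = .bullet
  · obtain ⟨a, ha⟩ := exists_head_eq_of_bullet hx
    exact Or.inr ⟨hx, a, label_tail_ne_bullet a, ha⟩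
  · exact Or.inl hx

theorem map_proj_jump (J : R.Node → Option R.Node) (hJ : ∀ n, (J n).isSome → R.label n = .bot)
    (t : R.fullPiece.Node) :
    J (R.fullPiece.proj t) = (R.fullPiece.jump J t).map R.fullPiece.proj := by
  rcases t with n | a
  · rcases hn : J n.1 with _ | y
    · rw [Piece.jump_eq_none hn]
      exact hn
    · obtain ⟨t, ht, rfl⟩ := Piece.exists_stable (jumpClosed_fullPiece n.1 n.2 y hn)
      rw [Piece.jump_eq_some.2 ⟨ht, hn⟩]
      exact hn
  · change J (R.head a.1) = none
    by_contra h
    have h1 := hJ _ (Option.isSome_iff_ne_none.2 h)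
    rw [(R.mem_concl a.1).1 a.2] at h1
    cases h1

/-- The renaming of the full piece into the proof-structure. -/
noncomputable def fullPieceRenaming (m : R.Node) :
    Part (R.fullPiece.toPS (R.canonicalJump m) (R.canonicalExt m).jump_bot) (R.canonicalExt m)
      ∅ where
  node := R.fullPiece.proj
  arc := Subtype.val
  arc_inj := Subtype.val_injective
  node_inj x _ y _ h := (stable_fullPiece x).eq (stable_fullPiece y) h
  tail_arc _ := rfl
  head_arc a := (Piece.proj_head (P := R.fullPiece) a).symm
  label_node := by
    rintro (n | a) -
    · rfl
    · exact (R.mem_concl a.1).1 a.2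
  left_node := by
    rintro (n | a) - h h'
    · rfl
    · rcases h with h | h <;> cases h
  right_node := by
    rintro (n | a) - h h'
    · rfl
    · rcases h with h | h <;> cases h
  ty_arc _ := rfl
  jump_node x _ := map_proj_jump (R.canonicalJump m) (R.canonicalExt m).jump_bot x
  jump_survives _ _ _ h := h

theorem isRenaming_fullPieceRenaming (m : R.Node) : (fullPieceRenaming m).IsRenaming where
  node_surj x := by
    by_cases hx : R.label x = .bullet
    · obtain ⟨a, ha⟩ := exists_head_eq_of_bullet hx
      exact ⟨.inr ⟨a, (R.mem_concl a).2 (ha ▸ hx)⟩, ha⟩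
    · exact ⟨.inl ⟨x, hx⟩, rfl⟩
  arc_surj a := ⟨⟨a, label_tail_ne_bullet a⟩, rfl⟩
  concl_eq := (List.attachWith_map_subtype_val _).symm

end ProofStructure

/-! ### Removal of terminal nodes from a piece -/

namespace ProofStructure

variable {R : ProofStructure}

theorem not_erasing_tail_of_bullet {a : R.Arc} (hb : R.label (R.head a) = .bullet)
    (h : ¬ R.Erasing (R.head a)) : ¬ R.Erasing (R.tail a) := fun h' =>
  h ⟨_, Or.inr (Or.inr hb), fun b hba => by rwa [eq_of_head_eq_of_bullet hba (hba ▸ hb)]⟩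

/-- This ensures that the removal of erasing nodes never destroys the target of a jump. -/
theorem not_erasing_of_canonicalJump (hF : R.InFragment NBT) (hcut : R.CutFree) {m : R.Node}
    (hm : ¬ R.Erasing m) {n y : R.Node} (h : R.canonicalJump m n = some y) : ¬ R.Erasing y := by
  have hn : R.label n = .bot := (R.canonicalExt m).jump_bot n (by
    change (R.canonicalJump m n).isSome
    rw [h]; rfl)
  by_cases hw : n ∈ R.wPar
  · obtain ⟨y', h1, n₀, -, -, h2, -⟩ := canonicalJump_of_mem_wPar hF hcut m hw
    rw [h] at h1
    obtain rfl := Option.some.inj h1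
    exact h2
  · rw [canonicalJump_of_notMem_wPar m hn hw] at h
    obtain rfl := Option.some.inj h
    exact hm

namespace Piece

variable (P : R.Piece)

open Classical in
/-- The list of the arcs with a given property. -/
noncomputable def _root_.LL.ProofStructure.arcList (p : R.Arc → Prop) : List R.Arc :=
  (Finset.univ.filter p).toList

theorem _root_.LL.ProofStructure.mem_arcList {p : R.Arc → Prop} {a : R.Arc} :
    a ∈ arcList p ↔ p a := by
  simp [arcList]

theorem _root_.LL.ProofStructure.nodup_arcList (p : R.Arc → Prop) : (arcList p).Nodup :=
  Finset.nodup_toList _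

/-- The piece with given nodes and conclusions. -/
def restrict (N : Set R.Node) (hN : N ⊆ P.nodes) (hup : ∀ a, R.head a ∈ N → R.tail a ∈ N)
    (l : List R.Arc) (hl : l.Nodup) (h : ∀ a, a ∈ l ↔ R.tail a ∈ N ∧ R.head a ∉ N) : R.Piece where
  nodes := N
  concl := l
  up := hup
  ne_bullet n hn := P.ne_bullet n (hN hn)
  nodup := hl
  mem_concl := h

open Classical in
/-- The non-erasing nodes of a piece. -/
noncomputable def core : Finset R.Node := Finset.univ.filter fun n => n ∈ P.nodes ∧ ¬ R.Erasing n

variable {P}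

theorem mem_core {n : R.Node} : n ∈ P.core ↔ n ∈ P.nodes ∧ ¬ R.Erasing n := by
  simp [core]

/-- No arc goes from `n` to a node of the piece. -/
def IsTerminal (P : R.Piece) (n : R.Node) : Prop := ∀ a, R.tail a = n → R.head a ∉ P.nodes

/-- An erasing node of the piece is not terminal, so an arc leads from it to a node of the piece, a
`⅋` by the fragment. If that node is erasing too, the descent goes on; a counterexample of maximal
rank is therefore impossible. -/
theorem exists_core_below (hF : R.InFragment NBT) (hcut : R.CutFree)
    (hE : ∀ n ∈ P.nodes, R.Erasing n → ¬ P.IsTerminal n) {x : R.Node} (hx : x ∈ P.nodes)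
    (hxe : R.Erasing x) :
    ∃ q ∈ P.nodes, ¬ R.Erasing q ∧ R.label q = .par ∧ R.Prec x q := by
  classical
  by_contra hcon
  let Q : Finset R.Node := Finset.univ.filter fun x => x ∈ P.nodes ∧ R.Erasing x ∧
    ¬ ∃ q ∈ P.nodes, ¬ R.Erasing q ∧ R.label q = .par ∧ R.Prec x q
  have hQ : Q.Nonempty := ⟨x, Finset.mem_filter.2 ⟨Finset.mem_univ _, hx, hxe, hcon⟩⟩
  obtain ⟨y, hy, hmax⟩ := Finset.exists_max_image Q R.rank hQ
  obtain ⟨-, hyP, hye, hyq⟩ := Finset.mem_filter.1 hy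
  have hter := hE y hyP hye
  unfold IsTerminal at hter
  push Not at hter
  obtain ⟨a, rfl, haP⟩ := hter
  have hs : R.Prec (R.tail a) (R.head a) := .single ⟨a, rfl, rfl⟩
  have hpar : R.label (R.head a) = .par :=
    (hye.label_head hF hcut).resolve_right (P.ne_bullet _ haP)
  by_cases he : R.Erasing (R.head a)
  · have h1 : R.head a ∈ Q := Finset.mem_filter.2 ⟨Finset.mem_univ _, haP, he,
      fun ⟨q, h1, h2, h3, h4⟩ => hyq ⟨q, h1, h2, h3, hs.trans h4⟩⟩
    have := hmax _ h1
    have := rank_lt a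
    omega
  · exact hyq ⟨_, haP, he, hpar, hs⟩

theorem mem_of_prec {x y : R.Node} (h : R.Prec x y) (hy : y ∈ P.nodes) : x ∈ P.nodes := by
  induction h using Relation.TransGen.head_induction_on with
  | single h => obtain ⟨a, rfl, rfl⟩ := h; exact P.up a hy
  | head h _ ih => obtain ⟨a, rfl, rfl⟩ := h; exact P.up a ih

/-- If no terminal node of the piece is erasing, then a `⊥` node of the piece jumps to a premise of
a `⅋` node of the piece below it. -/
theorem canonicalJump_spec (hF : R.InFragment NBT) (hcut : R.CutFree)
    (hE : ∀ n ∈ P.nodes, R.Erasing n → ¬ P.IsTerminal n) {m n y : R.Node} (hn : n ∈ P.nodes)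
    (h : R.canonicalJump m n = some y) :
    ∃ c, R.tail c = y ∧ R.head c ∈ P.nodes ∧ R.label (R.head c) = .par ∧
      ¬ R.Erasing (R.head c) ∧ R.Prec n (R.head c) := by
  have hb : R.label n = .bot := (R.canonicalExt m).jump_bot n (by
    change (R.canonicalJump m n).isSome
    rw [h]; rfl)
  obtain ⟨q, hq, hqe, hqp, hnq⟩ := exists_core_below hF hcut hE hn (erasing_of_bot hb)
  obtain ⟨y', h1, n₀, h2, h3, -, a, h4, rfl⟩ := canonicalJump_of_mem_wPar hF hcut m
    (n := n) ⟨hb, q, hqp, hqe, hnq⟩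
  rw [h] at h1
  obtain rfl := Option.some.inj h1
  refine ⟨a, h4, ?_, h2⟩
  -- The least non-erasing `⅋` below `n` is `q` or lies above `q`, so it belongs to the piece.
  rcases h3 q ⟨hqp, hqe, hnq⟩ with h5 | h5
  · exact h5 ▸ hq
  · exact mem_of_prec h5 hq

section Steps

variable {J : R.Node → Option R.Node}
  {hJ : ∀ n, (J n).isSome → R.label n = .bot}

/-- A piece is sequentializable if it is after the removal of a terminal `⊥` node. -/
theorem sequentializable_of_bot (hF : R.InFragment NBT) {n : R.Node} (hnP : n ∈ P.nodes)
    (hl : R.label n = .bot) (hter : P.IsTerminal n) (hjP : P.JumpClosed J) {x : R.Node}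
    (hx : J n = some x)
    (hrec : ∀ P₁ : R.Piece, P₁.nodes = P.nodes \ {n} → P₁.JumpClosed J ∧
      (x ∈ P₁.nodes ∨ R.label x = .bullet ∧ ∃ a, R.tail a ∈ P₁.nodes ∧ R.head a = x) ∧
      P₁.Sequentializable J hJ) :
    P.Sequentializable J hJ := by
  obtain ⟨c, hc⟩ := exists_tail_eq (n := n) (by simp [hl]) (by simp [hl])
  have hup : ∀ a, R.head a ∈ P.nodes \ {n} → R.tail a ∈ P.nodes \ {n} := fun a ha =>
    ⟨P.up a ha.1, fun h => hter a h ha.1⟩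
  have hhead : ∀ a, R.head a ≠ n := fun a ha =>
    label_head_ne_of_numPremises_eq_zero ha (by rw [hl]; rfl)
  let P₁ := P.restrict (P.nodes \ {n}) Set.sdiff_subset hup
    (arcList fun a => R.tail a ∈ P.nodes \ {n} ∧ R.head a ∉ P.nodes \ {n}) (nodup_arcList _)
    fun a => mem_arcList
  have hm₁ : ∀ a, a ∈ P₁.concl ↔ R.tail a ∈ P.nodes \ {n} ∧ R.head a ∉ P.nodes \ {n} :=
    fun a => mem_arcList
  have hu : ∀ a, R.tail a = n → a = c := fun a ha =>
    eq_of_tail_eq (ha.trans hc.symm) (by rw [ha, hl]; simp)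
  -- `P'` has its conclusions in the order that the rule produces; exchanges then restore the order
  -- of `P`.
  let P' := P.restrict P.nodes subset_rfl P.up (P₁.concl ++ [c])
    (by
      refine List.nodup_append.2 ⟨nodup_arcList _, List.nodup_singleton _, ?_⟩
      rintro a ha b hb rfl
      rw [List.mem_singleton] at hb
      exact ((hm₁ a).1 ha).1.2 (by rw [hb, hc]; rfl))
    (by
      intro a
      rw [List.mem_append, List.mem_singleton, hm₁]
      constructor
      · rintro (⟨h1, h2⟩ | rfl)
        · exact ⟨h1.1, fun h => h2 ⟨h, hhead a⟩⟩
        · exact ⟨hc ▸ hnP, hter _ hc⟩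
      · rintro ⟨h1, h2⟩
        by_cases h : R.tail a = n
        · exact Or.inr (hu a h)
        · exact Or.inl ⟨⟨h1, h⟩, fun h3 => h2 h3.1⟩)
  obtain ⟨r1, r2, r3⟩ := hrec P₁ rfl
  have : P'.Sequentializable J hJ := r3.bot hF hl hnP rfl hc rfl r1 hx r2
  exact this.of_nodes_eq hF rfl (hjP.congr rfl)

/-- A piece is sequentializable if it is after the removal of a terminal `⅋` node. -/
theorem sequentializable_of_par (hF : R.InFragment NBT) {n : R.Node} (hnP : n ∈ P.nodes)
    (hl : R.label n = .par) (hter : P.IsTerminal n) (hjP : P.JumpClosed J)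
    (hrec : ∀ P₁ : R.Piece, P₁.nodes = P.nodes \ {n} → P₁.JumpClosed J ∧
      P₁.Sequentializable J hJ) :
    P.Sequentializable J hJ := by
  obtain ⟨c, hc⟩ := exists_tail_eq (n := n) (by simp [hl]) (by simp [hl])
  have hup : ∀ a, R.head a ∈ P.nodes \ {n} → R.tail a ∈ P.nodes \ {n} := fun a ha =>
    ⟨P.up a ha.1, fun h => hter a h ha.1⟩
  have hu : ∀ a, R.tail a = n → a = c := fun a ha =>
    eq_of_tail_eq (ha.trans hc.symm) (by rw [ha, hl]; simp)
  let γ : List R.Arc := arcList fun a => R.tail a ∈ P.nodes \ {n} ∧ R.head a ∉ P.nodes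
  have hγ : ∀ a, a ∈ γ ↔ R.tail a ∈ P.nodes \ {n} ∧ R.head a ∉ P.nodes := fun a => mem_arcList
  have hL := R.head_left n (Or.inr hl)
  have hR := R.head_right n (Or.inr hl)
  have htop : ∀ a, R.head a = n → R.tail a ∈ P.nodes \ {n} := fun a ha =>
    ⟨P.up a (ha ▸ hnP), fun h => hter a h (ha ▸ hnP)⟩
  let P₁ := P.restrict (P.nodes \ {n}) Set.sdiff_subset hup
    (γ ++ [R.left n (Or.inr hl), R.right n (Or.inr hl)])
    (by
      refine List.nodup_append.2 ⟨nodup_arcList _, by simpa using R.left_ne_right n _, ?_⟩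
      rintro a ha b hb rfl
      have h1 := ((hγ a).1 ha).2
      simp only [List.mem_cons, List.not_mem_nil, or_false] at hb
      rcases hb with rfl | rfl
      · exact h1 (hL.symm ▸ hnP)
      · exact h1 (hR.symm ▸ hnP))
    (by
      intro a
      simp only [List.mem_append, hγ, List.mem_cons, List.not_mem_nil, or_false]
      constructor
      · rintro (⟨h1, h2⟩ | rfl | rfl)
        · exact ⟨h1, fun h => h2 h.1⟩
        · exact ⟨htop _ hL, fun h => h.2 hL⟩
        · exact ⟨htop _ hR, fun h => h.2 hR⟩
      · rintro ⟨h1, h2⟩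
        by_cases h : R.head a = n
        · exact Or.inr (eq_left_or_eq_right _ h)
        · exact Or.inl ⟨h1, fun h3 => h2 ⟨h3, h⟩⟩)
  let P' := P.restrict P.nodes subset_rfl P.up (γ ++ [c])
    (by
      refine List.nodup_append.2 ⟨nodup_arcList _, List.nodup_singleton _, ?_⟩
      rintro a ha b hb rfl
      rw [List.mem_singleton] at hb
      exact ((hγ a).1 ha).1.2 (by rw [hb, hc]; rfl))
    (by
      intro a
      rw [List.mem_append, List.mem_singleton, hγ]
      constructor
      · rintro (⟨h1, h2⟩ | rfl)
        · exact ⟨h1.1, h2⟩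
        · exact ⟨hc ▸ hnP, hter _ hc⟩
      · rintro ⟨h1, h2⟩
        by_cases h : R.tail a = n
        · exact Or.inr (hu a h)
        · exact Or.inl ⟨⟨h1, h⟩, h2⟩)
  obtain ⟨r1, r2⟩ := hrec P₁ rfl
  have : P'.Sequentializable J hJ := r2.par hF hl hnP rfl hc rfl rfl r1
  exact this.of_nodes_eq hF rfl (hjP.congr rfl)

/-- A piece is sequentializable if it is made of a terminal `⊗` node and two sequentializable
pieces. -/
theorem sequentializable_of_tensor (hF : R.InFragment NBT) {n : R.Node} (hnP : n ∈ P.nodes)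
    (hl : R.label n = .tensor) (hter : P.IsTerminal n) (hjP : P.JumpClosed J) {N₁ N₂ : Set R.Node}
    (hup₁ : ∀ a, R.head a ∈ N₁ → R.tail a ∈ N₁) (hup₂ : ∀ a, R.head a ∈ N₂ → R.tail a ∈ N₂)
    (hdis : Disjoint N₁ N₂) (hn₁ : n ∉ N₁) (hn₂ : n ∉ N₂) (hN : P.nodes = N₁ ∪ N₂ ∪ {n})
    (hL : R.tail (R.left n (Or.inl hl)) ∈ N₁) (hR : R.tail (R.right n (Or.inl hl)) ∈ N₂)
    (hrec₁ : ∀ P₁ : R.Piece, P₁.nodes = N₁ → P₁.JumpClosed J ∧ P₁.Sequentializable J hJ)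
    (hrec₂ : ∀ P₂ : R.Piece, P₂.nodes = N₂ → P₂.JumpClosed J ∧ P₂.Sequentializable J hJ) :
    P.Sequentializable J hJ := by
  obtain ⟨c, hc⟩ := exists_tail_eq (n := n) (by simp [hl]) (by simp [hl])
  have hu : ∀ a, R.tail a = n → a = c := fun a ha =>
    eq_of_tail_eq (ha.trans hc.symm) (by rw [ha, hl]; simp)
  have hsub₁ : N₁ ⊆ P.nodes := hN ▸ fun x hx => Or.inl (Or.inl hx)
  have hsub₂ : N₂ ⊆ P.nodes := hN ▸ fun x hx => Or.inl (Or.inr hx)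
  rw [Set.disjoint_left] at hdis
  let γ : List R.Arc := arcList fun a => R.tail a ∈ N₁ ∧ R.head a ∉ P.nodes
  let δ : List R.Arc := arcList fun a => R.tail a ∈ N₂ ∧ R.head a ∉ P.nodes
  have hγ : ∀ a, a ∈ γ ↔ R.tail a ∈ N₁ ∧ R.head a ∉ P.nodes := fun a => mem_arcList
  have hδ : ∀ a, a ∈ δ ↔ R.tail a ∈ N₂ ∧ R.head a ∉ P.nodes := fun a => mem_arcList
  have hL' := R.head_left n (Or.inl hl)
  have hR' := R.head_right n (Or.inl hl)
  let P₁ := P.restrict N₁ hsub₁ hup₁ (γ ++ [R.left n (Or.inl hl)])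
    (by
      refine List.nodup_append.2 ⟨nodup_arcList _, List.nodup_singleton _, ?_⟩
      rintro a ha b hb rfl
      rw [List.mem_singleton] at hb
      exact ((hγ a).1 ha).2 (by rw [hb, hL']; exact hnP))
    (by
      intro a
      rw [List.mem_append, List.mem_singleton, hγ]
      constructor
      · rintro (⟨h1, h2⟩ | rfl)
        · exact ⟨h1, fun h => h2 (hsub₁ h)⟩
        · exact ⟨hL, by rwa [hL']⟩
      · rintro ⟨h1, h2⟩
        by_cases h : R.head a ∈ P.nodes
        · rw [hN] at h
          rcases h with (h | h) | h
          · exact absurd h h2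
          · exact absurd (hup₂ a h) (hdis h1)
          · rcases eq_left_or_eq_right (Or.inl hl) h with rfl | rfl
            · exact Or.inr rfl
            · exact absurd hR (hdis h1)
        · exact Or.inl ⟨h1, h⟩)
  let P₂ := P.restrict N₂ hsub₂ hup₂ (R.right n (Or.inl hl) :: δ)
    (by
      refine List.nodup_cons.2 ⟨fun h => ?_, nodup_arcList _⟩
      exact ((hδ _).1 h).2 (by rw [hR']; exact hnP))
    (by
      intro a
      rw [List.mem_cons, hδ]
      constructor
      · rintro (rfl | ⟨h1, h2⟩)
        · exact ⟨hR, by rwa [hR']⟩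
        · exact ⟨h1, fun h => h2 (hsub₂ h)⟩
      · rintro ⟨h1, h2⟩
        by_cases h : R.head a ∈ P.nodes
        · rw [hN] at h
          rcases h with (h | h) | h
          · exact absurd h1 (hdis (hup₁ a h))
          · exact absurd h h2
          · rcases eq_left_or_eq_right (Or.inl hl) h with rfl | rfl
            · exact absurd h1 (hdis hL)
            · exact Or.inl rfl
        · exact Or.inr ⟨h1, h⟩)
  let P' := P.restrict P.nodes subset_rfl P.up (γ ++ c :: δ)
    (by
      refine List.nodup_append.2 ⟨nodup_arcList _, List.nodup_cons.2 ⟨fun h => ?_,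
        nodup_arcList _⟩, ?_⟩
      · exact hn₂ (hc ▸ ((hδ c).1 h).1)
      · rintro a ha b hb rfl
        rw [List.mem_cons] at hb
        have h1 := ((hγ a).1 ha).1
        rcases hb with rfl | hb
        · exact hn₁ (hc ▸ h1)
        · exact hdis h1 ((hδ a).1 hb).1)
    (by
      intro a
      rw [List.mem_append, List.mem_cons, hγ, hδ]
      constructor
      · rintro (⟨h1, h2⟩ | rfl | ⟨h1, h2⟩)
        · exact ⟨hsub₁ h1, h2⟩
        · exact ⟨hc ▸ hnP, hter _ hc⟩
        · exact ⟨hsub₂ h1, h2⟩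
      · rintro ⟨h1, h2⟩
        rw [hN] at h1
        rcases h1 with (h1 | h1) | h1
        · exact Or.inl ⟨h1, h2⟩
        · exact Or.inr (Or.inr ⟨h1, h2⟩)
        · exact Or.inr (Or.inl (hu a h1)))
  obtain ⟨r1, r2⟩ := hrec₁ P₁ rfl
  obtain ⟨r3, r4⟩ := hrec₂ P₂ rfl
  have : P'.Sequentializable J hJ := r2.tensor hF r4 hl hnP hN (Set.disjoint_left.2 hdis) hn₁ hn₂
    hc rfl rfl rfl r1 r3
  exact this.of_nodes_eq hF rfl (hjP.congr rfl)

/-- A piece made of one `ax` or `1` node is sequentializable. -/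
theorem sequentializable_of_singleton (hF : R.InFragment NBT) {n : R.Node} (hn : P.nodes = {n})
    (hl : R.label n = .ax ∨ R.label n = .one) (hjP : P.JumpClosed J) :
    P.Sequentializable J hJ := by
  have hhead : ∀ a, R.head a ≠ n := fun a ha =>
    label_head_ne_of_numPremises_eq_zero ha (by rcases hl with h | h <;> rw [h] <;> rfl)
  have hmem : ∀ a, R.tail a = n ↔ R.tail a ∈ P.nodes ∧ R.head a ∉ P.nodes := by
    intro a
    rw [hn]
    exact ⟨fun h => ⟨h, hhead a⟩, fun h => h.1⟩
  have hcard := R.card_conclusions n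
  rcases hl with hl | hl
  · rw [hl] at hcard
    obtain ⟨a, b, hab, h⟩ := Set.ncard_eq_two.1 hcard
    let P' := P.restrict P.nodes subset_rfl P.up [a, b] (by simpa using hab) (by
      intro x
      rw [← hmem]
      have : x ∈ {a | R.tail a = n} ↔ x ∈ ({a, b} : Set R.Arc) := by rw [h]
      simpa using this.symm)
    have : P'.Sequentializable J hJ := sequentializable_ax hF hl hn rfl
    exact this.of_nodes_eq hF rfl (hjP.congr rfl)
  · rw [hl] at hcard
    obtain ⟨a, h⟩ := Set.ncard_eq_one.1 hcard
    let P' := P.restrict P.nodes subset_rfl P.up [a] (by simp) (by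
      intro x
      rw [← hmem]
      have : x ∈ {a | R.tail a = n} ↔ x ∈ ({a} : Set R.Arc) := by rw [h]
      simpa using this.symm)
    have : P'.Sequentializable J hJ := sequentializable_one hF hl hn rfl
    exact this.of_nodes_eq hF rfl (hjP.congr rfl)

end Steps

end Piece

end ProofStructure

namespace ProofStructure

namespace Piece

variable {R : ProofStructure} {P : R.Piece}

/-! ### Sequentialization of pieces -/

theorem up_core (hF : R.InFragment NBT) (hcut : R.CutFree) (hAC : R.AC) :
    (R.switchingSystem hF hcut hAC).Up P.core := by
  intro a ha hh
  rw [mem_core] at hh ⊢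
  exact ⟨P.up a hh.1, (mem_mainArcs.1 ha).1⟩

/-- The removal of an erasing node keeps the targets of the canonical jumps. -/
theorem jumpClosed_of_erasing (hF : R.InFragment NBT) (hcut : R.CutFree) {m : R.Node}
    (hm : ¬ R.Erasing m) (hj : P.JumpClosed (R.canonicalJump m)) {n : R.Node} (hn : R.Erasing n)
    {x y : R.Node} (hx : x ∈ P.nodes) (h : R.canonicalJump m x = some y) :
    y ∈ P.nodes \ {n} ∨ R.label y = .bullet ∧ ∃ a, R.tail a ∈ P.nodes \ {n} ∧ R.head a = y := by
  have hy := not_erasing_of_canonicalJump hF hcut hm h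
  rcases hj x hx y h with h1 | ⟨h1, a, h2, rfl⟩
  · exact Or.inl ⟨h1, fun h2 => hy (h2 ▸ hn)⟩
  · exact Or.inr ⟨h1, a, ⟨h2, fun h3 => not_erasing_tail_of_bullet h1 hy (h3 ▸ hn)⟩, rfl⟩

theorem core_eq_of_erasing {P₁ : R.Piece} {n : R.Node} (hn : R.Erasing n)
    (h : P₁.nodes = P.nodes \ {n}) : P₁.core = P.core := by
  ext x
  rw [mem_core, mem_core, h]
  constructor
  · exact fun h => ⟨h.1.1, h.2⟩
  · exact fun h => ⟨⟨h.1, fun h' => h.2 (h' ▸ hn)⟩, h.2⟩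

/-- A piece without terminal `⅋` node, and with a node that has a non-erasing premise, has a
splitting `⊗` node. -/
theorem exists_splitting (hF : R.InFragment NBT) (hcut : R.CutFree) (hAC : R.AC)
    (hw : (R.switchingSystem hF hcut hAC).weight P.core = 1)
    (hpar : ∀ n ∈ P.nodes, R.label n = .par → ¬ P.IsTerminal n)
    (hne : ∃ c ∈ R.mainArcs, R.head c ∈ P.core) :
    ∃ (n : R.Node) (hl : R.label n = .tensor) (A B : Finset R.Node),
      n ∈ P.nodes ∧ P.IsTerminal n ∧
      (R.switchingSystem hF hcut hAC).Up A ∧ (R.switchingSystem hF hcut hAC).Up B ∧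
      Disjoint A B ∧ n ∉ A ∧ n ∉ B ∧ A ∪ B ∪ {n} = P.core ∧
      R.tail (R.left n (Or.inl hl)) ∈ A ∧ R.tail (R.right n (Or.inl hl)) ∈ B ∧
      (R.switchingSystem hF hcut hAC).weight A = 1 ∧
      (R.switchingSystem hF hcut hAC).weight B = 1 := by
  -- Every arc from a non-erasing node to a node of the piece is a main arc, so being terminal in
  -- the core and in the piece are the same.
  have hterm : ∀ n ∈ P.core, (R.switchingSystem hF hcut hAC).Terminal P.core n →
      P.IsTerminal n := by
    rintro n hn ht a rfl haP
    have h1 : ¬ R.Erasing (R.tail a) := (mem_core.1 hn).2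
    exact ht a (mem_mainArcs.2 ⟨h1, P.ne_bullet _ haP⟩) rfl
      (mem_core.2 ⟨haP, not_erasing_head h1⟩)
  have hT : ∀ c ∈ R.mainArcs, R.head c ∈ P.core →
      (R.switchingSystem hF hcut hAC).Terminal P.core (R.head c) →
      R.label (R.head c) = .tensor := by
    intro c hc hcP ht
    have h1 := label_head_ne_of_numPremises_eq_zero (R := R) (a := c) rfl
    have h2 := hcut (R.head c)
    have h3 := (mem_mainArcs.1 hc).2
    have h4 : R.label (R.head c) ≠ .par := fun h =>
      hpar _ (mem_core.1 hcP).1 h (hterm _ hcP ht)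
    cases hl : R.label (R.head c) <;> simp_all [Label.numPremises]
  obtain ⟨n, a, b, A, B, h1, h2, h3, h4, h5, h6, h7, h8, h9, h10, h11, h12, h13⟩ :=
    SwitchingSystem.exists_splitting (up_core hF hcut hAC) hw
      (fun c hc hcP ht => ⟨_, _, isTensor_switchingSystem hF hcut hAC (hT c hc hcP ht)⟩) hne
  obtain rfl := h3.head_left
  have hl : R.label (R.head a) = .tensor := hT a h3.mem_left h1 h2
  have hlr := (isTensor_switchingSystem hF hcut hAC hl)
  have ha := eq_left_or_eq_right (a := a) (Or.inl hl) rfl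
  have hb := eq_left_or_eq_right (a := b) (Or.inl hl) h3.head_right
  have hnP := (mem_core.1 h1).1
  have hnt := hterm _ h1 h2
  have hab := h3.ne
  -- A switching system does not distinguish left and right premises, so the two halves may have to
  -- be exchanged.
  rcases ha with ha | ha
  · have hb : b = R.right (R.head a) (Or.inl hl) := hb.resolve_left fun h => hab (ha.trans h.symm)
    refine ⟨R.head a, hl, A, B, hnP, hnt, h4, h5, h6, h7, h8, h9, ?_, ?_, h12, h13⟩
    · rw [← ha]; exact h10
    · rw [← hb]; exact h11
  · have hb : b = R.left (R.head a) (Or.inl hl) := hb.resolve_right fun h => hab (ha.trans h.symm)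
    refine ⟨R.head a, hl, B, A, hnP, hnt, h5, h4, h6.symm, h8, h7, ?_, ?_, ?_, h13, h12⟩
    · rw [Finset.union_comm B A]; exact h9
    · rw [← hb]; exact h11
    · rw [← ha]; exact h10

/-- The nodes of the piece above the nodes of `A`. -/
def above (P : R.Piece) (A : Finset R.Node) : Set R.Node :=
  {x | x ∈ P.nodes ∧ ∃ w ∈ A, Relation.ReflTransGen R.Step x w}

theorem above_up (A : Finset R.Node) (a : R.Arc) (h : R.head a ∈ P.above A) :
    R.tail a ∈ P.above A := by
  obtain ⟨h1, w, hw, h2⟩ := h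
  exact ⟨P.up a h1, w, hw, .head ⟨a, rfl, rfl⟩ h2⟩

variable {hF : R.InFragment NBT} {hcut : R.CutFree} {hAC : R.AC}

/-- All the nodes below a non-erasing node are non-erasing, so the path runs along main arcs and `A`
can be followed upwards. -/
theorem mem_of_reflTransGen {A : Finset R.Node} (hA : (R.switchingSystem hF hcut hAC).Up A)
    (hAP : A ⊆ P.core) {x w : R.Node} (hx : ¬ R.Erasing x) (hw : w ∈ A)
    (h : Relation.ReflTransGen R.Step x w) : x ∈ A := by
  induction h using Relation.ReflTransGen.head_induction_on with
  | refl => exact hw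
  | head h h' ih =>
    obtain ⟨a, rfl, rfl⟩ := h
    have h1 := ih (not_erasing_head hx)
    exact hA a (mem_mainArcs.2 ⟨hx, P.ne_bullet _ (mem_core.1 (hAP h1)).1⟩) h1

theorem mem_above_iff {A : Finset R.Node} (hA : (R.switchingSystem hF hcut hAC).Up A)
    (hAP : A ⊆ P.core) {x : R.Node} (hx : ¬ R.Erasing x) : x ∈ P.above A ↔ x ∈ A := by
  constructor
  · rintro ⟨-, w, hw, h⟩
    exact mem_of_reflTransGen hA hAP hx hw h
  · exact fun h => ⟨(mem_core.1 (hAP h)).1, x, h, .refl⟩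

/-- As long as the node is erasing, the paths to `A` and to `B` share their first arc. At the first
non-erasing node, they show that it belongs to both sets. -/
theorem disjoint_above {A B : Finset R.Node} (hA : (R.switchingSystem hF hcut hAC).Up A)
    (hB : (R.switchingSystem hF hcut hAC).Up B) (hAP : A ⊆ P.core) (hBP : B ⊆ P.core)
    (hdis : Disjoint A B) : Disjoint (P.above A) (P.above B) := by
  rw [Set.disjoint_left]
  rintro x ⟨-, w, hw, h⟩ ⟨-, w', hw', h'⟩
  rw [Finset.disjoint_left] at hdis
  induction h using Relation.ReflTransGen.head_induction_on with
  | refl => exact hdis hw (mem_of_reflTransGen hB hBP (mem_core.1 (hAP hw)).2 hw' h')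
  | head h h1 ih =>
    obtain ⟨a, rfl, rfl⟩ := h
    by_cases he : R.Erasing (R.tail a)
    · rcases Relation.ReflTransGen.cases_head h' with h2 | ⟨z, ⟨b, hb, rfl⟩, h2⟩
      · exact (mem_core.1 (hBP hw')).2 (h2 ▸ he)
      · rw [← he.eq_of_tail_eq hb.symm] at h2
        exact ih h2
    · exact hdis (mem_of_reflTransGen hA hAP he hw (.head ⟨a, rfl, rfl⟩ h1))
        (mem_of_reflTransGen hB hBP he hw' h')

theorem core_eq_of_above {P₁ : R.Piece} {A : Finset R.Node}
    (hA : (R.switchingSystem hF hcut hAC).Up A) (hAP : A ⊆ P.core) (h : P₁.nodes = P.above A) :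
    P₁.core = A := by
  ext x
  rw [mem_core, h]
  constructor
  · exact fun h => (mem_above_iff hA hAP h.2).1 h.1
  · intro h
    have hx := (mem_core.1 (hAP h)).2
    exact ⟨(mem_above_iff hA hAP hx).2 h, hx⟩

/-- Induction on the number of nodes, with two invariants: the core has weight `1`, and jumps stay
in the piece. Once terminal erasing nodes are excluded, `canonicalJump_spec` ties each jump to a `⅋`
of the piece below its source, which preserves the second invariant in the `⅋` and `⊗` steps. -/
theorem sequentializable_of_weight (hF : R.InFragment NBT) (hcut : R.CutFree) (hAC : R.AC)
    {m : R.Node} (hm : ¬ R.Erasing m) (P : R.Piece) (hj : P.JumpClosed (R.canonicalJump m))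
    (hw : (R.switchingSystem hF hcut hAC).weight P.core = 1) :
    P.Sequentializable (R.canonicalJump m) (R.canonicalExt m).jump_bot := by
  induction hk : P.nodes.ncard using Nat.strong_induction_on generalizing P with
  | _ k ih =>
  subst hk
  have hlt : ∀ N : Set R.Node, N ⊆ P.nodes → ∀ n ∈ P.nodes, n ∉ N → N.ncard < P.nodes.ncard :=
    fun N hN n hn hnN => Set.ncard_lt_ncard ⟨hN, fun h => hnN (h hn)⟩ (Set.toFinite _)
  by_cases hE : ∀ n ∈ P.nodes, R.Erasing n → ¬ P.IsTerminal n
  swap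
  · push Not at hE
    obtain ⟨n, hnP, hne, hter⟩ := hE
    have hrec : ∀ P₁ : R.Piece, P₁.nodes = P.nodes \ {n} →
        P₁.JumpClosed (R.canonicalJump m) ∧
          P₁.Sequentializable (R.canonicalJump m) (R.canonicalExt m).jump_bot := by
      intro P₁ h₁
      have hj₁ : P₁.JumpClosed (R.canonicalJump m) := by
        intro x hx y hxy
        rw [h₁] at hx ⊢
        exact jumpClosed_of_erasing hF hcut hm hj hne hx.1 hxy
      refine ⟨hj₁, ih _ ?_ P₁ hj₁ (by rw [core_eq_of_erasing hne h₁, hw]) rfl⟩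
      exact h₁ ▸ hlt _ Set.sdiff_subset n hnP (by simp)
    rcases hne.label with hl | hl | hl
    · have hJ : ∃ x, R.canonicalJump m n = some x := by
        by_cases hwp : n ∈ R.wPar
        · obtain ⟨x, hx, -⟩ := canonicalJump_of_mem_wPar hF hcut m hwp
          exact ⟨x, hx⟩
        · exact ⟨m, canonicalJump_of_notMem_wPar m hl hwp⟩
      obtain ⟨x, hx⟩ := hJ
      refine sequentializable_of_bot hF hnP hl hter hj hx fun P₁ h₁ => ⟨(hrec P₁ h₁).1, ?_,
        (hrec P₁ h₁).2⟩
      rw [h₁]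
      exact jumpClosed_of_erasing hF hcut hm hj hne hnP hx
    · exact sequentializable_of_par hF hnP hl hter hj hrec
    · exact absurd hl (P.ne_bullet n hnP)
  by_cases hpar : ∀ n ∈ P.nodes, R.label n = .par → ¬ P.IsTerminal n
  swap
  · push Not at hpar
    obtain ⟨n, hnP, hl, hter⟩ := hpar
    have hne : ¬ R.Erasing n := fun h => hE n hnP h hter
    refine sequentializable_of_par hF hnP hl hter hj fun P₁ h₁ => ?_
    have hj₁ : P₁.JumpClosed (R.canonicalJump m) := by
      intro x hx y hxy
      rw [h₁] at hx ⊢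
      obtain ⟨c, rfl, h2, -⟩ := canonicalJump_spec hF hcut hE hx.1 hxy
      -- The target is the tail of an arc to a node of the piece, so it is not the terminal node
      -- `n`.
      exact Or.inl ⟨P.up c h2, fun h => hter c h h2⟩
    refine ⟨hj₁, ih _ (h₁ ▸ hlt _ Set.sdiff_subset n hnP (by simp)) P₁ hj₁ ?_ rfl⟩
    have hcore : P₁.core = P.core.erase n := by
      ext x
      rw [mem_core, h₁, Finset.mem_erase, mem_core]
      simp only [Set.mem_sdiff, Set.mem_singleton_iff]
      tauto
    have h0 : R.nodeWeight n = 0 := by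
      unfold nodeWeight
      rw [if_neg (by rw [hl]; simp), if_pos ⟨hl, hne⟩]
    rw [hcore, ← hw]
    exact Finset.sum_erase _ h0
  by_cases harc : ∃ c ∈ R.mainArcs, R.head c ∈ P.core
  · obtain ⟨n, hl, A, B, hnP, hter, hA, hB, hdis, hnA, hnB, hAB, hLA, hRB, hwA, hwB⟩ :=
      exists_splitting hF hcut hAC hw hpar harc
    have hAP : A ⊆ P.core := fun x hx => hAB ▸ by simp [hx]
    have hBP : B ⊆ P.core := fun x hx => hAB ▸ by simp [hx]
    have hnc : ¬ R.Erasing n := fun h => hE n hnP h hter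
    have hdis' := disjoint_above hA hB hAP hBP hdis
    have hn₁ : n ∉ P.above A := fun h => hnA ((mem_above_iff hA hAP hnc).1 h)
    have hn₂ : n ∉ P.above B := fun h => hnB ((mem_above_iff hB hBP hnc).1 h)
    -- An erasing node lies above a `⅋` of the core. This is not the tensor `n`, so it is in `A` or
    -- in `B`.
    have hN : P.nodes = P.above A ∪ P.above B ∪ {n} := by
      ext x
      constructor
      · intro hx
        by_cases hxe : R.Erasing x
        · obtain ⟨q, hq, hqe, hqp, hxq⟩ := exists_core_below hF hcut hE hx hxe
          have hqc : q ∈ A ∪ B ∪ {n} := hAB ▸ mem_core.2 ⟨hq, hqe⟩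
          simp only [Finset.mem_union, Finset.mem_singleton] at hqc
          rcases hqc with (h | h) | h
          · exact Or.inl (Or.inl ⟨hx, q, h, hxq.to_reflTransGen⟩)
          · exact Or.inl (Or.inr ⟨hx, q, h, hxq.to_reflTransGen⟩)
          · rw [h, hl] at hqp
            cases hqp
        · have hxc : x ∈ A ∪ B ∪ {n} := hAB ▸ mem_core.2 ⟨hx, hxe⟩
          simp only [Finset.mem_union, Finset.mem_singleton] at hxc
          rcases hxc with (h | h) | h
          · exact Or.inl (Or.inl ((mem_above_iff hA hAP hxe).2 h))
          · exact Or.inl (Or.inr ((mem_above_iff hB hBP hxe).2 h))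
          · exact Or.inr h
      · rintro ((h | h) | h)
        · exact h.1
        · exact h.1
        · exact h ▸ hnP
    have hrec : ∀ C D : Finset R.Node, (R.switchingSystem hF hcut hAC).Up C → C ⊆ P.core →
        D ⊆ P.core → (R.switchingSystem hF hcut hAC).weight C = 1 → n ∉ P.above C →
        Disjoint (P.above C) (P.above D) → (∀ x ∈ P.core, x ∈ C ∨ x ∈ D ∨ x = n) →
        ∀ P₁ : R.Piece, P₁.nodes = P.above C → P₁.JumpClosed (R.canonicalJump m) ∧
          P₁.Sequentializable (R.canonicalJump m) (R.canonicalExt m).jump_bot := by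
      intro C D hC hCP hDP hwC hnC hCD hcov P₁ h₁
      have hsub : P.above C ⊆ P.nodes := fun x hx => hx.1
      have hj₁ : P₁.JumpClosed (R.canonicalJump m) := by
        intro x hx y hxy
        rw [h₁] at hx ⊢
        obtain ⟨c, rfl, h2, h3, h4, h5⟩ := canonicalJump_spec hF hcut hE hx.1 hxy
        refine Or.inl (above_up C c ?_)
        -- The `⅋` that determines the jump is below `x`. It is not `n`, and in `D` it would put `x`
        -- above both halves, so it is in `C` and its premises are above `C`.
        rcases hcov _ (mem_core.2 ⟨h2, h4⟩) with h | h | h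
        · exact ⟨h2, _, h, .refl⟩
        · exact absurd ⟨hx.1, _, h, h5.to_reflTransGen⟩ (Set.disjoint_left.1 hCD hx)
        · rw [h, hl] at h3
          cases h3
      refine ⟨hj₁, ih _ (h₁ ▸ hlt _ hsub n hnP hnC) P₁ hj₁ ?_ rfl⟩
      rw [core_eq_of_above hC hCP h₁, hwC]
    have hcov : ∀ x ∈ P.core, x ∈ A ∨ x ∈ B ∨ x = n := by
      intro x hx
      rw [← hAB] at hx
      simpa only [Finset.mem_union, Finset.mem_singleton, or_assoc] using hx
    refine sequentializable_of_tensor hF hnP hl hter hj (above_up A) (above_up B) hdis' hn₁ hn₂ hN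
      ⟨(mem_core.1 (hAP hLA)).1, _, hLA, .refl⟩ ⟨(mem_core.1 (hBP hRB)).1, _, hRB, .refl⟩
      (hrec A B hA hAP hBP hwA hn₁ hdis' hcov) (hrec B A hB hBP hAP hwB hn₂ hdis'.symm ?_)
    intro x hx
    have := hcov x hx
    tauto
  · push Not at harc
    -- With no main premise in the core, only `ax` and `1` nodes remain there. Each weighs `1`, so
    -- there is a single one, and no erasing node is left for want of a `⅋` to be above.
    have hlab : ∀ n ∈ P.core, R.label n = .ax ∨ R.label n = .one := by
      intro n hn
      have h1 := mem_core.1 hn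
      have h2 := P.ne_bullet n h1.1
      have h3 : R.label n ≠ .tensor := fun h =>
        harc _ (isTensor_switchingSystem hF hcut hAC h).mem_left
          ((R.head_left n (Or.inl h)).symm ▸ hn)
      have h4 : R.label n ≠ .par := fun h => by
        obtain ⟨a, rfl, ha⟩ := exists_not_erasing_tail h h1.2
        exact harc a (mem_mainArcs.2 ⟨ha, h2⟩) hn
      have h5 : R.label n ≠ .bot := fun h => h1.2 (erasing_of_bot h)
      have h6 := hcut n
      cases hl : R.label n <;> simp_all
    have hcard : P.core.card = 1 := by
      have : ∑ n ∈ P.core, R.nodeWeight n = ∑ n ∈ P.core, 1 := by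
        refine Finset.sum_congr rfl fun n hn => ?_
        rcases hlab n hn with h | h <;> simp [nodeWeight, h]
      have h1 : ∑ n ∈ P.core, R.nodeWeight n = 1 := hw
      rw [this] at h1
      simpa using h1
    obtain ⟨n, hn⟩ := Finset.card_eq_one.1 hcard
    have hnc : n ∈ P.core := by simp [hn]
    refine sequentializable_of_singleton hF ?_ (hlab n hnc) hj
    ext x
    rw [Set.mem_singleton_iff]
    constructor
    · intro hx
      by_cases hxe : R.Erasing x
      · obtain ⟨q, hq, hqe, hqp, -⟩ := exists_core_below hF hcut hE hx hxe
        rcases hlab q (mem_core.2 ⟨hq, hqe⟩) with h | h <;> rw [h] at hqp <;> cases hqp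
      · have : x ∈ P.core := mem_core.2 ⟨hx, hxe⟩
        simpa [hn] using this
    · rintro rfl
      exact (mem_core.1 hnc).1

end Piece

/-! ### The full piece and the main theorem -/

theorem core_fullPiece {R : ProofStructure} : R.fullPiece.core = R.mainNodes := by
  ext x
  rw [Piece.mem_core, mem_mainNodes]
  exact and_comm

/-- This is needed for the lower bound on the weight. If `m` is a `•` node, the node above it is
non-erasing and serves instead. -/
theorem mainNodes_nonempty {R : ProofStructure} {m : R.Node} (hm : ¬ R.Erasing m) :
    R.mainNodes.Nonempty := by
  by_cases hl : R.label m = .bullet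
  · obtain ⟨a, rfl⟩ := exists_head_eq_of_bullet hl
    exact ⟨R.tail a, mem_mainNodes.2 ⟨not_erasing_tail_of_bullet hl hm, label_tail_ne_bullet a⟩⟩
  · exact ⟨m, mem_mainNodes.2 ⟨hm, hl⟩⟩

end ProofStructure

end LL

theorem mainTheorem4 (R : LL.ProofStructure) (hF : R.InFragment LL.NBT) (hcut : R.CutFree)
    (hJ : R.JumpFree) (hR : R.ACCw) (m : R.Node) (hm : ¬ R.Erasing m) :
    ∃ π : LL.Proof (R.concl.map R.ty),
      π.CutFree ∧ π.InFragment LL.NBT ∧ LL.Deseq π (R.canonicalExt m) := by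
  have hup := LL.ProofStructure.Piece.up_core (P := R.fullPiece) hF hcut hR.1
  -- Acyclicity gives weight at least `1`, and the number of components gives at most `1`.
  have hpos := hup.weight_pos (LL.ProofStructure.core_fullPiece ▸
    LL.ProofStructure.mainNodes_nonempty hm)
  have hle : (R.switchingSystem hF hcut hR.1).weight R.fullPiece.core ≤ 1 := by
    rw [LL.ProofStructure.core_fullPiece]
    exact LL.ProofStructure.sum_nodeWeight_mainNodes hcut hJ hR.2
  obtain ⟨Γ, π, rfl, h1, h2, h3⟩ := LL.ProofStructure.Piece.sequentializable_of_weight hF hcut hR.1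
    hm R.fullPiece LL.ProofStructure.jumpClosed_fullPiece (le_antisymm hle hpos)
  exact ⟨π, h1, h2, h3.rename (LL.ProofStructure.isRenaming_fullPieceRenaming m) h1⟩
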